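/- Let $k,t\in\mathbb{C}$ with $k\neq 0,\pm1$ and $t\neq 0$. On $\mathbb{P}^1\times\mathbb{P}^1$ over $\mathbb{C}$ use the affine coordinates $x=x_1/x_0$, $y=y_1/y_0$. Then the formula $$\varphi(x,y)=\left(\frac{(x-k)(x+k)\,y}{k^2-x^2+2txy},\;x\right)$$ defines a birational map $\varphi:\mathbb{P}^1\times\mathbb{P}^1\dashrightarrow\mathbb{P}^1\times\mathbb{P}^1$, and there are a smooth projective rational surface $S$ and a birational morphism $\varepsilon:S\to\mathbb{P}^1\times\mathbb{P}^1$ such that $\varphi$ lifts to an automorphism of $S$, that is, the birational map $\tilde\varphi=\varepsilon^{-1}\circ\varphi\circ\varepsilon$ of $S$ is an automorphism. Moreover, $S=\mathrm{Bl}_{b_8}\cdots\mathrm{Bl}_{b_1}(\mathbb{P}^1\times\mathbb{P}^1)$, with $\varepsilon$ the composition of the eight blow-ups, each centred at a point, namely: - $b_1:(x,y)=(k,0)$, and $b_2$ is the point of the exceptional curve over $b_1$ at which $(x-k)/y=t$; - $b_3:(x,y)=(-k,0)$, and $b_4$ is the point of the exceptional curve over $b_3$ at which $(x+k)/y=t$;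 - $b_5:(x,y)=(0,k)$, and $b_6$ is the point of the exceptional curve over $b_5$ at which $(y-k)/x=t$; - $b_7:(x,y)=(0,-k)$, and $b_8$ is the point of the exceptional curve over $b_7$ at which $(y+k)/x=t$. (Here $b_3,b_5,b_7$ are regarded as points of the surfaces obtained by the preceding blow-ups, which are isomorphisms near them.) -/

import Mathlib

noncomputable section

namespace ClassicalAG

/-! Classical algebraic geometry over the complex numbers. Projective spaces are indexed by a finite
set of homogeneous coordinates. Functions and maps are total functions on the ambient projective
space; only their values on the set under consideration are ever used. -/

/-- The projective space with homogeneous coordinates indexed by `ι`;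
`PSp (Fin (n + 1))` is `ℙⁿ`. -/
abbrev PSp (ι : Type) : Type := Projectivization ℂ (ι → ℂ)

/-- The value of a polynomial at the chosen representative of a point. It is only used for the
vanishing of homogeneous polynomials and for quotients of homogeneous polynomials of equal degree,
which do not depend on the representative. -/
def val {ι : Type} (f : MvPolynomial ι ℂ) (p : PSp ι) : ℂ := MvPolynomial.eval p.rep f

/-- The common zeros of a set of polynomials. -/
def zeroLocus {ι : Type} (A : Set (MvPolynomial ι ℂ)) : Set (PSp ι) :=
  {p | ∀ f ∈ A, val f p = 0}

/-- `f` is a homogeneous polynomial (of some degree). -/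
def IsForm {ι : Type} (f : MvPolynomial ι ℂ) : Prop := ∃ d : ℕ, f.IsHomogeneous d

/-- The Zariski topology: the closed sets are the zero loci of sets of homogeneous polynomials. -/
instance zariski (ι : Type) : TopologicalSpace (PSp ι) :=
  TopologicalSpace.ofClosed
    {Z | ∃ A : Set (MvPolynomial ι ℂ), (∀ f ∈ A, IsForm f) ∧ Z = zeroLocus A}
    ⟨{1}, by
        rintro f rfl
        exact ⟨0, MvPolynomial.isHomogeneous_one _ _⟩, by
        ext p
        simp [zeroLocus, val]⟩
    (by
      intro 𝒵 h𝒵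
      refine ⟨{f | IsForm f ∧ ∃ Z ∈ 𝒵, ∀ p ∈ Z, val f p = 0}, fun f hf => hf.1, ?_⟩
      ext p
      constructor
      · rintro hp f ⟨-, Z, hZ, hf⟩
        exact hf p (hp Z hZ)
      · intro hp Z hZ
        obtain ⟨A, hA, rfl⟩ := h𝒵 hZ
        exact fun f hf => hp f ⟨hA f hf, _, hZ, fun q hq => hq f hf⟩)
    (by
      rintro _ ⟨A, hA, rfl⟩ _ ⟨B, hB, rfl⟩
      refine ⟨{h | ∃ f ∈ A, ∃ g ∈ B, h = f * g}, ?_, ?_⟩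
      · rintro _ ⟨f, hf, g, hg, rfl⟩
        obtain ⟨d, hd⟩ := hA f hf
        obtain ⟨e, he⟩ := hB g hg
        exact ⟨d + e, hd.mul he⟩
      · ext p
        constructor
        · rintro (hp | hp)
          · rintro _ ⟨f, hf, g, -, rfl⟩
            simp [val, show MvPolynomial.eval p.rep f = 0 from hp f hf]
          · rintro _ ⟨f, -, g, hg, rfl⟩
            simp [val, show MvPolynomial.eval p.rep g = 0 from hp g hg]
        · intro hp
          by_contra hcon
          rw [Set.mem_union, not_or] at hcon
          obtain ⟨h1, h2⟩ := hcon
          simp only [zeroLocus, Set.mem_ofPred_eq, not_forall] at h1 h2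
          obtain ⟨f, hf, hf0⟩ := h1
          obtain ⟨g, hg, hg0⟩ := h2
          have := hp _ ⟨f, hf, g, hg, rfl⟩
          simp only [val, map_mul, mul_eq_zero] at this
          exact this.elim hf0 hg0)

theorem isClosed_zeroLocus {ι : Type} (A : Set (MvPolynomial ι ℂ)) (hA : ∀ f ∈ A, IsForm f) :
    IsClosed (zeroLocus A) :=
  ⟨A, hA, compl_compl _⟩

/-- `f` is a regular function on the (locally closed) set `W`: locally on `W` it is a quotient of
two homogeneous polynomials of the same degree with nowhere vanishing denominator. -/
def IsRegularOn {ι : Type} (W : Set (PSp ι)) (f : PSp ι → ℂ) : Prop :=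
  ∀ p ∈ W, ∃ U : Set (PSp ι), IsOpen U ∧ p ∈ U ∧
    ∃ (d : ℕ) (g h : MvPolynomial ι ℂ), g.IsHomogeneous d ∧ h.IsHomogeneous d ∧
      ∀ q ∈ W ∩ U, val h q ≠ 0 ∧ f q = val g q / val h q

/-- `φ` restricts to a morphism from `A` to `B`: it is continuous and pulls back regular functions
on open subsets of `B` to regular functions. -/
def IsMorphism {ι κ : Type} (A : Set (PSp ι)) (B : Set (PSp κ)) (φ : PSp ι → PSp κ) : Prop :=
  Set.MapsTo φ A B ∧ ContinuousOn φ A ∧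
    ∀ (U : Set (PSp κ)) (f : PSp κ → ℂ), IsOpen U → IsRegularOn (B ∩ U) f →
      IsRegularOn (A ∩ φ ⁻¹' U) (f ∘ φ)

/-- `φ` restricts to an isomorphism from `A` to `B`. -/
def IsIsoOn {ι κ : Type} (A : Set (PSp ι)) (B : Set (PSp κ)) (φ : PSp ι → PSp κ) : Prop :=
  IsMorphism A B φ ∧ ∃ ψ : PSp κ → PSp ι, IsMorphism B A ψ ∧
    (∀ p ∈ A, ψ (φ p) = p) ∧ ∀ q ∈ B, φ (ψ q) = q

/-- A projective variety (not necessarily irreducible): a closed subset of a projective space. -/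
structure ProjVariety where
  /-- the index set of the homogeneous coordinates of the ambient projective space -/
  ι : Type
  finite : Finite ι
  carrier : Set (PSp ι)
  isClosed : IsClosed carrier

/-- Morphisms of projective varieties. -/
structure Mor (X Y : ProjVariety) where
  toFun : PSp X.ι → PSp Y.ι
  isMorphism : IsMorphism X.carrier Y.carrier toFun

instance (X Y : ProjVariety) : CoeFun (Mor X Y) (fun _ => PSp X.ι → PSp Y.ι) := ⟨Mor.toFun⟩

theorem IsMorphism.comp {ι κ μ : Type} {A : Set (PSp ι)} {B : Set (PSp κ)} {C : Set (PSp μ)}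
    {ψ : PSp κ → PSp μ} {φ : PSp ι → PSp κ} (hψ : IsMorphism B C ψ) (hφ : IsMorphism A B φ) :
    IsMorphism A C (ψ ∘ φ) := by
  obtain ⟨hφm, hφc, hφr⟩ := hφ
  obtain ⟨hψm, hψc, hψr⟩ := hψ
  refine ⟨hψm.comp hφm, hψc.comp hφc hφm, fun U f hU hf => ?_⟩
  obtain ⟨V, hV, hVU⟩ := continuousOn_iff'.1 hψc U hU
  have h1 : IsRegularOn (B ∩ V) (f ∘ ψ) := by
    have := hψr U f hU hf
    rwa [Set.inter_comm B, hVU, Set.inter_comm V] at this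
  have h2 := hφr V (f ∘ ψ) hV h1
  have h3 : A ∩ φ ⁻¹' V = A ∩ (ψ ∘ φ) ⁻¹' U := by
    ext p
    refine and_congr_right fun hp => ?_
    have := Set.ext_iff.1 hVU (φ p)
    simp only [Set.mem_inter_iff, Set.mem_preimage, hφm hp, and_true] at this
    exact this.symm
  rwa [h3] at h2

/-- Composition of morphisms. -/
def Mor.comp {X Y Z : ProjVariety} (g : Mor Y Z) (f : Mor X Y) : Mor X Z where
  toFun := g ∘ f
  isMorphism := g.isMorphism.comp f.isMorphism

/-- `f : X → X` is an automorphism of `X`. -/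
def Mor.IsAutomorphism {X : ProjVariety} (f : Mor X X) : Prop :=
  IsIsoOn X.carrier X.carrier f

/-- A rational map `X ⇢ Y`, given by a morphism on a dense open subset of `X`. Two of them are the
same rational map if they agree on a dense open subset. -/
structure RatMap (X Y : ProjVariety) where
  dom : Set (PSp X.ι)
  isOpen_dom : IsOpen dom
  dense_dom : X.carrier ⊆ closure (X.carrier ∩ dom)
  toFun : PSp X.ι → PSp Y.ι
  isMorphism : IsMorphism (X.carrier ∩ dom) Y.carrier toFun

instance (X Y : ProjVariety) : CoeFun (RatMap X Y) (fun _ => PSp X.ι → PSp Y.ι) := ⟨RatMap.toFun⟩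

/-- The rational map given by a morphism. -/
def Mor.toRatMap {X Y : ProjVariety} (f : Mor X Y) : RatMap X Y where
  dom := Set.univ
  isOpen_dom := isOpen_univ
  dense_dom := by simpa using subset_closure
  toFun := f
  isMorphism := by simpa using f.isMorphism

/-- `P` holds at every point of some dense open subset of `X`. -/
def Generically (X : ProjVariety) (P : PSp X.ι → Prop) : Prop :=
  ∃ W : Set (PSp X.ι), IsOpen W ∧ X.carrier ⊆ closure (X.carrier ∩ W) ∧
    ∀ p ∈ X.carrier ∩ W, P p

/-- `ψ ∘ φ = id` as rational maps. -/
def RatMap.IsLeftInverse {X Y : ProjVariety} (ψ : RatMap Y X) (φ : RatMap X Y) : Prop :=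
  Generically X fun p => p ∈ φ.dom ∧ φ p ∈ ψ.dom ∧ ψ (φ p) = p

/-- `ψ` is the inverse of the rational map `φ`. -/
def RatMap.IsInverse {X Y : ProjVariety} (ψ : RatMap Y X) (φ : RatMap X Y) : Prop :=
  ψ.IsLeftInverse φ ∧ φ.IsLeftInverse ψ

/-- `φ` is a birational map. -/
def RatMap.IsBirational {X Y : ProjVariety} (φ : RatMap X Y) : Prop :=
  ∃ ψ : RatMap Y X, ψ.IsInverse φ

/-- For a birational morphism `ε : S → X`, the rational self-map `φ` of `X` lifts to the
morphism `F : S → S`, that is, `F = ε⁻¹ ∘ φ ∘ ε` as rational maps. -/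
def LiftsTo {S X : ProjVariety} (ε : Mor S X) (φ : RatMap X X) (F : Mor S S) : Prop :=
  ∃ e : RatMap X S, e.IsInverse ε.toRatMap ∧
    Generically S fun s => ε s ∈ φ.dom ∧ φ (ε s) ∈ e.dom ∧ F s = e (φ (ε s))

/-- The projective space `ℙⁿ` as a projective variety. -/
abbrev projSpace (n : ℕ) : ProjVariety where
  ι := Fin (n + 1)
  finite := inferInstance
  carrier := Set.univ
  isClosed := isClosed_univ

/-- The homogeneous polynomials vanishing on `X`; they generate the homogeneous ideal of `X`. -/
def vanishingForms (X : ProjVariety) : Set (MvPolynomial X.ι ℂ) :=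
  {f | IsForm f ∧ ∀ p ∈ X.carrier, val f p = 0}

/-- Jacobian criterion: at every point of `X` the Jacobian matrix of the homogeneous ideal of `X`
has rank `n - d`, where `n` is the dimension of the ambient projective space (so that there are
`n + 1` homogeneous coordinates). By Euler's formula the rank is the same as in an affine chart. -/
def IsSmoothOfDim (X : ProjVariety) (d : ℕ) : Prop :=
  ∀ p ∈ X.carrier,
    Module.finrank ℂ (Submodule.span ℂ
      {w : X.ι → ℂ | ∃ f ∈ vanishingForms X, w = fun j => val (MvPolynomial.pderiv j f) p})
      + d + 1 = Nat.card X.ι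

/-- Smooth projective rational surfaces: irreducible, birational to `ℙ²`, and smooth (of
dimension two) at every point. -/
def IsSmoothRationalSurface (X : ProjVariety) : Prop :=
  IsIrreducible X.carrier ∧ IsSmoothOfDim X 2 ∧ ∃ r : RatMap X (projSpace 2), r.IsBirational

/-- The Segre embedding. -/
def segre {ι κ : Type} (p : PSp ι) (q : PSp κ) : PSp (ι × κ) :=
  Projectivization.mk ℂ (fun ij => p.rep ij.1 * q.rep ij.2) (by
    obtain ⟨i, hi⟩ := Function.ne_iff.1 p.rep_nonzero
    obtain ⟨j, hj⟩ := Function.ne_iff.1 q.rep_nonzero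
    exact Function.ne_iff.2 ⟨(i, j), mul_ne_zero hi hj⟩)

/-- The regular functions `f₁, f₂` near `p` are a system of local parameters: they generate the
maximal ideal of the local ring of `X` at `p`. For a surface this means that `p` is a smooth point
and that the curves `f₁ = 0` and `f₂ = 0` are smooth at `p` and meet there transversally. -/
def IsLocalParameters (X : ProjVariety) (p : PSp X.ι) (f₁ f₂ : PSp X.ι → ℂ) : Prop :=
  f₁ p = 0 ∧ f₂ p = 0 ∧
    ∀ (V : Set (PSp X.ι)) (g : PSp X.ι → ℂ), IsOpen V → p ∈ V → IsRegularOn (X.carrier ∩ V) g →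
      g p = 0 → ∃ W : Set (PSp X.ι), IsOpen W ∧ p ∈ W ∧ ∃ a b : PSp X.ι → ℂ,
        IsRegularOn (X.carrier ∩ W) a ∧ IsRegularOn (X.carrier ∩ W) b ∧
          ∀ q ∈ X.carrier ∩ W, g q = a q * f₁ q + b q * f₂ q

/-- The local model `{(q, [l₀ : l₁]) | l₀ f₁(q) = l₁ f₂(q)} ⊆ (X ∩ U) × ℙ¹` of the blow-up of a
surface at the point `f₁ = f₂ = 0`, inside the Segre embedding. -/
def blowupModel (X : ProjVariety) (U : Set (PSp X.ι)) (f₁ f₂ : PSp X.ι → ℂ) :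
    Set (PSp (X.ι × Fin 2)) :=
  {z | ∃ q ∈ X.carrier ∩ U, ∃ l : PSp (Fin 2), l.rep 0 * f₁ q = l.rep 1 * f₂ q ∧ z = segre q l}

/-- `π : Y → X` is the blow-up of the surface `X` at its smooth point `p`: it is an isomorphism over
`X ∖ {p}`, and over an open neighbourhood `U` of `p` with local parameters `f₁, f₂` that vanish
simultaneously only at `p` it is isomorphic to the local model. -/
def IsPointBlowup {X Y : ProjVariety} (π : Mor Y X) (p : PSp X.ι) : Prop :=
  p ∈ X.carrier ∧
  IsIsoOn (Y.carrier \ π ⁻¹' {p}) (X.carrier \ {p}) π ∧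
  ∃ (U : Set (PSp X.ι)) (f₁ f₂ : PSp X.ι → ℂ), IsOpen U ∧ p ∈ U ∧
    IsRegularOn (X.carrier ∩ U) f₁ ∧ IsRegularOn (X.carrier ∩ U) f₂ ∧
    (∀ q ∈ X.carrier ∩ U, f₁ q = 0 → f₂ q = 0 → q = p) ∧
    IsLocalParameters X p f₁ f₂ ∧
    ∃ l : PSp Y.ι → PSp (Fin 2),
      IsIsoOn (Y.carrier ∩ π ⁻¹' U) (blowupModel X U f₁ f₂) (fun y => segre (π y) (l y))

/-! ### The product of two projective lines -/

theorem range_segre_eq :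
    Set.range (fun pq : PSp (Fin 2) × PSp (Fin 2) => segre pq.1 pq.2) =
      zeroLocus {MvPolynomial.X (0, 0) * MvPolynomial.X (1, 1)
        - MvPolynomial.X (0, 1) * MvPolynomial.X (1, 0)} := by
  ext z
  constructor
  · rintro ⟨⟨p, q⟩, rfl⟩ f hf
    obtain rfl := Set.mem_singleton_iff.1 hf
    obtain ⟨a, ha⟩ := Projectivization.exists_smul_eq_mk_rep ℂ
      (fun ij : Fin 2 × Fin 2 => p.rep ij.1 * q.rep ij.2) (by
        obtain ⟨i, hi⟩ := Function.ne_iff.1 p.rep_nonzero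
        obtain ⟨j, hj⟩ := Function.ne_iff.1 q.rep_nonzero
        exact Function.ne_iff.2 ⟨(i, j), mul_ne_zero hi hj⟩)
    simp only [val, segre, ← ha, map_sub, map_mul, MvPolynomial.eval_X, Pi.smul_apply,
      Units.smul_def, smul_eq_mul]
    ring
  · intro hz
    have hz' := hz _ rfl
    simp only [val, map_sub, map_mul, MvPolynomial.eval_X] at hz'
    obtain ⟨⟨i, j⟩, hij⟩ := Function.ne_iff.1 z.rep_nonzero
    have hij' : z.rep (i, j) ≠ 0 := hij
    have hu : (fun a => z.rep (a, j)) ≠ 0 := Function.ne_iff.2 ⟨i, hij⟩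
    have hv : (fun b => z.rep (i, b)) ≠ 0 := Function.ne_iff.2 ⟨j, hij⟩
    obtain ⟨a, ha⟩ := Projectivization.exists_smul_eq_mk_rep ℂ _ hu
    obtain ⟨b, hb⟩ := Projectivization.exists_smul_eq_mk_rep ℂ _ hv
    refine ⟨(Projectivization.mk ℂ _ hu, Projectivization.mk ℂ _ hv), ?_⟩
    conv_rhs => rw [← z.mk_rep]
    simp only [segre]
    rw [Projectivization.mk_eq_mk_iff']
    refine ⟨a * b * z.rep (i, j), ?_⟩
    funext ⟨c, d⟩
    simp only [← ha, ← hb, Pi.smul_apply, Units.smul_def, smul_eq_mul]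
    have key : z.rep (i, j) * z.rep (c, d) = z.rep (c, j) * z.rep (i, d) := by
      fin_cases i <;> fin_cases j <;> fin_cases c <;> fin_cases d <;> simp <;>
        first | done | linear_combination hz' | linear_combination -hz' |
          linear_combination (0 : ℂ) * hz'
    linear_combination (a * b : ℂ) * key

/-- `ℙ¹ × ℙ¹`, as a projective variety by the Segre embedding `z_{ij} = x_i y_j`. -/
abbrev P1P1 : ProjVariety where
  ι := Fin 2 × Fin 2
  finite := inferInstance
  carrier := Set.range fun pq : PSp (Fin 2) × PSp (Fin 2) => segre pq.1 pq.2
  isClosed := by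
    rw [range_segre_eq]
    refine isClosed_zeroLocus _ fun f hf => ?_
    obtain rfl := Set.mem_singleton_iff.1 hf
    exact ⟨2, ((MvPolynomial.isHomogeneous_X ℂ _).mul (MvPolynomial.isHomogeneous_X ℂ _)).sub
      ((MvPolynomial.isHomogeneous_X ℂ _).mul (MvPolynomial.isHomogeneous_X ℂ _))⟩

/-- The point `[1 : x]` of `ℙ¹`. -/
def affPt (x : ℂ) : PSp (Fin 2) :=
  Projectivization.mk ℂ ![1, x] fun h => one_ne_zero (congrFun h 0)

/-- The point `(x, y) = ([1 : x], [1 : y])` of `ℙ¹ × ℙ¹`. -/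
def pt (x y : ℂ) : PSp (Fin 2 × Fin 2) := segre (affPt x) (affPt y)

/-- The affine chart `𝔸² ⊆ ℙ¹ × ℙ¹` with coordinates `x = x₁ / x₀` and `y = y₁ / y₀`. -/
def chart : Set (PSp (Fin 2 × Fin 2)) := {z | ∃ x y : ℂ, z = pt x y}

/-- The coordinate `x = x₁ / x₀ = z₁₀ / z₀₀` on the affine chart. -/
def xCoord (z : PSp (Fin 2 × Fin 2)) : ℂ :=
  z.rep (1, 0) / z.rep (0, 0)

/-- The coordinate `y = y₁ / y₀ = z₀₁ / z₀₀` on the affine chart. -/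
def yCoord (z : PSp (Fin 2 × Fin 2)) : ℂ :=
  z.rep (0, 1) / z.rep (0, 0)

/-- For a morphism `ε : Y → ℙ¹ × ℙ¹` and functions `f, g` on the affine chart (with `g` not
identically zero), the rational function `(f / g) ∘ ε` is regular at the point `b` of `Y`, with
value `c` there. -/
def QuotientHasValue {Y : ProjVariety} (ε : Mor Y P1P1) (f g : PSp (Fin 2 × Fin 2) → ℂ)
    (b : PSp Y.ι) (c : ℂ) : Prop :=
  ∃ (W : Set (PSp Y.ι)) (r : PSp Y.ι → ℂ), IsOpen W ∧ b ∈ Y.carrier ∩ W ∧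
    IsRegularOn (Y.carrier ∩ W) r ∧
    (∀ q ∈ Y.carrier ∩ W, ε q ∈ chart ∧ f (ε q) = r q * g (ε q)) ∧ r b = c

/-- `φ` is the rational map given by
`(x, y) ↦ ((x - k) (x + k) y / (k ^ 2 - x ^ 2 + 2 t x y), x)`. -/
def IsQRTMap (k t : ℂ) (φ : RatMap P1P1 P1P1) : Prop :=
  ∀ x y : ℂ, k ^ 2 - x ^ 2 + 2 * t * x * y ≠ 0 →
    pt x y ∈ φ.dom ∧
      φ (pt x y) = pt ((x - k) * (x + k) * y / (k ^ 2 - x ^ 2 + 2 * t * x * y)) x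

end ClassicalAG

end

open ClassicalAG

/-!
The eight centres are the base points of the pencil of biquadratic curves that the QRT map `φ`
preserves. Write `φ` as the involution `I : (x, y) ↦ (x, y')` with
`1 / y + 1 / y' = t / (x - k) + t / (x + k)`, followed by the exchange `(x, y) ↦ (y, x)` of the
coordinates. Both lift to involutive automorphisms of the blow-up `S` of the eight points, and the
composite of the two lifts is the automorphism sought.

The surface is made explicit. A pair of blow-ups over `(ξ, η) = (c, 0)`, where `(ξ, η)` is `(x, y)`
or `(y, x)` and `c = ±k`, adds to a point of the surface a point `l` of the plane with general value
`[ξ - c : η : (ξ - c) η]` and a point `z` of the line with general value `[t l₁ - l₀ : l₂]`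
(`planeExt` and `lineExt`). Both are closed subvarieties of Segre products, and explicit charts
isomorphic to open subsets of the plane show that the projections are blow-ups of points
(`planeProj_isPointBlowup`, `lineProj_isPointBlowup`). An induction over the four pairs
(`IsTower.step`) carries along that `S` is an isomorphism off the centres and is covered by planar
charts that meet the set of general points; smoothness (by the Jacobian criterion in the form
`jacobian_of_iso`), irreducibility and rationality of `S` follow.

To lift `I`, note that `S` is irreducible and separated, so that a map that is defined at general
points extends to `S` if it extends near each point (`exists_reg_extension`); the extension takes
values in `S` because `S` is closed. It suffices to extend the coordinates `y'`, `l` and `z` of the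
image point, and each of them is given near each point by one of a few formulas in the coordinates
of `S`. For instance, `1 / y' = z₀ / z₁ + t / (x + c)` for the coordinate `z` over `(c, 0)`, wherever
`x ≠ -c`. The formulas for the coordinates over `(0, c)` are needed near the points over `(0, -c)`,
which `I` exchanges with those over `(0, c)` (`extendsAt_of_basePt_neg`). That the extended map is
an involution is checked at general points (`IsTower.leftInverse`).
-/

noncomputable section

namespace ClassicalAG

open MvPolynomial

/-! ### Forms, open sets and regular functions -/

theorem eval_smul_of_isHomogeneous {ι : Type} {f : MvPolynomial ι ℂ} {d : ℕ}
    (hf : f.IsHomogeneous d) (c : ℂ) (v : ι → ℂ) : eval (c • v) f = c ^ d * eval v f := by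
  rw [eval_eq, eval_eq, Finset.mul_sum]
  refine Finset.sum_congr rfl fun m hm => ?_
  have hd : ∑ i ∈ m.support, m i = d := (hf.degree_eq_sum_deg_support hm).symm
  simp only [Pi.smul_apply, smul_eq_mul, mul_pow, Finset.prod_mul_distrib, Finset.prod_pow_eq_pow_sum,
    hd]
  ring

theorem exists_form_of_mem_isOpen {ι : Type} {U : Set (PSp ι)} (hU : IsOpen U) {p : PSp ι}
    (hp : p ∈ U) : ∃ (d : ℕ) (h : MvPolynomial ι ℂ), h.IsHomogeneous d ∧ val h p ≠ 0 ∧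
      ∀ q, val h q ≠ 0 → q ∈ U := by
  obtain ⟨A, hA, hUA⟩ := hU
  have hpA : p ∉ zeroLocus A := fun h => by
    rw [← hUA] at h
    exact h hp
  simp only [zeroLocus, Set.mem_ofPred_eq, not_forall] at hpA
  obtain ⟨f, hf, hfp⟩ := hpA
  obtain ⟨d, hd⟩ := hA f hf
  refine ⟨d, f, hd, hfp, fun q hq => ?_⟩
  by_contra hqU
  have : q ∈ zeroLocus A := by
    rw [← hUA]
    exact hqU
  exact hq (this f hf)

theorem isOpen_val_ne {ι : Type} {d : ℕ} {h : MvPolynomial ι ℂ} (hh : h.IsHomogeneous d) :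
    IsOpen {q : PSp ι | val h q ≠ 0} := by
  have := (isClosed_zeroLocus {h} (by rintro f rfl; exact ⟨d, hh⟩)).isOpen_compl
  convert this using 1
  ext q
  simp [zeroLocus]

namespace IsRegularOn

variable {ι : Type} {W V : Set (PSp ι)} {f g : PSp ι → ℂ}

theorem mono (hf : IsRegularOn W f) (h : V ⊆ W) : IsRegularOn V f := fun p hp =>
  let ⟨U, hU, hpU, d, a, b, ha, hb, hab⟩ := hf p (h hp)
  ⟨U, hU, hpU, d, a, b, ha, hb, fun q hq => hab q ⟨h hq.1, hq.2⟩⟩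

theorem congr (hf : IsRegularOn W f) (h : ∀ q ∈ W, g q = f q) : IsRegularOn W g := fun p hp =>
  let ⟨U, hU, hpU, d, a, b, ha, hb, hab⟩ := hf p hp
  ⟨U, hU, hpU, d, a, b, ha, hb, fun q hq => ⟨(hab q hq).1, (h q hq.1).trans (hab q hq).2⟩⟩

theorem of_local (h : ∀ p ∈ W, ∃ U, IsOpen U ∧ p ∈ U ∧ IsRegularOn (W ∩ U) f) :
    IsRegularOn W f := fun p hp => by
  obtain ⟨U, hU, hpU, hf⟩ := h p hp
  obtain ⟨V, hV, hpV, d, a, b, ha, hb, hab⟩ := hf p ⟨hp, hpU⟩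
  exact ⟨U ∩ V, hU.inter hV, ⟨hpU, hpV⟩, d, a, b, ha, hb,
    fun q hq => hab q ⟨⟨hq.1, hq.2.1⟩, hq.2.2⟩⟩

theorem const (c : ℂ) : IsRegularOn W (fun _ => c) := fun p _ =>
  ⟨Set.univ, isOpen_univ, trivial, 0, C c, 1, isHomogeneous_C _ _, isHomogeneous_one _ _,
    fun q _ => by simp [val]⟩

theorem add (hf : IsRegularOn W f) (hg : IsRegularOn W g) :
    IsRegularOn W (fun q => f q + g q) := fun p hp => by
  obtain ⟨U, hU, hpU, d, a, b, ha, hb, hab⟩ := hf p hp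
  obtain ⟨V, hV, hpV, e, r, s, hr, hs, hrs⟩ := hg p hp
  refine ⟨U ∩ V, hU.inter hV, ⟨hpU, hpV⟩, d + e, a * s + b * r, b * s,
    (ha.mul hs).add (hb.mul hr), hb.mul hs, fun q hq => ?_⟩
  obtain ⟨h1, h2⟩ := hab q ⟨hq.1, hq.2.1⟩
  obtain ⟨h3, h4⟩ := hrs q ⟨hq.1, hq.2.2⟩
  simp only [val, map_mul, map_add] at *
  refine ⟨mul_ne_zero h1 h3, ?_⟩
  rw [h2, h4]
  field_simp

theorem mul (hf : IsRegularOn W f) (hg : IsRegularOn W g) :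
    IsRegularOn W (fun q => f q * g q) := fun p hp => by
  obtain ⟨U, hU, hpU, d, a, b, ha, hb, hab⟩ := hf p hp
  obtain ⟨V, hV, hpV, e, r, s, hr, hs, hrs⟩ := hg p hp
  refine ⟨U ∩ V, hU.inter hV, ⟨hpU, hpV⟩, d + e, a * r, b * s,
    ha.mul hr, hb.mul hs, fun q hq => ?_⟩
  obtain ⟨h1, h2⟩ := hab q ⟨hq.1, hq.2.1⟩
  obtain ⟨h3, h4⟩ := hrs q ⟨hq.1, hq.2.2⟩
  simp only [val, map_mul] at *
  refine ⟨mul_ne_zero h1 h3, ?_⟩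
  rw [h2, h4]
  field_simp

theorem neg (hf : IsRegularOn W f) : IsRegularOn W (fun q => -f q) :=
  ((const (-1)).mul hf).congr fun q _ => by ring

theorem sub (hf : IsRegularOn W f) (hg : IsRegularOn W g) :
    IsRegularOn W (fun q => f q - g q) :=
  (hf.add hg.neg).congr fun q _ => by ring

theorem pow (hf : IsRegularOn W f) (n : ℕ) : IsRegularOn W (fun q => f q ^ n) := by
  induction n with
  | zero => simpa using const 1
  | succ n ih => simpa [pow_succ] using ih.mul hf

theorem exists_isOpen_ne (hf : IsRegularOn W f) {p : PSp ι} (hp : p ∈ W) (h : f p ≠ 0) :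
    ∃ U, IsOpen U ∧ p ∈ U ∧ ∀ q ∈ W ∩ U, f q ≠ 0 := by
  obtain ⟨U, hU, hpU, d, a, b, ha, hb, hab⟩ := hf p hp
  refine ⟨U ∩ {q | val a q ≠ 0}, hU.inter (isOpen_val_ne ha), ⟨hpU, ?_⟩, fun q hq => ?_⟩
  · intro h0
    rw [(hab p ⟨hp, hpU⟩).2, h0, zero_div] at h
    exact h rfl
  · obtain ⟨h1, h2⟩ := hab q ⟨hq.1, hq.2.1⟩
    rw [h2]
    exact div_ne_zero hq.2.2 h1

theorem inv (hf : IsRegularOn W f) (h0 : ∀ q ∈ W, f q ≠ 0) : IsRegularOn W (fun q => (f q)⁻¹) :=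
  fun p hp => by
  obtain ⟨U, hU, hpU, d, a, b, ha, hb, hab⟩ := hf p hp
  refine ⟨U, hU, hpU, d, b, a, hb, ha, fun q hq => ?_⟩
  obtain ⟨h1, h2⟩ := hab q hq
  have h3 : val a q ≠ 0 := fun h => h0 q hq.1 (by rw [h2, h, zero_div])
  exact ⟨h3, by simp only [h2, inv_div]⟩

theorem div (hf : IsRegularOn W f) (hg : IsRegularOn W g) (h0 : ∀ q ∈ W, g q ≠ 0) :
    IsRegularOn W (fun q => f q / g q) :=
  (hf.mul (hg.inv h0)).congr fun q _ => by rw [div_eq_mul_inv]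

theorem sum {α : Type} (s : Finset α) {F : α → PSp ι → ℂ} (h : ∀ a ∈ s, IsRegularOn W (F a)) :
    IsRegularOn W (fun q => ∑ a ∈ s, F a q) := by
  classical
  induction s using Finset.induction_on with
  | empty => simpa using const 0
  | insert a s ha ih =>
    simp only [Finset.sum_insert ha]
    exact (h a (Finset.mem_insert_self _ _)).add
      (ih fun b hb => h b (Finset.mem_insert_of_mem hb))

theorem eval {κ : Type} {u : PSp ι → κ → ℂ} (hu : ∀ j, IsRegularOn W (fun q => u q j))
    (P : MvPolynomial κ ℂ) : IsRegularOn W (fun q => MvPolynomial.eval (u q) P) := by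
  induction P using MvPolynomial.induction_on with
  | C a => simpa using const a
  | add P Q hP hQ => simpa using hP.add hQ
  | mul_X P i hP => simpa using hP.mul (hu i)

theorem val_div_val {d : ℕ} {a b : MvPolynomial ι ℂ} (ha : a.IsHomogeneous d)
    (hb : b.IsHomogeneous d) (h : ∀ q ∈ W, val b q ≠ 0) :
    IsRegularOn W (fun q => val a q / val b q) := fun _ _ =>
  ⟨Set.univ, isOpen_univ, trivial, d, a, b, ha, hb, fun q hq => ⟨h q hq.1, rfl⟩⟩

end IsRegularOn

/-! ### Families of functions up to a local scalar, and morphisms -/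

/-- The point with homogeneous coordinates `v`; an arbitrary point if `v = 0`. -/
def pmk {κ : Type} [Nonempty κ] (v : κ → ℂ) : PSp κ :=
  open Classical in
  if h : v ≠ 0 then Projectivization.mk ℂ v h
  else Projectivization.mk ℂ (fun _ => 1) (Function.ne_iff.2
    ⟨Classical.arbitrary κ, one_ne_zero⟩)

/-- `v` is a vector of homogeneous coordinates of the point `p`. -/
def IsRep {κ : Type} (v : κ → ℂ) (p : PSp κ) : Prop := v ≠ 0 ∧ ∃ c : ℂ, p.rep = c • v

theorem isRep_rep {κ : Type} (p : PSp κ) : IsRep p.rep p := ⟨p.rep_nonzero, 1, by simp⟩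

theorem isRep_mk {κ : Type} (v : κ → ℂ) (h : v ≠ 0) : IsRep v (Projectivization.mk ℂ v h) := by
  obtain ⟨a, ha⟩ := Projectivization.exists_smul_eq_mk_rep ℂ v h
  exact ⟨h, a, ha.symm⟩

theorem isRep_pmk {κ : Type} [Nonempty κ] {v : κ → ℂ} (h : v ≠ 0) : IsRep v (pmk v) := by
  simp only [pmk, dif_pos h]
  exact isRep_mk v h

namespace IsRep

variable {κ : Type} {v w : κ → ℂ} {p q : PSp κ}

theorem exists_rep_eq (h : IsRep v p) : ∃ c : ℂ, c ≠ 0 ∧ p.rep = c • v := by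
  obtain ⟨-, c, hc⟩ := h
  refine ⟨c, ?_, hc⟩
  rintro rfl
  exact p.rep_nonzero (by simpa using hc)

theorem exists_eq_smul_rep (h : IsRep v p) : ∃ c : ℂ, c ≠ 0 ∧ v = c • p.rep := by
  obtain ⟨c, hc, h⟩ := h.exists_rep_eq
  exact ⟨c⁻¹, inv_ne_zero hc, by rw [h, inv_smul_smul₀ hc]⟩

theorem eq (hv : IsRep v p) (hw : IsRep v q) : p = q := by
  obtain ⟨a, ha, h1⟩ := hv.exists_rep_eq
  obtain ⟨b, hb, h2⟩ := hw.exists_rep_eq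
  rw [← p.mk_rep, ← q.mk_rep, Projectivization.mk_eq_mk_iff']
  exact ⟨a / b, by rw [h1, h2, smul_smul, div_mul_cancel₀ _ hb]⟩

theorem smul (h : IsRep v p) {c : ℂ} (hc : c ≠ 0) : IsRep (c • v) p := by
  obtain ⟨h0, a, ha⟩ := h
  exact ⟨smul_ne_zero hc h0, a / c, by rw [ha, smul_smul, div_mul_cancel₀ _ hc]⟩

theorem of_smul {c : ℂ} (h : IsRep (c • v) p) : IsRep v p := by
  obtain ⟨h0, a, ha⟩ := h
  refine ⟨?_, a * c, by rw [ha, smul_smul]⟩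
  rintro rfl
  simp at h0

theorem eq_pmk [Nonempty κ] (h : IsRep v p) : p = pmk v := h.eq (isRep_pmk h.1)

theorem val_eq_zero_iff (h : IsRep v p) {f : MvPolynomial κ ℂ} {d : ℕ} (hf : f.IsHomogeneous d) :
    val f p = 0 ↔ MvPolynomial.eval v f = 0 := by
  obtain ⟨c, hc, h⟩ := h.exists_rep_eq
  rw [val, h, eval_smul_of_isHomogeneous hf]
  simp [hc]

theorem val_div_val (h : IsRep v p) {f g : MvPolynomial κ ℂ} {d : ℕ} (hf : f.IsHomogeneous d)
    (hg : g.IsHomogeneous d) :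
    val f p / val g p = MvPolynomial.eval v f / MvPolynomial.eval v g := by
  obtain ⟨c, hc, h⟩ := h.exists_rep_eq
  rw [val, val, h, eval_smul_of_isHomogeneous hf, eval_smul_of_isHomogeneous hg,
    mul_div_mul_left _ _ (pow_ne_zero d hc)]

/-- Proportionality of homogeneous coordinate vectors, as the vanishing of minors. -/
theorem eq_iff (hv : IsRep v p) (hw : IsRep w q) : p = q ↔ ∀ i j, v i * w j = v j * w i := by
  constructor
  · rintro rfl i j
    obtain ⟨a, ha, rfl⟩ := hv.exists_eq_smul_rep
    obtain ⟨b, hb, rfl⟩ := hw.exists_eq_smul_rep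
    simp only [Pi.smul_apply, smul_eq_mul]
    ring
  · intro h
    obtain ⟨j, hj⟩ := Function.ne_iff.1 hw.1
    obtain ⟨i, hi⟩ := Function.ne_iff.1 hv.1
    simp only [Pi.zero_apply] at hi hj
    have hvj : v j ≠ 0 := fun h0 => by
      have := h i j
      rw [h0, zero_mul] at this
      exact mul_ne_zero hi hj this
    have : v = (v j / w j) • w := by
      funext i
      simp only [Pi.smul_apply, smul_eq_mul]
      field_simp
      linear_combination h i j
    rw [this] at hv
    exact hv.of_smul.eq hw

end IsRep

theorem pmk_rep {κ : Type} [Nonempty κ] (p : PSp κ) : pmk p.rep = p := ((isRep_rep p).eq_pmk).symm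

theorem pmk_smul {κ : Type} [Nonempty κ] {v : κ → ℂ} {c : ℂ} (hc : c ≠ 0) (hv : v ≠ 0) :
    pmk (c • v) = pmk v := (((isRep_pmk hv).smul hc).eq_pmk).symm

/-- The functions `f · j` are regular on `A` up to multiplication by a common, locally defined and
nowhere vanishing function. Such families are the homogeneous coordinates of morphisms. -/
def PReg {ι κ : Type} (A : Set (PSp ι)) (f : PSp ι → κ → ℂ) : Prop :=
  ∀ p ∈ A, ∃ U : Set (PSp ι), IsOpen U ∧ p ∈ U ∧ ∃ c : PSp ι → ℂ, (∀ q ∈ A ∩ U, c q ≠ 0) ∧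
    ∀ j, IsRegularOn (A ∩ U) (fun q => c q * f q j)

/-- `φ` is given on `A` by homogeneous coordinates that are regular up to a local scalar. -/
def Reg {ι κ : Type} (A : Set (PSp ι)) (φ : PSp ι → PSp κ) : Prop := PReg A fun q => (φ q).rep

section PReg

variable {ι κ μ : Type} {A B : Set (PSp ι)}

theorem PReg.mono {f : PSp ι → κ → ℂ} (hf : PReg A f) (h : B ⊆ A) : PReg B f := fun p hp =>
  let ⟨U, hU, hpU, c, hc, hcf⟩ := hf p (h hp)
  ⟨U, hU, hpU, c, fun q hq => hc q ⟨h hq.1, hq.2⟩, fun j =>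
    (hcf j).mono fun _ hq => ⟨h hq.1, hq.2⟩⟩

theorem Reg.mono {φ : PSp ι → PSp κ} (hf : Reg A φ) (h : B ⊆ A) : Reg B φ := PReg.mono hf h

theorem PReg.of_local {f : PSp ι → κ → ℂ}
    (h : ∀ p ∈ A, ∃ U, IsOpen U ∧ p ∈ U ∧ PReg (A ∩ U) f) : PReg A f := fun p hp => by
  obtain ⟨U, hU, hpU, hf⟩ := h p hp
  obtain ⟨V, hV, hpV, c, hc, hcf⟩ := hf p ⟨hp, hpU⟩
  refine ⟨U ∩ V, hU.inter hV, ⟨hpU, hpV⟩, c, fun q hq => hc q ⟨⟨hq.1, hq.2.1⟩, hq.2.2⟩,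
    fun j => (hcf j).mono fun q hq => ⟨⟨hq.1, hq.2.1⟩, hq.2.2⟩⟩

theorem PReg.of_isRegularOn {f : PSp ι → κ → ℂ} (h : ∀ j, IsRegularOn A (fun q => f q j)) :
    PReg A f := fun p _ =>
  ⟨Set.univ, isOpen_univ, trivial, fun _ => 1, fun _ _ => one_ne_zero, fun j => by
    simpa using h j⟩

/-- Change of a family by nowhere vanishing factors, which need not be regular. -/
theorem PReg.congr_smul {f g : PSp ι → κ → ℂ} (hf : PReg A f)
    (h : ∀ q ∈ A, ∃ a : ℂ, a ≠ 0 ∧ g q = a • f q) : PReg A g := fun p hp => by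
  obtain ⟨U, hU, hpU, c, hc, hcf⟩ := hf p hp
  choose! a ha hag using h
  refine ⟨U, hU, hpU, fun q => c q / a q, fun q hq => div_ne_zero (hc q hq) (ha q hq.1), fun j =>
    (hcf j).congr fun q hq => ?_⟩
  have := ha q hq.1
  rw [hag q hq.1, Pi.smul_apply, smul_eq_mul]
  field_simp

theorem PReg.reg {f : PSp ι → κ → ℂ} (hf : PReg A f) {φ : PSp ι → PSp κ}
    (h : ∀ q ∈ A, IsRep (f q) (φ q)) : Reg A φ :=
  PReg.congr_smul hf fun q hq => (h q hq).exists_rep_eq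

theorem PReg.reg_pmk [Nonempty κ] {f : PSp ι → κ → ℂ} (hf : PReg A f)
    (h : ∀ q ∈ A, f q ≠ 0) : Reg A (fun q => pmk (f q)) :=
  hf.reg fun q hq => isRep_pmk (h q hq)

theorem Reg.congr {φ ψ : PSp ι → PSp κ} (hφ : Reg A φ) (h : ∀ q ∈ A, ψ q = φ q) : Reg A ψ :=
  PReg.congr_smul hφ fun q hq => ⟨1, one_ne_zero, by rw [h q hq, one_smul]⟩

theorem Reg.of_local {φ : PSp ι → PSp κ}
    (h : ∀ p ∈ A, ∃ U, IsOpen U ∧ p ∈ U ∧ Reg (A ∩ U) φ) : Reg A φ := PReg.of_local h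

/-- A family that depends linearly on another one, with regular coefficients. -/
theorem PReg.lin [Fintype κ] {f : PSp ι → κ → ℂ} (hf : PReg A f) {M : μ → κ → PSp ι → ℂ}
    (hM : ∀ j i, IsRegularOn A (M j i)) : PReg A (fun q j => ∑ i, M j i q * f q i) :=
  fun p hp => by
  obtain ⟨U, hU, hpU, c, hc, hcf⟩ := hf p hp
  refine ⟨U, hU, hpU, c, hc, fun j => (IsRegularOn.sum Finset.univ fun i _ =>
    ((hM j i).mono Set.inter_subset_left).mul (hcf i)).congr fun q _ => ?_⟩
  rw [Finset.mul_sum]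
  exact Finset.sum_congr rfl fun i _ => by ring

/-- The products of the members of two families. -/
theorem PReg.tensor {f : PSp ι → κ → ℂ} {g : PSp ι → μ → ℂ} (hf : PReg A f) (hg : PReg A g) :
    PReg A (fun q (ij : κ × μ) => f q ij.1 * g q ij.2) := fun p hp => by
  obtain ⟨U, hU, hpU, c, hc, hcf⟩ := hf p hp
  obtain ⟨V, hV, hpV, d, hd, hdg⟩ := hg p hp
  refine ⟨U ∩ V, hU.inter hV, ⟨hpU, hpV⟩, fun q => c q * d q,
    fun q hq => mul_ne_zero (hc q ⟨hq.1, hq.2.1⟩) (hd q ⟨hq.1, hq.2.2⟩), fun ij => ?_⟩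
  refine (((hcf ij.1).mono ?_).mul ((hdg ij.2).mono ?_)).congr fun q _ => by ring
  · exact fun q hq => ⟨hq.1, hq.2.1⟩
  · exact fun q hq => ⟨hq.1, hq.2.2⟩

/-- Families depending on another one by homogeneous polynomials of the same degree. -/
theorem PReg.poly {f : PSp ι → κ → ℂ} (hf : PReg A f) {d : ℕ} {P : μ → MvPolynomial κ ℂ}
    (hP : ∀ j, (P j).IsHomogeneous d) : PReg A (fun q j => eval (f q) (P j)) := fun p hp => by
  obtain ⟨U, hU, hpU, c, hc, hcf⟩ := hf p hp
  refine ⟨U, hU, hpU, fun q => c q ^ d, fun q hq => pow_ne_zero _ (hc q hq), fun j =>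
    (IsRegularOn.eval (u := fun q => c q • f q) hcf (P j)).congr fun q _ => ?_⟩
  rw [eval_smul_of_isHomogeneous (hP j)]

theorem PReg.ratio {f : PSp ι → κ → ℂ} (hf : PReg A f) (i j : κ) (h : ∀ q ∈ A, f q j ≠ 0) :
    IsRegularOn A (fun q => f q i / f q j) := IsRegularOn.of_local fun p hp => by
  obtain ⟨U, hU, hpU, c, hc, hcf⟩ := hf p hp
  refine ⟨U, hU, hpU, ((hcf i).div (hcf j) fun q hq => mul_ne_zero (hc q hq) (h q hq.1)).congr
    fun q hq => ?_⟩
  rw [mul_div_mul_left _ _ (hc q hq)]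

theorem PReg.exists_isOpen_ne {f : PSp ι → κ → ℂ} (hf : PReg A f) (j : κ) :
    ∃ W, IsOpen W ∧ A ∩ W = {q ∈ A | f q j ≠ 0} := by
  have : ∀ p ∈ {q ∈ A | f q j ≠ 0}, ∃ V, IsOpen V ∧ p ∈ V ∧ ∀ q ∈ A ∩ V, f q j ≠ 0 := by
    rintro p ⟨hp, hpj⟩
    obtain ⟨U, hU, hpU, c, hc, hcf⟩ := hf p hp
    obtain ⟨V, hV, hpV, h⟩ := (hcf j).exists_isOpen_ne ⟨hp, hpU⟩
      (mul_ne_zero (hc p ⟨hp, hpU⟩) hpj)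
    exact ⟨U ∩ V, hU.inter hV, ⟨hpU, hpV⟩, fun q hq =>
      right_ne_zero_of_mul (h q ⟨⟨hq.1, hq.2.1⟩, hq.2.2⟩)⟩
  choose! V hV hpV hVj using this
  refine ⟨⋃ p ∈ {q ∈ A | f q j ≠ 0}, V p, isOpen_biUnion hV, ?_⟩
  ext q
  simp only [Set.mem_inter_iff, Set.mem_iUnion₂]
  constructor
  · rintro ⟨hq, p, hp, hqp⟩
    exact ⟨hq, hVj p hp q ⟨hq, hqp⟩⟩
  · intro hq
    exact ⟨hq.1, q, hq, hpV q hq⟩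

/-- The main criterion: the maps given locally by regular homogeneous coordinates are the
morphisms. -/
theorem Reg.isMorphism {φ : PSp ι → PSp κ} (hφ : Reg A φ) {B : Set (PSp κ)}
    (h : Set.MapsTo φ A B) : IsMorphism A B φ := by
  have hcont : ContinuousOn φ A := by
    rw [continuousOn_iff]
    intro p hp T hT hpT
    obtain ⟨d, h, hh, hhp, hhT⟩ := exists_form_of_mem_isOpen hT hpT
    have h1 := PReg.poly hφ (μ := Unit) (P := fun _ => h) fun _ => hh
    obtain ⟨W, hW, hAW⟩ := h1.exists_isOpen_ne ()
    refine ⟨W, hW, ?_, ?_⟩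
    · exact (hAW.symm.subset ⟨hp, hhp⟩).2
    · intro q hq
      exact hhT _ (hAW.subset ⟨hq.2, hq.1⟩).2
  refine ⟨h, hcont, fun U f hU hf p hp => ?_⟩
  obtain ⟨V, hV, hpV, d, a, b, ha, hb, hab⟩ := hf (φ p) ⟨h hp.1, hp.2⟩
  obtain ⟨W, hW, hAW⟩ := continuousOn_iff'.1 hcont V hV
  obtain ⟨Z, hZ, hpZ, c, hc, hcφ⟩ := hφ p hp.1
  have key : IsRegularOn (A ∩ φ ⁻¹' U ∩ (W ∩ Z)) (f ∘ φ) := by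
    have hsub : A ∩ φ ⁻¹' U ∩ (W ∩ Z) ⊆ A ∩ Z := fun q hq => ⟨hq.1.1, hq.2.2⟩
    have hv : ∀ q ∈ A ∩ φ ⁻¹' U ∩ (W ∩ Z), φ q ∈ B ∩ U ∩ V := fun q hq =>
      ⟨⟨h hq.1.1, hq.1.2⟩, (hAW.symm.subset ⟨hq.2.1, hq.1.1⟩).1⟩
    have hr : ∀ q ∈ A ∩ φ ⁻¹' U ∩ (W ∩ Z), IsRep (c q • (φ q).rep) (φ q) := fun q hq =>
      (isRep_rep _).smul (hc q (hsub hq))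
    refine (((IsRegularOn.eval (u := fun q => c q • (φ q).rep) hcφ a).mono hsub).div
      ((IsRegularOn.eval (u := fun q => c q • (φ q).rep) hcφ b).mono hsub) ?_).congr ?_
    · intro q hq
      exact fun h0 => (hab _ (hv q hq)).1 (((hr q hq).val_eq_zero_iff hb).2 h0)
    · intro q hq
      rw [Function.comp_apply, (hab _ (hv q hq)).2, (hr q hq).val_div_val ha hb]
  have hpW : p ∈ W := (hAW.subset ⟨hpV, hp.1⟩).1
  obtain ⟨T, hT, hpT, r⟩ := key p ⟨hp, hpW, hpZ⟩
  obtain ⟨e, g, k, hg, hk, hgk⟩ := r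
  exact ⟨W ∩ Z ∩ T, (hW.inter hZ).inter hT, ⟨⟨hpW, hpZ⟩, hpT⟩, e, g, k, hg, hk,
    fun q hq => hgk q ⟨⟨hq.1, hq.2.1⟩, hq.2.2⟩⟩

theorem IsMorphism.reg {φ : PSp ι → PSp κ} {B : Set (PSp κ)} (h : IsMorphism A B φ) :
    Reg A φ := fun p hp => by
  obtain ⟨hm, hc, hr⟩ := h
  obtain ⟨i, hi⟩ := Function.ne_iff.1 (φ p).rep_nonzero
  set U : Set (PSp κ) := {q | val (X i) q ≠ 0} with hUdef
  have hU : IsOpen U := isOpen_val_ne (isHomogeneous_X ℂ i)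
  obtain ⟨V, hV, hAV⟩ := continuousOn_iff'.1 hc U hU
  have hpV : p ∈ V := (hAV.subset ⟨by simpa [hUdef, val] using hi, hp⟩).1
  have hAV' : A ∩ V = A ∩ φ ⁻¹' U := by rw [Set.inter_comm, ← hAV, Set.inter_comm]
  refine ⟨V, hV, hpV, fun q => ((φ q).rep i)⁻¹, fun q hq => ?_, fun j => ?_⟩
  · have : q ∈ A ∩ φ ⁻¹' U := hAV'.subset hq
    simpa [hUdef, val] using this.2
  · rw [hAV']
    refine (hr U (fun q => val (X j) q / val (X i) q) hU ?_).congr fun q _ => ?_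
    · exact IsRegularOn.val_div_val (isHomogeneous_X ℂ j) (isHomogeneous_X ℂ i) fun q hq => hq.2
    · simp [val, div_eq_inv_mul]

theorem Reg.continuousOn {φ : PSp ι → PSp κ} (hφ : Reg A φ) : ContinuousOn φ A :=
  (hφ.isMorphism (Set.mapsTo_univ φ A)).2.1

theorem Reg.exists_isOpen {φ : PSp ι → PSp κ} (hφ : Reg A φ) {U : Set (PSp κ)} (hU : IsOpen U) :
    ∃ V, IsOpen V ∧ A ∩ V = A ∩ φ ⁻¹' U := by
  obtain ⟨V, hV, h⟩ := continuousOn_iff'.1 hφ.continuousOn U hU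
  exact ⟨V, hV, by rw [Set.inter_comm, ← h, Set.inter_comm]⟩

theorem IsRegularOn.comp {B : Set (PSp κ)} {f : PSp κ → ℂ} (hf : IsRegularOn B f)
    {φ : PSp ι → PSp κ} (hφ : Reg A φ) (h : Set.MapsTo φ A B) :
    IsRegularOn A (fun q => f (φ q)) := by
  have := (hφ.isMorphism h).2.2 Set.univ f isOpen_univ (by simpa using hf)
  rw [Set.preimage_univ, Set.inter_univ] at this
  exact this

theorem PReg.comp {B : Set (PSp κ)} {f : PSp κ → μ → ℂ} (hf : PReg B f)
    {φ : PSp ι → PSp κ} (hφ : Reg A φ) (h : Set.MapsTo φ A B) :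
    PReg A (fun q => f (φ q)) := fun p hp => by
  obtain ⟨U, hU, hpU, c, hc, hcf⟩ := hf (φ p) (h hp)
  obtain ⟨V, hV, hAV⟩ := hφ.exists_isOpen hU
  have hpV : p ∈ A ∩ V := by
    rw [hAV]
    exact ⟨hp, hpU⟩
  have hm : Set.MapsTo φ (A ∩ V) (B ∩ U) := fun q hq => by
    rw [hAV] at hq
    exact ⟨h hq.1, hq.2⟩
  exact ⟨V, hV, hpV.2, fun q => c (φ q), fun q hq => hc _ (hm hq), fun j =>
    (hcf j).comp (hφ.mono Set.inter_subset_left) hm⟩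

theorem Reg.comp {B : Set (PSp κ)} {ψ : PSp κ → PSp μ} (hψ : Reg B ψ)
    {φ : PSp ι → PSp κ} (hφ : Reg A φ) (h : Set.MapsTo φ A B) :
    Reg A (fun q => ψ (φ q)) := PReg.comp hψ hφ h

theorem preg_rep : PReg A (fun q => q.rep) := fun p hp => by
  obtain ⟨i, hi⟩ := Function.ne_iff.1 p.rep_nonzero
  refine ⟨{q | val (X i) q ≠ 0}, isOpen_val_ne (isHomogeneous_X ℂ i), by simpa [val] using hi,
    fun q => (val (X i) q)⁻¹, fun q hq => inv_ne_zero hq.2, fun j => ?_⟩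
  refine (IsRegularOn.val_div_val (isHomogeneous_X ℂ j) (isHomogeneous_X ℂ i)
    fun q hq => hq.2).congr fun q _ => ?_
  simp [val, div_eq_inv_mul]

theorem reg_id : Reg A (fun q => q) := preg_rep

/-- The zeros of a family on a closed set form a closed set. -/
theorem PReg.isClosed_zeros {f : PSp ι → κ → ℂ} (hf : PReg A f) (hA : IsClosed A) :
    IsClosed {q ∈ A | f q = 0} := by
  have h : ∀ j, IsClosed {q ∈ A | f q j = 0} := fun j => by
    obtain ⟨W, hW, hAW⟩ := hf.exists_isOpen_ne j
    convert hA.inter hW.isClosed_compl using 1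
    ext q
    have : q ∈ A ∩ W ↔ q ∈ A ∧ f q j ≠ 0 := by rw [hAW]; rfl
    simp only [Set.mem_inter_iff] at this
    simp only [Set.mem_inter_iff, Set.mem_compl_iff]
    change q ∈ A ∧ f q j = 0 ↔ _
    tauto
  by_cases hκ : Nonempty κ
  · convert isClosed_iInter h using 1
    ext q
    simp only [Set.mem_iInter]
    exact ⟨fun h j => ⟨h.1, by rw [h.2]; rfl⟩,
      fun h => ⟨(h (Classical.arbitrary κ)).1, funext fun j => (h j).2⟩⟩
  · convert hA using 1
    ext q
    exact ⟨fun h => h.1, fun h => ⟨h, funext fun j => (hκ ⟨j⟩).elim⟩⟩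

/-- Two morphisms that agree on a dense subset are equal. -/
theorem Reg.eqOn_of_dense {φ ψ : PSp ι → PSp κ} (hφ : Reg A φ) (hψ : Reg A ψ) {D : Set (PSp ι)}
    (hD : A ⊆ closure (A ∩ D)) (h : ∀ q ∈ A ∩ D, φ q = ψ q) : ∀ q ∈ A, φ q = ψ q := by
  intro p hp
  by_contra hne
  have hmin : ∃ i j, (φ p).rep i * (ψ p).rep j - (φ p).rep j * (ψ p).rep i ≠ 0 := by
    by_contra hcon
    push Not at hcon
    exact hne (((isRep_rep _).eq_iff (isRep_rep _)).2 fun i j => sub_eq_zero.1 (hcon i j))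
  obtain ⟨i, j, hij⟩ := hmin
  have hP : PReg A (fun q (_ : Unit) =>
      (φ q).rep i * (ψ q).rep j - (φ q).rep j * (ψ q).rep i) := fun p hp => by
    obtain ⟨U, hU, hpU, c, hc, hcf⟩ := PReg.tensor hφ hψ p hp
    exact ⟨U, hU, hpU, c, hc, fun _ => ((hcf (i, j)).sub (hcf (j, i))).congr fun q _ => by ring⟩
  obtain ⟨W, hW, hAW⟩ := hP.exists_isOpen_ne ()
  have hpW : p ∈ A ∩ W := by
    rw [hAW]
    exact ⟨hp, hij⟩
  obtain ⟨q, hqW, hqA, hqD⟩ := mem_closure_iff.1 (hD hp) W hW hpW.2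
  have h1 : q ∈ A ∩ W := ⟨hqA, hqW⟩
  rw [hAW] at h1
  refine h1.2 ?_
  rw [h q ⟨hqA, hqD⟩]
  ring

end PReg

/-! ### The Segre embedding -/

section Segre

variable {ι κ μ : Type}

/-- The first projection, inverse to the Segre embedding in the first argument: a nonzero column
of the matrix of homogeneous coordinates. -/
def sfst (z : PSp (ι × κ)) : PSp ι :=
  have h : ∃ ij : ι × κ, z.rep ij ≠ 0 := Function.ne_iff.1 z.rep_nonzero
  Projectivization.mk ℂ (fun a => z.rep (a, h.choose.2)) (Function.ne_iff.2
    ⟨h.choose.1, h.choose_spec⟩)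

/-- The second projection, inverse to the Segre embedding in the second argument: a nonzero row
of the matrix of homogeneous coordinates. -/
def ssnd (z : PSp (ι × κ)) : PSp κ :=
  have h : ∃ ij : ι × κ, z.rep ij ≠ 0 := Function.ne_iff.1 z.rep_nonzero
  Projectivization.mk ℂ (fun b => z.rep (h.choose.1, b)) (Function.ne_iff.2
    ⟨h.choose.2, h.choose_spec⟩)

theorem IsRep.segre {u : ι → ℂ} {v : κ → ℂ} {p : PSp ι} {q : PSp κ} (hu : IsRep u p)
    (hv : IsRep v q) : IsRep (fun ij : ι × κ => u ij.1 * v ij.2) (segre p q) := by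
  obtain ⟨a, ha, h1⟩ := hu.exists_rep_eq
  obtain ⟨b, hb, h2⟩ := hv.exists_rep_eq
  have h : IsRep (fun ij : ι × κ => p.rep ij.1 * q.rep ij.2) (ClassicalAG.segre p q) :=
    isRep_mk _ (by
    obtain ⟨i, hi⟩ := Function.ne_iff.1 p.rep_nonzero
    obtain ⟨j, hj⟩ := Function.ne_iff.1 q.rep_nonzero
    exact Function.ne_iff.2 ⟨(i, j), mul_ne_zero hi hj⟩)
  refine IsRep.of_smul (c := a * b) ?_
  convert h using 1
  funext ij
  simp only [h1, h2, Pi.smul_apply, smul_eq_mul]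
  ring

theorem segre_rep (p : PSp ι) (q : PSp κ) :
    IsRep (fun ij : ι × κ => p.rep ij.1 * q.rep ij.2) (segre p q) :=
  (isRep_rep p).segre (isRep_rep q)

theorem segre_col {p : PSp ι} {q : PSp κ} {j : κ} (hj : ∃ i, (segre p q).rep (i, j) ≠ 0) :
    IsRep (fun a => (segre p q).rep (a, j)) p := by
  obtain ⟨c, hc, h⟩ := (segre_rep p q).exists_rep_eq
  obtain ⟨i, hij⟩ := hj
  have hq : q.rep j ≠ 0 := fun h0 => hij (by simp [h, h0])
  have : (fun a => (segre p q).rep (a, j)) = (c * q.rep j) • p.rep := by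
    funext a
    simp only [h, Pi.smul_apply, smul_eq_mul]
    ring
  rw [this]
  exact (isRep_rep p).smul (mul_ne_zero hc hq)

theorem segre_row {p : PSp ι} {q : PSp κ} {i : ι} (hi : ∃ j, (segre p q).rep (i, j) ≠ 0) :
    IsRep (fun b => (segre p q).rep (i, b)) q := by
  obtain ⟨c, hc, h⟩ := (segre_rep p q).exists_rep_eq
  obtain ⟨j, hij⟩ := hi
  have hp : p.rep i ≠ 0 := fun h0 => hij (by simp [h, h0])
  have : (fun b => (segre p q).rep (i, b)) = (c * p.rep i) • q.rep := by
    funext a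
    simp only [h, Pi.smul_apply, smul_eq_mul]
    ring
  rw [this]
  exact (isRep_rep q).smul (mul_ne_zero hc hp)

@[simp] theorem sfst_segre (p : PSp ι) (q : PSp κ) : sfst (segre p q) = p := by
  have h : ∃ ij : ι × κ, (segre p q).rep ij ≠ 0 := Function.ne_iff.1 (segre p q).rep_nonzero
  exact (isRep_mk _ _).eq (segre_col ⟨h.choose.1, h.choose_spec⟩)

@[simp] theorem ssnd_segre (p : PSp ι) (q : PSp κ) : ssnd (segre p q) = q := by
  have h : ∃ ij : ι × κ, (segre p q).rep ij ≠ 0 := Function.ne_iff.1 (segre p q).rep_nonzero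
  exact (isRep_mk _ _).eq (segre_row ⟨h.choose.2, h.choose_spec⟩)

theorem segre_injective {p p' : PSp ι} {q q' : PSp κ} (h : segre p q = segre p' q') :
    p = p' ∧ q = q' :=
  ⟨by simpa using congrArg sfst h, by simpa using congrArg ssnd h⟩

theorem Reg.segre {A : Set (PSp μ)} {φ : PSp μ → PSp ι} {ψ : PSp μ → PSp κ} (hφ : Reg A φ)
    (hψ : Reg A ψ) : Reg A (fun q => segre (φ q) (ψ q)) :=
  (PReg.tensor hφ hψ).reg fun _ _ => segre_rep _ _

/-- The image of the Segre embedding. -/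
def segreSet (ι κ : Type) : Set (PSp (ι × κ)) := {z | ∃ p q, z = segre p q}

theorem segre_mem (p : PSp ι) (q : PSp κ) : segre p q ∈ segreSet ι κ := ⟨p, q, rfl⟩

theorem segre_sfst_ssnd {z : PSp (ι × κ)} (hz : z ∈ segreSet ι κ) :
    segre (sfst z) (ssnd z) = z := by
  obtain ⟨p, q, rfl⟩ := hz
  simp

theorem reg_sfst : Reg (segreSet ι κ) (sfst : PSp (ι × κ) → PSp ι) := Reg.of_local fun z _ => by
  obtain ⟨⟨i, j⟩, hij⟩ := Function.ne_iff.1 z.rep_nonzero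
  refine ⟨{q | val (X (i, j)) q ≠ 0}, isOpen_val_ne (isHomogeneous_X ℂ _), by simpa [val] using hij,
    PReg.reg (f := fun q a => q.rep (a, j)) ?_ ?_⟩
  · have := preg_rep (A := segreSet ι κ ∩ {q | val (X (i, j)) q ≠ 0})
    exact (PReg.poly this (P := fun a => X (a, j)) (fun a => isHomogeneous_X ℂ _)).congr_smul
      fun q _ => ⟨1, one_ne_zero, by simp⟩
  · rintro _ ⟨⟨p, q, rfl⟩, h⟩
    rw [sfst_segre]
    exact segre_col ⟨i, by simpa [val] using h⟩

theorem reg_ssnd : Reg (segreSet ι κ) (ssnd : PSp (ι × κ) → PSp κ) := Reg.of_local fun z _ => by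
  obtain ⟨⟨i, j⟩, hij⟩ := Function.ne_iff.1 z.rep_nonzero
  refine ⟨{q | val (X (i, j)) q ≠ 0}, isOpen_val_ne (isHomogeneous_X ℂ _), by simpa [val] using hij,
    PReg.reg (f := fun q a => q.rep (i, a)) ?_ ?_⟩
  · have := preg_rep (A := segreSet ι κ ∩ {q | val (X (i, j)) q ≠ 0})
    exact (PReg.poly this (P := fun a => X (i, a)) (fun a => isHomogeneous_X ℂ _)).congr_smul
      fun q _ => ⟨1, one_ne_zero, by simp⟩
  · rintro _ ⟨⟨p, q, rfl⟩, h⟩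
    rw [ssnd_segre]
    exact segre_row ⟨j, by simpa [val] using h⟩

theorem isClosed_segreSet : IsClosed (segreSet ι κ) := by
  have : segreSet ι κ = zeroLocus {f | ∃ a b : ι × κ,
      f = X a * X b - X (a.1, b.2) * X (b.1, a.2)} := by
    ext z
    constructor
    · rintro ⟨p, q, rfl⟩ f ⟨a, b, rfl⟩
      rw [(segre_rep p q).val_eq_zero_iff (d := 2)
        (((isHomogeneous_X ℂ _).mul (isHomogeneous_X ℂ _)).sub
          ((isHomogeneous_X ℂ _).mul (isHomogeneous_X ℂ _)))]
      simp only [map_sub, map_mul, eval_X]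
      ring
    · intro hz
      obtain ⟨⟨i, j⟩, hij⟩ := Function.ne_iff.1 z.rep_nonzero
      have hij' : z.rep (i, j) ≠ 0 := hij
      have hu : (fun a => z.rep (a, j)) ≠ 0 := Function.ne_iff.2 ⟨i, hij⟩
      have hv : (fun b => z.rep (i, b)) ≠ 0 := Function.ne_iff.2 ⟨j, hij⟩
      refine ⟨Projectivization.mk ℂ _ hu, Projectivization.mk ℂ _ hv, (isRep_rep z).eq ?_⟩
      · have h := ((isRep_mk _ hu).segre (isRep_mk _ hv))
        have h2 : z.rep (i, j) • z.rep = fun ab : ι × κ => z.rep (ab.1, j) * z.rep (i, ab.2) := by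
          funext ⟨a, b⟩
          have := hz _ ⟨(i, j), (a, b), rfl⟩
          simp only [val, map_sub, map_mul, eval_X] at this
          simp only [Pi.smul_apply, smul_eq_mul]
          linear_combination this
        rw [← h2] at h
        exact h.of_smul
  rw [this]
  refine isClosed_zeroLocus _ ?_
  rintro f ⟨a, b, rfl⟩
  exact ⟨2, ((isHomogeneous_X ℂ _).mul (isHomogeneous_X ℂ _)).sub
    ((isHomogeneous_X ℂ _).mul (isHomogeneous_X ℂ _))⟩

/-- The product of a closed set with a projective space is closed. -/
theorem isClosed_segre_image {A : Set (PSp ι)} (hA : IsClosed A) :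
    IsClosed {z : PSp (ι × κ) | ∃ p ∈ A, ∃ q, z = segre p q} := by
  obtain ⟨V, hV, h⟩ := (reg_sfst (ι := ι) (κ := κ)).exists_isOpen hA.isOpen_compl
  have : {z : PSp (ι × κ) | ∃ p ∈ A, ∃ q, z = segre p q} = segreSet ι κ ∩ Vᶜ := by
    ext z
    have hz := Set.ext_iff.1 h z
    constructor
    · rintro ⟨p, hp, q, rfl⟩
      refine ⟨segre_mem _ _, fun hV => ?_⟩
      have := (hz.1 ⟨segre_mem _ _, hV⟩).2
      rw [Set.mem_preimage, sfst_segre] at this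
      exact this hp
    · rintro ⟨⟨p, q, rfl⟩, hzV⟩
      refine ⟨p, ?_, q, rfl⟩
      by_contra hp
      exact hzV (hz.2 ⟨segre_mem _ _, by simpa using hp⟩).2
  rw [this]
  exact isClosed_segreSet.inter hV.isClosed_compl

end Segre

/-! ### Irreducibility and extension of morphisms -/

section Irreducible

variable {ι κ : Type}

theorem exists_isRep_eval_ne_zero [Nonempty κ] {G : MvPolynomial κ ℂ} (hG : G ≠ 0) (i : κ) :
    ∃ v : κ → ℂ, v i ≠ 0 ∧ eval v G ≠ 0 := by
  have h : (X i * G : MvPolynomial κ ℂ) ≠ 0 := mul_ne_zero (X_ne_zero i) hG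
  have : ∃ v, eval v (X i * G) ≠ 0 := by
    by_contra hcon
    push Not at hcon
    exact h (MvPolynomial.funext fun v => by rw [hcon v, map_zero])
  obtain ⟨v, hv⟩ := this
  rw [map_mul, eval_X] at hv
  exact ⟨v, left_ne_zero_of_mul hv, right_ne_zero_of_mul hv⟩

/-- A nonzero form does not vanish identically on a nonempty open set. -/
theorem exists_mem_val_ne_zero {O : Set (PSp κ)} (hO : IsOpen O) (hne : O.Nonempty)
    {d : ℕ} {G : MvPolynomial κ ℂ} (hGd : G.IsHomogeneous d) (hG : G ≠ 0) :
    ∃ p ∈ O, val G p ≠ 0 := by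
  obtain ⟨p, hp⟩ := hne
  obtain ⟨i, -⟩ := Function.ne_iff.1 p.rep_nonzero
  have : Nonempty κ := ⟨i⟩
  obtain ⟨e, h, hh, hhp, hhO⟩ := exists_form_of_mem_isOpen hO hp
  have hh0 : h ≠ 0 := by
    rintro rfl
    simp [val] at hhp
  obtain ⟨v, hvi, hv⟩ := exists_isRep_eval_ne_zero (mul_ne_zero hh0 hG) i
  rw [map_mul] at hv
  have hv0 : v ≠ 0 := by
    rintro rfl
    exact hvi rfl
  have hr := isRep_pmk hv0
  refine ⟨pmk v, hhO _ ?_, ?_⟩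
  · rw [Ne, hr.val_eq_zero_iff hh]
    exact left_ne_zero_of_mul hv
  · rw [Ne, hr.val_eq_zero_iff hGd]
    exact right_ne_zero_of_mul hv

theorem isPreirreducible_of_isOpen {O : Set (PSp κ)} (hO : IsOpen O) : IsPreirreducible O := by
  rintro U V hU hV ⟨p, hp⟩ ⟨q, hq⟩
  obtain ⟨d, h, hh, hhq, hhV⟩ := exists_form_of_mem_isOpen hV hq.2
  have hh0 : h ≠ 0 := by
    rintro rfl
    simp [val] at hhq
  obtain ⟨r, hr, hrh⟩ := exists_mem_val_ne_zero (hO.inter hU) ⟨p, hp⟩ hh hh0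
  exact ⟨r, hr.1, hr.2, hhV r hrh⟩

/-- A nonempty relatively open subset of an irreducible set is dense in every relatively open
subset. -/
theorem subset_closure_of_isPreirreducible {A U D : Set (PSp ι)} (hA : IsPreirreducible A)
    (hU : IsOpen U) (hD : IsOpen D) (hne : (A ∩ D).Nonempty) :
    A ∩ U ⊆ closure (A ∩ U ∩ D) := by
  rintro p ⟨hp, hpU⟩
  rw [mem_closure_iff]
  intro V hV hpV
  obtain ⟨q, hqA, ⟨hqV, hqU⟩, hqD⟩ := hA (V ∩ U) D (hV.inter hU) hD ⟨p, hp, hpV, hpU⟩ hne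
  exact ⟨q, hqV, ⟨hqA, hqU⟩, hqD⟩

/-- A map on a dense open subset of an irreducible set that extends to a morphism near every point
extends to a global morphism, since the local extensions agree where they are both defined. -/
theorem exists_reg_extension {S D : Set (PSp ι)} (hS : IsPreirreducible S) (hD : IsOpen D)
    (hne : (S ∩ D).Nonempty) (f₀ : PSp ι → PSp κ)
    (h : ∀ s ∈ S, ∃ W, IsOpen W ∧ s ∈ W ∧ ∃ g : PSp ι → PSp κ, Reg (S ∩ W) g ∧
      ∀ q ∈ S ∩ W, q ∈ D → g q = f₀ q) :
    ∃ f : PSp ι → PSp κ, Reg S f ∧ ∀ q ∈ S ∩ D, f q = f₀ q := by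
  have : Nonempty (PSp ι → PSp κ) := ⟨f₀⟩
  choose! W hW hsW g hg hgf using h
  refine ⟨fun s => g s s, Reg.of_local fun s hs => ⟨W s, hW s hs, hsW s hs, ?_⟩, fun q hq =>
    hgf q hq.1 q ⟨hq.1, hsW q hq.1⟩ hq.2⟩
  refine (hg s hs).congr fun q hq => ?_
  have hsub := subset_closure_of_isPreirreducible hS
    ((hW s hs).inter (hW q hq.1)) hD hne
  refine Reg.eqOn_of_dense ((hg q hq.1).mono ?_) ((hg s hs).mono ?_) hsub ?_ q
    ⟨hq.1, hq.2, hsW q hq.1⟩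
  · exact fun r hr => ⟨hr.1, hr.2.2⟩
  · exact fun r hr => ⟨hr.1, hr.2.1⟩
  · intro r hr
    rw [hgf q hq.1 r ⟨hr.1.1, hr.1.2.2⟩ hr.2, hgf s hs r ⟨hr.1.1, hr.1.2.1⟩ hr.2]

end Irreducible

/-! ### Isomorphisms with explicit inverse -/

/-- `φ` and `ψ` are mutually inverse isomorphisms of `A` and `B`. -/
structure Iso {ι κ : Type} (A : Set (PSp ι)) (B : Set (PSp κ)) (φ : PSp ι → PSp κ)
    (ψ : PSp κ → PSp ι) : Prop where
  mapsTo : Set.MapsTo φ A B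
  mapsTo' : Set.MapsTo ψ B A
  reg : Reg A φ
  reg' : Reg B ψ
  left : ∀ p ∈ A, ψ (φ p) = p
  right : ∀ q ∈ B, φ (ψ q) = q

namespace Iso

variable {ι κ μ : Type} {A : Set (PSp ι)} {B : Set (PSp κ)} {C : Set (PSp μ)}
  {φ : PSp ι → PSp κ} {ψ : PSp κ → PSp ι}

theorem isIsoOn (h : Iso A B φ ψ) : IsIsoOn A B φ :=
  ⟨h.reg.isMorphism h.mapsTo, ψ, h.reg'.isMorphism h.mapsTo', h.left, h.right⟩

theorem trans (h : Iso A B φ ψ) {φ' : PSp κ → PSp μ} {ψ' : PSp μ → PSp κ} (h' : Iso B C φ' ψ') :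
    Iso A C (fun p => φ' (φ p)) (fun q => ψ (ψ' q)) where
  mapsTo p hp := h'.mapsTo (h.mapsTo hp)
  mapsTo' q hq := h.mapsTo' (h'.mapsTo' hq)
  reg := h'.reg.comp h.reg h.mapsTo
  reg' := h.reg'.comp h'.reg' h'.mapsTo'
  left p hp := by rw [h'.left _ (h.mapsTo hp), h.left p hp]
  right q hq := by rw [h.right _ (h'.mapsTo' hq), h'.right q hq]

theorem restrict (h : Iso A B φ ψ) {A' : Set (PSp ι)} {B' : Set (PSp κ)} (hA : A' ⊆ A)
    (hB : B' ⊆ B) (hAB : ∀ p ∈ A, p ∈ A' ↔ φ p ∈ B') : Iso A' B' φ ψ where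
  mapsTo p hp := (hAB p (hA hp)).1 hp
  mapsTo' q hq := (hAB _ (h.mapsTo' (hB hq))).2 (by rwa [h.right q (hB hq)])
  reg := h.reg.mono hA
  reg' := h.reg'.mono hB
  left p hp := h.left p (hA hp)
  right q hq := h.right q (hB hq)

end Iso

/-! ### Charts: the Jacobian criterion and local parameters -/

/-- A morphism is given near every point by forms of the same positive degree. -/
theorem Reg.exists_forms {ι κ : Type} [Finite κ] {A : Set (PSp ι)} {φ : PSp ι → PSp κ}
    (hφ : Reg A φ) {p : PSp ι} (hp : p ∈ A) : ∃ U, IsOpen U ∧ p ∈ U ∧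
      ∃ (d : ℕ) (G : κ → MvPolynomial ι ℂ), 0 < d ∧ (∀ j, (G j).IsHomogeneous d) ∧
        ∀ q ∈ A ∩ U, IsRep (fun j => val (G j) q) (φ q) := by
  classical
  have := Fintype.ofFinite κ
  obtain ⟨U, hU, hpU, c, hc, hcφ⟩ := hφ p hp
  obtain ⟨i, hi⟩ := Function.ne_iff.1 p.rep_nonzero
  choose V hV hpV d g h hg hh hgh using fun j => hcφ j p ⟨hp, hpU⟩
  refine ⟨U ∩ (⋂ j, V j) ∩ {q | val (X i) q ≠ 0},
    (hU.inter (isOpen_iInter_of_finite hV)).inter (isOpen_val_ne (isHomogeneous_X ℂ i)),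
    ⟨⟨hpU, Set.mem_iInter.2 hpV⟩, by simpa [val] using hi⟩, 1 + ∑ j, d j,
    fun j => X i * (g j * ∏ l ∈ Finset.univ.erase j, h l), by positivity, fun j => ?_,
    fun q hq => ?_⟩
  · refine (isHomogeneous_X ℂ i).mul ?_
    rw [← Finset.add_sum_erase _ _ (Finset.mem_univ j)]
    exact (hg j).mul (IsHomogeneous.prod _ _ _ fun l _ => hh l)
  · have hqA : q ∈ A ∩ U := ⟨hq.1, hq.2.1.1⟩
    have hqV : ∀ j, q ∈ A ∩ U ∩ V j := fun j => ⟨hqA, Set.mem_iInter.1 hq.2.1.2 j⟩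
    have hne : val (X i) q * (∏ l, val (h l) q) * c q ≠ 0 :=
      mul_ne_zero (mul_ne_zero hq.2.2 (Finset.prod_ne_zero_iff.2 fun l _ => (hgh l q (hqV l)).1))
        (hc q hqA)
    convert (isRep_rep (φ q)).smul hne using 1
    funext j
    obtain ⟨h1, h2⟩ := hgh j q (hqV j)
    replace h2 : c q * (φ q).rep j = val (g j) q / val (h j) q := h2
    rw [Pi.smul_apply, smul_eq_mul, mul_assoc, h2, ← Finset.mul_prod_erase _ _ (Finset.mem_univ j)]
    have : val (X i * (g j * ∏ l ∈ Finset.univ.erase j, h l)) q =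
        val (X i) q * (val (g j) q * ∏ l ∈ Finset.univ.erase j, val (h l) q) := by
      simp [val, map_prod]
    rw [this]
    field_simp

theorem eval_bind₁_eq {ι κ : Type} (H : κ → MvPolynomial ι ℂ) (v : ι → ℂ) (f : MvPolynomial κ ℂ) :
    eval v (bind₁ H f) = eval (fun j => eval v (H j)) f := by
  induction f using MvPolynomial.induction_on with
  | C a => simp
  | add p q hp hq => simp [hp, hq]
  | mul_X p i hp => simp [hp]

/-- The derivative of `f` at `v` in the direction `w`. -/
def dirDeriv {ι : Type} [Fintype ι] (v w : ι → ℂ) (f : MvPolynomial ι ℂ) : ℂ :=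
  ∑ j, w j * eval v (pderiv j f)

section DirDeriv

variable {ι κ : Type} [Fintype ι] [Fintype κ] (v w : ι → ℂ)

theorem dirDeriv_C (a : ℂ) : dirDeriv v w (C a) = 0 := by simp [dirDeriv]

theorem dirDeriv_add (f g : MvPolynomial ι ℂ) :
    dirDeriv v w (f + g) = dirDeriv v w f + dirDeriv v w g := by
  simp [dirDeriv, mul_add, Finset.sum_add_distrib]

theorem dirDeriv_sub (f g : MvPolynomial ι ℂ) :
    dirDeriv v w (f - g) = dirDeriv v w f - dirDeriv v w g := by
  simp [dirDeriv, mul_sub, Finset.sum_sub_distrib]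

theorem dirDeriv_mul (f g : MvPolynomial ι ℂ) :
    dirDeriv v w (f * g) = dirDeriv v w f * eval v g + eval v f * dirDeriv v w g := by
  simp only [dirDeriv, Derivation.leibniz, map_add, smul_eq_mul, map_mul, Finset.sum_mul,
    Finset.mul_sum, ← Finset.sum_add_distrib]
  exact Finset.sum_congr rfl fun j _ => by ring

theorem dirDeriv_X (i : ι) : dirDeriv v w (X i) = w i := by
  classical
  simp [dirDeriv, pderiv_X, Pi.single_apply]

theorem dirDeriv_bind₁ (H : κ → MvPolynomial ι ℂ) (f : MvPolynomial κ ℂ) :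
    dirDeriv v w (bind₁ H f) =
      dirDeriv (fun j => eval v (H j)) (fun j => dirDeriv v w (H j)) f := by
  induction f using MvPolynomial.induction_on with
  | C a => simp only [bind₁_C_right, dirDeriv_C]
  | add p q hp hq => rw [map_add, dirDeriv_add, dirDeriv_add, hp, hq]
  | mul_X p i hp =>
    rw [map_mul, dirDeriv_mul, dirDeriv_mul, hp, bind₁_X_right, dirDeriv_X, eval_bind₁_eq,
      eval_X]

theorem dirDeriv_self {f : MvPolynomial ι ℂ} {d : ℕ} (hf : f.IsHomogeneous d) :
    dirDeriv v v f = d * eval v f := by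
  have := congrArg (eval v) hf.sum_X_mul_pderiv
  simpa [dirDeriv] using this

theorem dirDeriv_zero : dirDeriv v w 0 = 0 := by simp [dirDeriv]

/-- The derivative of a tuple of polynomials, as a linear map. -/
def derivMap {ι κ : Type} [Fintype ι] (v : ι → ℂ) (H : κ → MvPolynomial ι ℂ) :
    (ι → ℂ) →ₗ[ℂ] (κ → ℂ) where
  toFun w j := dirDeriv v w (H j)
  map_add' a b := by
    funext j
    simp [dirDeriv, add_mul, Finset.sum_add_distrib]
  map_smul' a b := by
    funext j
    simp [dirDeriv, Finset.mul_sum, mul_assoc]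

end DirDeriv

theorem isHomogeneous_bind₁ {ι κ : Type} {H : κ → MvPolynomial ι ℂ} {d e : ℕ}
    (hH : ∀ j, (H j).IsHomogeneous d) {f : MvPolynomial κ ℂ} (hf : f.IsHomogeneous e) :
    (bind₁ H f).IsHomogeneous (d * e) := hf.aeval H hH

/-- If the annihilator of a set of vectors is the image of an injective linear map, the set spans a
space of complementary dimension. -/
theorem finrank_span_of_dotProduct_eq_zero {ι κ : Type} [Fintype ι] [Fintype κ]
    (A : Set (ι → ℂ)) (L : (κ → ℂ) →ₗ[ℂ] (ι → ℂ)) (hL : Function.Injective L)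
    (h : ∀ u, (∀ w ∈ A, w ⬝ᵥ u = 0) ↔ u ∈ LinearMap.range L) :
    Module.finrank ℂ (Submodule.span ℂ A) + Fintype.card κ = Fintype.card ι := by
  classical
  set e := dotProductEquiv ℂ ι
  set M := (Submodule.span ℂ A).map (e : (ι → ℂ) →ₗ[ℂ] Module.Dual ℂ (ι → ℂ)) with hM
  have h1 := Subspace.finrank_add_finrank_dualCoannihilator_eq M
  have h2 : M.dualCoannihilator = LinearMap.range L := by
    ext u
    rw [← h u, Submodule.mem_dualCoannihilator]
    constructor
    · intro hu w hw
      exact hu _ ⟨w, Submodule.subset_span hw, rfl⟩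
    · rintro hu _ ⟨w, hw, rfl⟩
      change w ⬝ᵥ u = 0
      induction hw using Submodule.span_induction with
      | mem w hw => exact hu w hw
      | zero => simp
      | add a b _ _ ha hb => rw [add_dotProduct, ha, hb, add_zero]
      | smul c a _ ha => rw [smul_dotProduct, ha, smul_zero]
  rw [h2, LinearMap.finrank_range_of_inj hL, Module.finrank_fintype_fun_eq_card,
    Module.finrank_fintype_fun_eq_card] at h1
  rw [← h1, hM, LinearEquiv.finrank_map_eq]

/-- If `X` is isomorphic to an open subset of the plane near `p`, the Jacobian matrix of `X` at `p`
has corank three. If `H` and `g` are forms giving the isomorphism and its inverse, the kernel of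
the Jacobian matrix is the image of the derivative of `H`. -/
theorem jacobian_of_iso (X : ProjVariety) {W : Set (PSp X.ι)} (hW : IsOpen W)
    {O : Set (PSp (Fin 3))} (hO : IsOpen O) {φ : PSp X.ι → PSp (Fin 3)}
    {χ : PSp (Fin 3) → PSp X.ι} (h : Iso (X.carrier ∩ W) O φ χ) {p : PSp X.ι}
    (hp : p ∈ X.carrier ∩ W) :
    Module.finrank ℂ (Submodule.span ℂ
      {w : X.ι → ℂ | ∃ f ∈ vanishingForms X, w = fun j => val (pderiv j f) p})
      + 2 + 1 = Nat.card X.ι := by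
  have := X.finite
  have := Fintype.ofFinite X.ι
  obtain ⟨U, hU, hpU, e, g, he, hg, hgr⟩ := h.reg.exists_forms hp
  obtain ⟨V, hV, hpV, d, H, hd, hH, hHr⟩ := h.reg'.exists_forms (h.mapsTo hp)
  set z := p.rep with hz
  set b : Fin 3 → ℂ := fun m => eval z (g m) with hb
  have hbr : IsRep b (φ p) := hgr p ⟨hp, hpU⟩
  obtain ⟨c, hc, hHb⟩ : ∃ c : ℂ, c ≠ 0 ∧ (fun j => eval b (H j)) = c • z := by
    have h1 := hHr _ ⟨h.mapsTo hp, hpV⟩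
    rw [h.left p hp] at h1
    obtain ⟨a, ha, hab⟩ := hbr.exists_eq_smul_rep
    obtain ⟨c, hc, hcz⟩ := h1.exists_eq_smul_rep
    refine ⟨a ^ d * c, mul_ne_zero (pow_ne_zero _ ha) hc, ?_⟩
    funext j
    rw [hab, eval_smul_of_isHomogeneous (hH j), mul_smul, ← hcz]
    rfl
  have hHb' : ∀ j, eval b (H j) = c * z j := fun j => congrFun hHb j
  -- forms on the plane that vanish on an open set are zero
  have hzero : ∀ {n : ℕ} {f : MvPolynomial (Fin 3) ℂ}, f.IsHomogeneous n →
      (∀ w ∈ O ∩ V, χ w ∈ U → val f w = 0) → f = 0 := fun {n f} hf hfO => by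
    by_contra hf0
    obtain ⟨T, hT, hTO⟩ := h.reg'.exists_isOpen hU
    have hpT : φ p ∈ O ∩ T := by
      rw [hTO]
      exact ⟨h.mapsTo hp, by simpa [h.left p hp] using hpU⟩
    obtain ⟨w, hw, hwf⟩ := exists_mem_val_ne_zero ((hO.inter hV).inter hT)
      ⟨φ p, ⟨hpT.1, hpV⟩, hpT.2⟩ hf hf0
    have : w ∈ O ∩ T := ⟨hw.1.1, hw.2⟩
    rw [hTO] at this
    exact hwf (hfO w hw.1 this.2)
  have hgH : ∀ m n, bind₁ H (g m) * MvPolynomial.X n - bind₁ H (g n) * MvPolynomial.X m = 0 :=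
    fun m n => by
    refine hzero (((isHomogeneous_bind₁ hH (hg m)).mul (isHomogeneous_X ℂ n)).sub
      ((isHomogeneous_bind₁ hH (hg n)).mul (isHomogeneous_X ℂ m))) fun w hw hwU => ?_
    have h1 := hgr (χ w) ⟨h.mapsTo' hw.1, hwU⟩
    rw [h.right w hw.1] at h1
    obtain ⟨a, ha, hab⟩ := (hHr w hw).exists_eq_smul_rep
    obtain ⟨a', ha', hab'⟩ := h1.exists_eq_smul_rep
    have h2 : ∀ n, val (bind₁ H (g n)) w = a ^ e * (a' * w.rep n) := fun n => by
      rw [val, eval_bind₁_eq]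
      change eval (fun j => val (H j) w) (g n) = _
      rw [hab, eval_smul_of_isHomogeneous (hg n)]
      exact congrArg _ (congrFun hab' n)
    have h3 : val (bind₁ H (g m) * MvPolynomial.X n - bind₁ H (g n) * MvPolynomial.X m) w =
        val (bind₁ H (g m)) w * w.rep n - val (bind₁ H (g n)) w * w.rep m := by
      simp [val]
    rw [h3, h2, h2]
    ring
  have hvan : ∀ f ∈ vanishingForms X, bind₁ H f = 0 := by
    rintro f ⟨⟨n, hn⟩, hf⟩
    refine hzero (isHomogeneous_bind₁ hH hn) fun w hw _ => ?_
    rw [val, eval_bind₁_eq]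
    exact ((hHr w hw).val_eq_zero_iff hn).1 (hf _ (h.mapsTo' hw.1).1)
  have hEuler : derivMap b H b = (d * c) • z := by
    funext j
    change dirDeriv b b (H j) = _
    rw [dirDeriv_self _ (hH j), hHb', Pi.smul_apply, smul_eq_mul]
    ring
  have hdc : (d * c : ℂ) ≠ 0 := mul_ne_zero (by exact_mod_cast hd.ne') hc
  have hgz : ∀ m, eval (fun j => eval b (H j)) (g m) = c ^ e * b m := fun m => by
    rw [hHb, eval_smul_of_isHomogeneous (hg m)]
  rw [Nat.card_eq_fintype_card, add_assoc]
  refine finrank_span_of_dotProduct_eq_zero (κ := Fin 3) _ (derivMap b H) ?_ fun u => ⟨?_, ?_⟩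
  · rw [injective_iff_map_eq_zero]
    intro u hu
    have h1 : ∀ m n, b m * u n = b n * u m := fun m n => by
      have := congrArg (dirDeriv b u) (hgH m n)
      rw [dirDeriv_zero, dirDeriv_sub, dirDeriv_mul, dirDeriv_mul, dirDeriv_bind₁, dirDeriv_bind₁,
        eval_bind₁_eq, eval_bind₁_eq, hgz, hgz, dirDeriv_X, dirDeriv_X] at this
      change dirDeriv _ (derivMap b H u) _ * _ + _ - (dirDeriv _ (derivMap b H u) _ * _ + _) = 0
        at this
      rw [hu] at this
      have h0 : ∀ f, dirDeriv (fun j => eval b (H j)) 0 f = 0 := fun f => by simp [dirDeriv]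
      rw [h0, h0] at this
      have hce : c ^ e ≠ 0 := pow_ne_zero _ hc
      apply mul_left_cancel₀ hce
      linear_combination this
    obtain ⟨m, hm⟩ := Function.ne_iff.1 hbr.1
    have hm' : b m ≠ 0 := hm
    have h2 : u = (u m / b m) • b := by
      funext n
      rw [Pi.smul_apply, smul_eq_mul]
      field_simp
      linear_combination h1 m n
    rw [h2, map_smul, hEuler, smul_smul] at hu
    have h3 : u m / b m * (d * c) = 0 := by
      by_contra h0
      exact p.rep_nonzero ((smul_eq_zero.1 hu).resolve_left h0)
    rw [h2, (mul_eq_zero.1 h3).resolve_right hdc, zero_smul]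
  · intro hu
    have hu' : ∀ f ∈ vanishingForms X, dirDeriv z u f = 0 := fun f hf => by
      rw [← hu _ ⟨f, hf, rfl⟩]
      exact Finset.sum_congr rfl fun j _ => mul_comm _ _
    -- the equations `q = χ (φ q)` are forms vanishing on `X`
    set η : X.ι → ℂ := derivMap b H (fun m => dirDeriv z u (g m)) with hη
    have hrel : ∀ i j, c * (u i * z j - u j * z i) + (z i * η j - z j * η i) = 0 := fun i j => by
      obtain ⟨T, hT, hTO⟩ := h.reg.exists_isOpen hV
      have hpT : p ∈ X.carrier ∩ W ∩ T := by
        rw [hTO]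
        exact ⟨hp, hpV⟩
      obtain ⟨n, k, hk, hkp, hkT⟩ := exists_form_of_mem_isOpen ((hW.inter hU).inter hT)
        ⟨⟨hp.2, hpU⟩, hpT.2⟩
      set P : MvPolynomial X.ι ℂ := MvPolynomial.X i * bind₁ g (H j)
        - MvPolynomial.X j * bind₁ g (H i) with hP
      have hPz : eval z P = 0 := by
        simp only [hP, map_sub, map_mul, eval_X, eval_bind₁_eq]
        change z i * eval b (H j) - z j * eval b (H i) = 0
        rw [hHb', hHb']
        ring
      have hmem : k * P ∈ vanishingForms X := by
        refine ⟨⟨_, hk.mul (((isHomogeneous_X ℂ i).mul (isHomogeneous_bind₁ hg (hH j))).sub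
          ((isHomogeneous_X ℂ j).mul (isHomogeneous_bind₁ hg (hH i))))⟩, fun q hq => ?_⟩
        rw [val, map_mul]
        by_cases hkq : val k q = 0
        · rw [show eval q.rep k = 0 from hkq, zero_mul]
        have hqT := hkT q hkq
        have hqT' : q ∈ X.carrier ∩ W ∩ T := ⟨⟨hq, hqT.1.1⟩, hqT.2⟩
        rw [hTO] at hqT'
        have h1 := hgr q ⟨hqT'.1, hqT.1.2⟩
        have h2 := hHr (φ q) ⟨h.mapsTo hqT'.1, hqT'.2⟩
        rw [h.left q hqT'.1] at h2
        obtain ⟨a, ha, hab⟩ := h1.exists_eq_smul_rep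
        obtain ⟨a', ha', hab'⟩ := h2.exists_eq_smul_rep
        have h3 : ∀ j, eval q.rep (bind₁ g (H j)) = a ^ d * (a' * q.rep j) := fun j => by
          rw [eval_bind₁_eq]
          change eval (fun m => val (g m) q) (H j) = _
          rw [hab, eval_smul_of_isHomogeneous (hH j)]
          exact congrArg _ (congrFun hab' j)
        simp only [hP, map_sub, map_mul, eval_X, h3]
        ring
      have h1 := hu' _ hmem
      rw [dirDeriv_mul, hPz, mul_zero, zero_add] at h1
      have h2 := (mul_eq_zero.1 h1).resolve_left hkp
      rw [hP, dirDeriv_sub, dirDeriv_mul, dirDeriv_mul, dirDeriv_X, dirDeriv_X, eval_X, eval_X,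
        dirDeriv_bind₁, dirDeriv_bind₁, eval_bind₁_eq, eval_bind₁_eq] at h2
      change u i * eval b (H j) + z i * η j - (u j * eval b (H i) + z j * η i) = 0 at h2
      rw [hHb', hHb'] at h2
      linear_combination h2
    obtain ⟨i, hi⟩ := Function.ne_iff.1 p.rep_nonzero
    have hi' : z i ≠ 0 := hi
    have hcu : c • u = η + ((c * u i - η i) / z i) • z := by
      funext j
      simp only [Pi.smul_apply, smul_eq_mul, Pi.add_apply]
      field_simp
      linear_combination -hrel i j
    have hzmem : z ∈ LinearMap.range (derivMap b H) := by
      have : z = (d * c : ℂ)⁻¹ • derivMap b H b := by rw [hEuler, inv_smul_smul₀ hdc]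
      rw [this]
      exact Submodule.smul_mem _ _ ⟨b, rfl⟩
    have : u = c⁻¹ • (c • u) := (inv_smul_smul₀ hc u).symm
    rw [this, hcu]
    exact Submodule.smul_mem _ _ (Submodule.add_mem _ ⟨_, rfl⟩ (Submodule.smul_mem _ _ hzmem))
  · rintro ⟨y, rfl⟩ w ⟨f, hf, rfl⟩
    have h1 := congrArg (dirDeriv b y) (hvan f hf)
    rw [dirDeriv_zero, dirDeriv_bind₁, hHb] at h1
    obtain ⟨⟨n, hn⟩, -⟩ := hf
    have h2 : ∀ j, eval (c • z) (pderiv j f) = c ^ (n - 1) * eval z (pderiv j f) := fun j =>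
      eval_smul_of_isHomogeneous hn.pderiv _ _
    have h3 : c ^ (n - 1) * ((fun j => val (pderiv j f) p) ⬝ᵥ derivMap b H y) = 0 := by
      rw [← h1, dirDeriv, dotProduct, Finset.mul_sum]
      refine Finset.sum_congr rfl fun j _ => ?_
      rw [h2]
      change _ * (eval z (pderiv j f) * dirDeriv b y (H j)) = _
      ring
    exact (mul_eq_zero.1 h3).resolve_left (pow_ne_zero _ hc)

/-- The point `[1 : a : b]` of the plane. -/
def aff2 (a b : ℂ) : PSp (Fin 3) := pmk ![1, a, b]

theorem aff2_rep (a b : ℂ) : IsRep ![1, a, b] (aff2 a b) :=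
  isRep_pmk (Function.ne_iff.2 ⟨0, one_ne_zero⟩)

theorem aff2_ratio (a b : ℂ) : (aff2 a b).rep 0 ≠ 0 ∧
    (aff2 a b).rep 1 / (aff2 a b).rep 0 = a ∧ (aff2 a b).rep 2 / (aff2 a b).rep 0 = b := by
  obtain ⟨c, hc, h⟩ := (aff2_rep a b).exists_rep_eq
  rw [h]
  simp [hc]

theorem aff2_injective {a b a' b' : ℂ} (h : aff2 a b = aff2 a' b') : a = a' ∧ b = b' := by
  obtain ⟨-, h1, h2⟩ := aff2_ratio a b
  rw [h] at h1 h2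
  exact ⟨h1.symm.trans (aff2_ratio a' b').2.1, h2.symm.trans (aff2_ratio a' b').2.2⟩

theorem eq_aff2 {w : PSp (Fin 3)} (hw : w.rep 0 ≠ 0) :
    w = aff2 (w.rep 1 / w.rep 0) (w.rep 2 / w.rep 0) := by
  refine (isRep_rep w).eq ?_
  convert (aff2_rep (w.rep 1 / w.rep 0) (w.rep 2 / w.rep 0)).smul hw using 1
  funext j
  fin_cases j <;> simp [hw, mul_div_cancel₀]

theorem reg_aff2 {ι : Type} {A : Set (PSp ι)} {a b : PSp ι → ℂ} (ha : IsRegularOn A a)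
    (hb : IsRegularOn A b) : Reg A (fun q => aff2 (a q) (b q)) := by
  refine PReg.reg (f := fun q => ![1, a q, b q]) (PReg.of_isRegularOn fun j => ?_)
    fun q _ => aff2_rep _ _
  fin_cases j
  · exact IsRegularOn.const 1
  · exact ha
  · exact hb

/-- `a` and `b` are affine coordinates that identify `A` with an open subset of the affine plane,
inside the projective plane. -/
def HasChart {ι : Type} (A : Set (PSp ι)) (a b : PSp ι → ℂ) : Prop :=
  ∃ (O : Set (PSp (Fin 3))) (χ : PSp (Fin 3) → PSp ι), IsOpen O ∧
    Iso A O (fun q => aff2 (a q) (b q)) χ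

namespace HasChart

variable {ι : Type} {A : Set (PSp ι)} {a b : PSp ι → ℂ}

theorem reg (h : HasChart A a b) : Reg A (fun q => aff2 (a q) (b q)) :=
  let ⟨_, _, _, h⟩ := h
  h.reg

theorem isRegularOn_fst (h : HasChart A a b) : IsRegularOn A a :=
  (PReg.ratio h.reg 1 0 fun _ _ => (aff2_ratio _ _).1).congr fun _ _ => (aff2_ratio _ _).2.1.symm

theorem isRegularOn_snd (h : HasChart A a b) : IsRegularOn A b :=
  (PReg.ratio h.reg 2 0 fun _ _ => (aff2_ratio _ _).1).congr fun _ _ => (aff2_ratio _ _).2.2.symm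

theorem isPreirreducible (h : HasChart A a b) : IsPreirreducible A := by
  obtain ⟨O, χ, hO, h⟩ := h
  have h1 := (isPreirreducible_of_isOpen hO).image χ h.reg'.continuousOn
  convert h1 using 1
  ext q
  exact ⟨fun hq => ⟨_, h.mapsTo hq, h.left q hq⟩, fun ⟨w, hw, hwq⟩ => hwq ▸ h.mapsTo' hw⟩

/-- Transport of a chart along an isomorphism. -/
theorem comp_iso (h : HasChart A a b) {κ : Type} {B : Set (PSp κ)} {φ : PSp κ → PSp ι}
    {ψ : PSp ι → PSp κ} (hφ : Iso B A φ ψ) :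
    HasChart B (fun q => a (φ q)) (fun q => b (φ q)) := by
  obtain ⟨O, χ, hO, h⟩ := h
  exact ⟨O, _, hO, hφ.trans h⟩

theorem mono (h : HasChart A a b) {U : Set (PSp ι)} (hU : IsOpen U) : HasChart (A ∩ U) a b := by
  obtain ⟨O, χ, hO, h⟩ := h
  obtain ⟨T, hT, hOT⟩ := h.reg'.exists_isOpen hU
  refine ⟨O ∩ T, χ, hO.inter hT, h.restrict Set.inter_subset_left Set.inter_subset_left ?_⟩
  intro p hp
  rw [hOT]
  simp only [Set.mem_inter_iff, Set.mem_preimage, h.left p hp, hp, h.mapsTo hp, true_and]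

theorem congr (h : HasChart A a b) {a' b' : PSp ι → ℂ} (ha : ∀ q ∈ A, a' q = a q)
    (hb : ∀ q ∈ A, b' q = b q) : HasChart A a' b' := by
  obtain ⟨O, χ, hO, h⟩ := h
  have he : ∀ q ∈ A, aff2 (a' q) (b' q) = aff2 (a q) (b q) := fun q hq => by
    rw [ha q hq, hb q hq]
  refine ⟨O, χ, hO, fun q hq => ?_, h.mapsTo', h.reg.congr he, h.reg', fun q hq => ?_,
    fun w hw => ?_⟩
  · simp only [he q hq]
    exact h.mapsTo hq
  · simp only [he q hq]
    exact h.left q hq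
  · simp only [he _ (h.mapsTo' hw)]
    exact h.right w hw

end HasChart

/-- The first-order Taylor expansion of a polynomial at `v`, with polynomial coefficients. -/
theorem exists_eval_eq_add_sum {κ : Type} [Fintype κ] [DecidableEq κ] (P : MvPolynomial κ ℂ)
    (v : κ → ℂ) : ∃ Q : κ → MvPolynomial κ ℂ,
      ∀ u, eval u P = eval v P + ∑ i, (u i - v i) * eval u (Q i) := by
  induction P using MvPolynomial.induction_on with
  | C a => exact ⟨0, fun u => by simp⟩
  | add P R hP hR =>
    obtain ⟨Q, hQ⟩ := hP
    obtain ⟨S, hS⟩ := hR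
    refine ⟨Q + S, fun u => ?_⟩
    rw [map_add, map_add, hQ, hS]
    simp only [Pi.add_apply, map_add, mul_add, Finset.sum_add_distrib]
    ring
  | mul_X P i hP =>
    obtain ⟨Q, hQ⟩ := hP
    refine ⟨fun j => Q j * X i + if j = i then C (eval v P) else 0, fun u => ?_⟩
    have h1 : ∀ j, eval u (Q j * X i + if j = i then C (eval v P) else 0) =
        eval u (Q j) * u i + if j = i then eval v P else 0 := fun j => by
      split_ifs <;> simp
    simp only [h1, mul_add, Finset.sum_add_distrib, mul_ite, mul_zero, Finset.sum_ite_eq',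
      Finset.mem_univ, if_true, map_mul, eval_X, ← mul_assoc, ← Finset.sum_mul]
    rw [hQ u]
    ring

/-- The coordinates of a chart, shifted to the origin, are local parameters. -/
theorem HasChart.isLocalParameters {X : ProjVariety} {W : Set (PSp X.ι)} (hW : IsOpen W)
    {a b : PSp X.ι → ℂ} (h : HasChart (X.carrier ∩ W) a b) {p : PSp X.ι}
    (hp : p ∈ X.carrier ∩ W) :
    IsLocalParameters X p (fun q => a q - a p) (fun q => b q - b p) := by
  refine ⟨sub_self _, sub_self _, fun V g hV hpV hg hgp => ?_⟩
  have har := h.isRegularOn_fst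
  have hbr := h.isRegularOn_snd
  obtain ⟨O, χ, hO, h⟩ := h
  obtain ⟨T, hT, hOT⟩ := h.reg'.exists_isOpen hV
  have hgχ : IsRegularOn (O ∩ T) (fun w => g (χ w)) := by
    rw [hOT]
    exact hg.comp (h.reg'.mono Set.inter_subset_left) fun w hw => ⟨(h.mapsTo' hw.1).1, hw.2⟩
  have hpT : aff2 (a p) (b p) ∈ O ∩ T := by
    rw [hOT]
    exact ⟨h.mapsTo hp, by
      rw [Set.mem_preimage, h.left p hp]
      exact hpV⟩
  obtain ⟨U, hU, hpU, d, G, H, hG, hH, hGH⟩ := hgχ _ hpT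
  obtain ⟨R, hR, hRU⟩ := h.reg.exists_isOpen (hU.inter hT)
  have hmem : ∀ q ∈ X.carrier ∩ W ∩ R, aff2 (a q) (b q) ∈ O ∩ T ∩ U := fun q hq => by
    rw [hRU] at hq
    exact ⟨⟨h.mapsTo hq.1, hq.2.2⟩, hq.2.1⟩
  have hval : ∀ q ∈ X.carrier ∩ W ∩ R, eval ![1, a q, b q] H ≠ 0 ∧
      g q = eval ![1, a q, b q] G / eval ![1, a q, b q] H := fun q hq => by
    obtain ⟨h1, h2⟩ := hGH _ (hmem q hq)
    refine ⟨fun h0 => h1 (((aff2_rep _ _).val_eq_zero_iff hH).2 h0), ?_⟩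
    rw [(aff2_rep _ _).val_div_val hG hH] at h2
    rw [← h2]
    exact congrArg g (h.left q hq.1).symm
  have hpR : p ∈ X.carrier ∩ W ∩ R := by
    rw [hRU]
    exact ⟨hp, hpU, hpT.2⟩
  obtain ⟨Q, hQ⟩ := exists_eval_eq_add_sum G ![1, a p, b p]
  have hG0 : eval ![1, a p, b p] G = 0 := by
    obtain ⟨h1, h2⟩ := hval p hpR
    rw [hgp, eq_comm, div_eq_zero_iff] at h2
    exact h2.resolve_right h1
  have hu : ∀ j, IsRegularOn (X.carrier ∩ (W ∩ R)) (fun q => ![1, a q, b q] j) := fun j => by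
    have hs : X.carrier ∩ (W ∩ R) ⊆ X.carrier ∩ W := fun q hq => ⟨hq.1, hq.2.1⟩
    fin_cases j
    · exact IsRegularOn.const 1
    · exact har.mono hs
    · exact hbr.mono hs
  have hH0 : ∀ q ∈ X.carrier ∩ (W ∩ R), eval ![1, a q, b q] H ≠ 0 := fun q hq =>
    (hval q ⟨⟨hq.1, hq.2.1⟩, hq.2.2⟩).1
  refine ⟨W ∩ R, hW.inter hR, ⟨hp.2, hpR.2⟩, fun q => eval ![1, a q, b q] (Q 1) /
    eval ![1, a q, b q] H, fun q => eval ![1, a q, b q] (Q 2) / eval ![1, a q, b q] H,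
    (IsRegularOn.eval hu _).div (IsRegularOn.eval hu _) hH0,
    (IsRegularOn.eval hu _).div (IsRegularOn.eval hu _) hH0, fun q hq => ?_⟩
  obtain ⟨h1, h2⟩ := hval q ⟨⟨hq.1, hq.2.1⟩, hq.2.2⟩
  rw [h2, hQ, hG0, Fin.sum_univ_three]
  simp only [Matrix.cons_val_zero, Matrix.cons_val_one, Matrix.cons_val]
  field_simp
  ring

/-- Local parameters may be replaced by functions in terms of which they can be expressed. -/
theorem IsLocalParameters.change {X : ProjVariety} {p : PSp X.ι} {f₁ f₂ g₁ g₂ : PSp X.ι → ℂ}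
    (h : IsLocalParameters X p f₁ f₂) (h₁ : g₁ p = 0) (h₂ : g₂ p = 0) {W : Set (PSp X.ι)}
    (hW : IsOpen W) (hpW : p ∈ W) {r s u v : PSp X.ι → ℂ} (hr : IsRegularOn (X.carrier ∩ W) r)
    (hs : IsRegularOn (X.carrier ∩ W) s) (hu : IsRegularOn (X.carrier ∩ W) u)
    (hv : IsRegularOn (X.carrier ∩ W) v)
    (hf₁ : ∀ q ∈ X.carrier ∩ W, f₁ q = r q * g₁ q + s q * g₂ q)
    (hf₂ : ∀ q ∈ X.carrier ∩ W, f₂ q = u q * g₁ q + v q * g₂ q) :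
    IsLocalParameters X p g₁ g₂ := by
  refine ⟨h₁, h₂, fun V g hV hpV hg hgp => ?_⟩
  obtain ⟨T, hT, hpT, a, b, ha, hb, hab⟩ := h.2.2 V g hV hpV hg hgp
  have s1 : X.carrier ∩ (T ∩ W) ⊆ X.carrier ∩ T := fun q hq => ⟨hq.1, hq.2.1⟩
  have s2 : X.carrier ∩ (T ∩ W) ⊆ X.carrier ∩ W := fun q hq => ⟨hq.1, hq.2.2⟩
  refine ⟨T ∩ W, hT.inter hW, ⟨hpT, hpW⟩, fun q => a q * r q + b q * u q,
    fun q => a q * s q + b q * v q,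
    ((ha.mono s1).mul (hr.mono s2)).add ((hb.mono s1).mul (hu.mono s2)),
    ((ha.mono s1).mul (hs.mono s2)).add ((hb.mono s1).mul (hv.mono s2)), fun q hq => ?_⟩
  rw [hab q (s1 hq), hf₁ q (s2 hq), hf₂ q (s2 hq)]
  ring

/-- The affine coordinates on `[w₀ : w₁ : w₂]` are regular where `w₀ ≠ 0`. -/
theorem isRegularOn_affine {E : Set (PSp (Fin 3))} (hE : ∀ w ∈ E, w.rep 0 ≠ 0) (j : Fin 3) :
    IsRegularOn E (fun w => w.rep j / w.rep 0) := PReg.ratio preg_rep j 0 hE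

/-- The complement of the zeros of a regular function in the affine plane is open. -/
theorem isOpen_affine_ne {e : ℂ → ℂ → ℂ}
    (he : IsRegularOn {w : PSp (Fin 3) | w.rep 0 ≠ 0}
      (fun w => e (w.rep 1 / w.rep 0) (w.rep 2 / w.rep 0))) :
    IsOpen {w : PSp (Fin 3) | w.rep 0 ≠ 0 ∧ e (w.rep 1 / w.rep 0) (w.rep 2 / w.rep 0) ≠ 0} := by
  have h0 : IsOpen {w : PSp (Fin 3) | w.rep 0 ≠ 0} := by
    simpa [val] using isOpen_val_ne (isHomogeneous_X ℂ (0 : Fin 3))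
  obtain ⟨W, hW, h⟩ := (PReg.of_isRegularOn (κ := Unit) fun _ => he).exists_isOpen_ne ()
  have : {w : PSp (Fin 3) | w.rep 0 ≠ 0 ∧ e (w.rep 1 / w.rep 0) (w.rep 2 / w.rep 0) ≠ 0} =
      {w : PSp (Fin 3) | w.rep 0 ≠ 0} ∩ W := by
    rw [h]
    rfl
  rw [this]
  exact h0.inter hW

/-- Charts of blow-ups: if `A` has the chart `(a, b)`, and `A'` consists of pairs of a point of
`A` and a point of another projective space, where `a`, `b` and the second point are expressed by
the functions `qa`, `qb`, `m` in terms of new coordinates `a'`, `b'`, then these form a chart. The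
new coordinates are subject to the condition `e (a', b') ≠ 0`. -/
theorem HasChart.lift {ι κ : Type} [Nonempty κ] {A : Set (PSp ι)} {a b : PSp ι → ℂ}
    (h : HasChart A a b)
    {A' : Set (PSp (ι × κ))} {a' b' : PSp (ι × κ) → ℂ} (ha' : IsRegularOn A' a')
    (hb' : IsRegularOn A' b') {e qa qb : ℂ → ℂ → ℂ} {m : ℂ → ℂ → κ → ℂ}
    (he : IsRegularOn {w : PSp (Fin 3) | w.rep 0 ≠ 0}
      (fun w => e (w.rep 1 / w.rep 0) (w.rep 2 / w.rep 0)))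
    (hq : ∀ (E : Set (PSp (Fin 3))) (α β : PSp (Fin 3) → ℂ), IsRegularOn E α → IsRegularOn E β →
      (∀ w ∈ E, e (α w) (β w) ≠ 0) → IsRegularOn E (fun w => qa (α w) (β w)) ∧
        IsRegularOn E (fun w => qb (α w) (β w)) ∧ ∀ j, IsRegularOn E (fun w => m (α w) (β w) j))
    (hm : ∀ α β, m α β ≠ 0)
    (h₁ : ∀ z ∈ A', ∃ q ∈ A, z = segre q (pmk (m (a' z) (b' z))) ∧ e (a' z) (b' z) ≠ 0 ∧
      a q = qa (a' z) (b' z) ∧ b q = qb (a' z) (b' z))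
    (h₂ : ∀ α β, e α β ≠ 0 → ∀ q ∈ A, a q = qa α β → b q = qb α β →
      segre q (pmk (m α β)) ∈ A' ∧ a' (segre q (pmk (m α β))) = α ∧
        b' (segre q (pmk (m α β))) = β) :
    HasChart A' a' b' := by
  obtain ⟨O, χ, hO, h⟩ := h
  set E := {w : PSp (Fin 3) | w.rep 0 ≠ 0 ∧ e (w.rep 1 / w.rep 0) (w.rep 2 / w.rep 0) ≠ 0} with hEdef
  have hE : IsOpen E := isOpen_affine_ne he
  have hE0 : ∀ w ∈ E, w.rep 0 ≠ 0 := fun w hw => hw.1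
  obtain ⟨r1, r2, r3⟩ := hq E _ _ (isRegularOn_affine hE0 1) (isRegularOn_affine hE0 2)
    fun w hw => hw.2
  have hQ := reg_aff2 r1 r2
  obtain ⟨T, hT, hTO⟩ := hQ.exists_isOpen hO
  set Q : PSp (Fin 3) → PSp (Fin 3) := fun w => aff2
    (qa (w.rep 1 / w.rep 0) (w.rep 2 / w.rep 0)) (qb (w.rep 1 / w.rep 0) (w.rep 2 / w.rep 0)) with hQdef
  set M : PSp (Fin 3) → PSp κ := fun w =>
    pmk (m (w.rep 1 / w.rep 0) (w.rep 2 / w.rep 0)) with hMdef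
  have hM : Reg E M := (PReg.of_isRegularOn r3).reg_pmk fun w _ => hm _ _
  have hmaps : Set.MapsTo Q (E ∩ T) O := fun w hw => by
    rw [hTO] at hw
    exact hw.2
  have key : ∀ z ∈ A', aff2 (a' z) (b' z) ∈ E ∩ T ∧
      segre (χ (Q (aff2 (a' z) (b' z)))) (M (aff2 (a' z) (b' z))) = z := fun z hz => by
    obtain ⟨q, hqA, hzq, hze, hqa, hqb⟩ := h₁ z hz
    obtain ⟨t0, t1, t2⟩ := aff2_ratio (a' z) (b' z)
    have hQz : Q (aff2 (a' z) (b' z)) = aff2 (a q) (b q) := by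
      simp only [hQdef, t1, t2, hqa, hqb]
    have hMz : M (aff2 (a' z) (b' z)) = pmk (m (a' z) (b' z)) := by
      simp only [hMdef, t1, t2]
    rw [hTO, hQz, hMz, h.left q hqA]
    refine ⟨⟨⟨t0, by rwa [t1, t2]⟩, ?_⟩, hzq.symm⟩
    rw [Set.mem_preimage, hQz]
    exact h.mapsTo hqA
  have key2 : ∀ w ∈ E ∩ T, segre (χ (Q w)) (M w) ∈ A' ∧
      aff2 (a' (segre (χ (Q w)) (M w))) (b' (segre (χ (Q w)) (M w))) = w := fun w hw => by
    have hQw := hmaps hw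
    have hχ := aff2_injective (h.right _ hQw)
    obtain ⟨g1, g2, g3⟩ := h₂ _ _ hw.1.2 _ (h.mapsTo' hQw) hχ.1 hχ.2
    refine ⟨g1, ?_⟩
    conv_rhs => rw [eq_aff2 hw.1.1]
    exact congrArg₂ aff2 g2 g3
  exact ⟨E ∩ T, fun w => segre (χ (Q w)) (M w), hE.inter hT,
    fun z hz => (key z hz).1, fun w hw => (key2 w hw).1, reg_aff2 ha' hb',
    (h.reg'.comp (hQ.mono Set.inter_subset_left) hmaps).segre (hM.mono Set.inter_subset_left),
    fun z hz => (key z hz).2, fun w hw => (key2 w hw).2⟩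

/-! ### The two kinds of blow-ups, as explicit varieties -/

/-- Families depending on two other ones by bihomogeneous expressions. -/
theorem PReg.comp2 {ι κ μ ν : Type} {A : Set (PSp ι)} {f : PSp ι → κ → ℂ} {g : PSp ι → μ → ℂ}
    (hf : PReg A f) (hg : PReg A g) {T : (κ → ℂ) → (μ → ℂ) → ν → ℂ} (m n : ℕ)
    (hT : ∀ (a b : ℂ) u v j, T (a • u) (b • v) j = a ^ m * b ^ n * T u v j)
    (hreg : ∀ (W : Set (PSp ι)) (u : PSp ι → κ → ℂ) (v : PSp ι → μ → ℂ),
      (∀ i, IsRegularOn W (fun q => u q i)) → (∀ i, IsRegularOn W (fun q => v q i)) →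
      ∀ j, IsRegularOn W (fun q => T (u q) (v q) j)) :
    PReg A (fun q => T (f q) (g q)) := fun p hp => by
  obtain ⟨U, hU, hpU, c, hc, hcf⟩ := hf p hp
  obtain ⟨V, hV, hpV, d, hd, hdg⟩ := hg p hp
  refine ⟨U ∩ V, hU.inter hV, ⟨hpU, hpV⟩, fun q => c q ^ m * d q ^ n,
    fun q hq => mul_ne_zero (pow_ne_zero _ (hc q ⟨hq.1, hq.2.1⟩))
      (pow_ne_zero _ (hd q ⟨hq.1, hq.2.2⟩)), fun j => ?_⟩
  refine (hreg (A ∩ (U ∩ V)) (fun q => c q • f q) (fun q => d q • g q)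
    (fun i => (hcf i).mono fun q hq => ⟨hq.1, hq.2.1⟩)
    (fun i => (hdg i).mono fun q hq => ⟨hq.1, hq.2.2⟩) j).congr fun q _ => ?_
  rw [hT]

/-- The coordinate `x` on `ℙ¹ × ℙ¹`, or `y` if `sw` is set. -/
def cx (sw : Bool) : PSp (Fin 2 × Fin 2) → PSp (Fin 2) := bif sw then ssnd else sfst

/-- The coordinate `y` on `ℙ¹ × ℙ¹`, or `x` if `sw` is set. -/
def cy (sw : Bool) : PSp (Fin 2 × Fin 2) → PSp (Fin 2) := cx !sw

/-- The affine coordinate of a point of `ℙ¹`. -/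
def aff (P : PSp (Fin 2)) : ℂ := P.rep 1 / P.rep 0

theorem P1P1_carrier : P1P1.carrier = segreSet (Fin 2) (Fin 2) := by
  ext z
  exact ⟨fun ⟨pq, h⟩ => ⟨pq.1, pq.2, h.symm⟩, fun ⟨p, q, h⟩ => ⟨(p, q), h.symm⟩⟩

theorem segre_mem_P1P1 (p q : PSp (Fin 2)) : segre p q ∈ P1P1.carrier := ⟨(p, q), rfl⟩

theorem reg_cx (sw : Bool) : Reg P1P1.carrier (cx sw) := by
  rw [P1P1_carrier]
  cases sw
  · exact reg_sfst
  · exact reg_ssnd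

theorem reg_cy (sw : Bool) : Reg P1P1.carrier (cy sw) := reg_cx _

theorem P1P1_ext {q q' : PSp (Fin 2 × Fin 2)} (hq : q ∈ P1P1.carrier) (hq' : q' ∈ P1P1.carrier)
    (sw : Bool) (h : cx sw q = cx sw q') (h' : cy sw q = cy sw q') : q = q' := by
  rw [P1P1_carrier] at hq hq'
  rw [← segre_sfst_ssnd hq, ← segre_sfst_ssnd hq']
  cases sw
  · exact congrArg₂ segre h h'
  · exact congrArg₂ segre h' h

theorem affPt_rep (x : ℂ) : IsRep ![1, x] (affPt x) := isRep_mk _ _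

theorem aff_eq {u : Fin 2 → ℂ} {P : PSp (Fin 2)} (h : IsRep u P) : aff P = u 1 / u 0 := by
  obtain ⟨c, hc, h⟩ := h.exists_rep_eq
  simp only [aff, h, Pi.smul_apply, smul_eq_mul]
  exact mul_div_mul_left _ _ hc

@[simp] theorem aff_affPt (x : ℂ) : aff (affPt x) = x := by
  rw [aff_eq (affPt_rep x)]
  simp

theorem affPt_rep_zero (x : ℂ) : (affPt x).rep 0 ≠ 0 := by
  obtain ⟨c, hc, h⟩ := (affPt_rep x).exists_rep_eq
  rw [h]
  simpa using hc

theorem eq_affPt {P : PSp (Fin 2)} (h : P.rep 0 ≠ 0) : P = affPt (aff P) := by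
  refine (isRep_rep P).eq ?_
  convert (affPt_rep (aff P)).smul h using 1
  funext j
  fin_cases j <;> simp [aff, h, mul_div_cancel₀]

/-- The numerator of `ξ - c`, where `ξ` is the coordinate `cx sw`. -/
def shiftNum (sw : Bool) (c : ℂ) (q : PSp (Fin 2 × Fin 2)) : ℂ :=
  (cx sw q).rep 1 - c * (cx sw q).rep 0

/-- The homogeneous coordinates of the rational map
`(ξ, η) ↦ [ξ - c : η : (ξ - c) η] = [1 / η : 1 / (ξ - c) : 1]` to the plane, where
`(ξ, η)` is `(x, y)` or `(y, x)`. -/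
def planeVec (sw : Bool) (c : ℂ) (q : PSp (Fin 2 × Fin 2)) : Fin 3 → ℂ :=
  ![shiftNum sw c q * (cy sw q).rep 0, (cx sw q).rep 0 * (cy sw q).rep 1,
    shiftNum sw c q * (cy sw q).rep 1]

/-- The closure of the graph of the rational map `planeVec`, given by the equations
`ξ - c = l₂ / l₁` and `η = l₂ / l₀`. -/
def PlaneRel (sw : Bool) (c : ℂ) (q : PSp (Fin 2 × Fin 2)) (l : PSp (Fin 3)) : Prop :=
  l.rep 2 * (cx sw q).rep 0 = shiftNum sw c q * l.rep 1 ∧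
    l.rep 2 * (cy sw q).rep 0 = (cy sw q).rep 1 * l.rep 0

/-- The base point `(ξ, η) = (c, 0)`. -/
def basePt (sw : Bool) (c : ℂ) : PSp (Fin 2 × Fin 2) := bif sw then pt 0 c else pt c 0

theorem planeRel_iff {sw : Bool} {c : ℂ} {q : PSp (Fin 2 × Fin 2)} {l : PSp (Fin 3)}
    {m : Fin 3 → ℂ} (hm : IsRep m l) : PlaneRel sw c q l ↔
      m 2 * (cx sw q).rep 0 = shiftNum sw c q * m 1 ∧
        m 2 * (cy sw q).rep 0 = (cy sw q).rep 1 * m 0 := by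
  obtain ⟨a, ha, h⟩ := hm.exists_rep_eq
  simp only [PlaneRel, h, Pi.smul_apply, smul_eq_mul]
  refine and_congr ⟨fun h => mul_left_cancel₀ ha ?_, fun h => ?_⟩
    ⟨fun h => mul_left_cancel₀ ha ?_, fun h => ?_⟩
  · linear_combination h
  · linear_combination a * h
  · linear_combination h
  · linear_combination a * h

theorem rep_two_ne (P : PSp (Fin 2)) (h : P.rep 0 = 0) : P.rep 1 ≠ 0 := by
  intro h1
  apply P.rep_nonzero
  funext j
  fin_cases j
  · exact h
  · exact h1

theorem planeVec_eq_zero_iff {sw : Bool} {c : ℂ} {q : PSp (Fin 2 × Fin 2)} :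
    planeVec sw c q = 0 ↔ shiftNum sw c q = 0 ∧ (cy sw q).rep 1 = 0 := by
  constructor
  · intro h
    have h0 : shiftNum sw c q * (cy sw q).rep 0 = 0 := congrFun h 0
    have h1 : (cx sw q).rep 0 * (cy sw q).rep 1 = 0 := congrFun h 1
    have h2 : shiftNum sw c q * (cy sw q).rep 1 = 0 := congrFun h 2
    by_cases hA : shiftNum sw c q = 0
    · refine ⟨hA, (mul_eq_zero.1 h1).resolve_left fun hx => rep_two_ne _ hx ?_⟩
      simpa [shiftNum, hx] using hA
    · exact (rep_two_ne _ ((mul_eq_zero.1 h0).resolve_left hA)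
        ((mul_eq_zero.1 h2).resolve_left hA)).elim
  · rintro ⟨h1, h2⟩
    funext j
    fin_cases j <;> simp [planeVec, h1, h2]

theorem basePt_mem (sw : Bool) (c : ℂ) : basePt sw c ∈ P1P1.carrier := by
  cases sw <;> exact segre_mem_P1P1 _ _

theorem cx_basePt (sw : Bool) (c : ℂ) : cx sw (basePt sw c) = affPt c := by
  cases sw <;> simp [cx, basePt, pt]

theorem cy_basePt (sw : Bool) (c : ℂ) : cy sw (basePt sw c) = affPt 0 := by
  cases sw <;> simp [cx, cy, basePt, pt]

theorem eq_basePt_iff {sw : Bool} {c : ℂ} {q : PSp (Fin 2 × Fin 2)} (hq : q ∈ P1P1.carrier) :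
    q = basePt sw c ↔ shiftNum sw c q = 0 ∧ (cy sw q).rep 1 = 0 := by
  constructor
  · rintro rfl
    obtain ⟨a, ha, h⟩ := (affPt_rep c).exists_rep_eq
    obtain ⟨b, hb, h'⟩ := (affPt_rep 0).exists_rep_eq
    simp only [shiftNum, cx_basePt, cy_basePt, h, h']
    constructor
    · simp
      ring
    · simp
  · rintro ⟨h1, h2⟩
    have hx : (cx sw q).rep 0 ≠ 0 := fun hx =>
      rep_two_ne _ hx (by simpa [shiftNum, hx] using h1)
    have hy : (cy sw q).rep 0 ≠ 0 := fun hy => rep_two_ne _ hy h2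
    refine P1P1_ext hq (basePt_mem _ _) sw ?_ ?_
    · rw [cx_basePt, eq_affPt hx]
      congr 1
      rw [shiftNum, sub_eq_zero] at h1
      rw [aff, h1, mul_div_cancel_right₀ _ hx]
    · rw [cy_basePt, eq_affPt hy]
      congr 1
      rw [aff, h2, zero_div]

theorem planeVec_ne_zero {sw : Bool} {c : ℂ} {q : PSp (Fin 2 × Fin 2)} (hq : q ∈ P1P1.carrier)
    (h : q ≠ basePt sw c) : planeVec sw c q ≠ 0 := fun h0 =>
  h ((eq_basePt_iff hq).2 (planeVec_eq_zero_iff.1 h0))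

theorem PlaneRel.isRep {sw : Bool} {c : ℂ} {q : PSp (Fin 2 × Fin 2)} {l : PSp (Fin 3)}
    (h : PlaneRel sw c q l) (h0 : planeVec sw c q ≠ 0) : IsRep (planeVec sw c q) l := by
  have := isRep_pmk h0
  rwa [← ((isRep_rep l).eq_iff this).2] at this
  obtain ⟨h1, h2⟩ := h
  intro i j
  fin_cases i <;> fin_cases j <;> simp [planeVec] <;> grind

theorem planeRel_pmk {sw : Bool} {c : ℂ} {q : PSp (Fin 2 × Fin 2)}
    (h0 : planeVec sw c q ≠ 0) : PlaneRel sw c q (pmk (planeVec sw c q)) := by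
  rw [planeRel_iff (isRep_pmk h0)]
  simp only [planeVec, Matrix.cons_val]
  constructor <;> ring

theorem preg_planeVec {ι : Type} {A : Set (PSp ι)} {φ : PSp ι → PSp (Fin 2 × Fin 2)} (sw : Bool)
    (c : ℂ) (hx : Reg A fun q => cx sw (φ q)) (hy : Reg A fun q => cy sw (φ q)) :
    PReg A (fun q => planeVec sw c (φ q)) := by
  refine PReg.comp2 (T := fun u v => ![(u 1 - c * u 0) * v 0, u 0 * v 1, (u 1 - c * u 0) * v 1])
    hx hy 1 1 ?_ ?_
  · intro a b u v j
    fin_cases j <;> simp <;> ring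
  · intro W u v hu hv j
    have hA := (hu 1).sub ((IsRegularOn.const c).mul (hu 0))
    fin_cases j
    · exact hA.mul (hv 0)
    · exact (hu 0).mul (hv 1)
    · exact hA.mul (hv 1)

/-- The first kind of blow-up: the points of `X` together with the point `l` of the plane. -/
abbrev planeExt (X : ProjVariety) (ε : Mor X P1P1) (sw : Bool) (c : ℂ) : ProjVariety where
  ι := X.ι × Fin 3
  finite := by
    have := X.finite
    infer_instance
  carrier := {z | ∃ q ∈ X.carrier, ∃ l, PlaneRel sw c (ε q) l ∧ z = segre q l}
  isClosed := by
    set A : Set (PSp (X.ι × Fin 3)) := {z | ∃ q ∈ X.carrier, ∃ l, z = segre q l} with hAdef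
    have hA : IsClosed A := isClosed_segre_image X.isClosed
    have hAs : A ⊆ segreSet _ _ := fun z ⟨q, _, l, h⟩ => ⟨q, l, h⟩
    have hm : Set.MapsTo sfst A X.carrier := by
      rintro _ ⟨q, hq, l, rfl⟩
      simpa using hq
    have hε : Reg A (fun z => ε (sfst z)) := ε.isMorphism.reg.comp (reg_sfst.mono hAs) hm
    have hm' : Set.MapsTo (fun z => ε (sfst z)) A P1P1.carrier := fun z hz =>
      ε.isMorphism.1 (hm hz)
    have h1 : PReg A (fun z (_ : Unit) => (ssnd z).rep 2 * (cx sw (ε (sfst z))).rep 0 -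
        shiftNum sw c (ε (sfst z)) * (ssnd z).rep 1) := by
      refine PReg.comp2 (T := fun u v _ => u 2 * v 0 - (v 1 - c * v 0) * u 1)
        (reg_ssnd.mono hAs) ((reg_cx sw).comp hε hm') 1 1 ?_ ?_
      · intro a b u v j
        simp only [Pi.smul_apply, smul_eq_mul]
        ring
      · intro W u v hu hv j
        exact ((hu 2).mul (hv 0)).sub
          (((hv 1).sub ((IsRegularOn.const c).mul (hv 0))).mul (hu 1))
    have h2 : PReg A (fun z (_ : Unit) => (ssnd z).rep 2 * (cy sw (ε (sfst z))).rep 0 -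
        (cy sw (ε (sfst z))).rep 1 * (ssnd z).rep 0) := by
      refine PReg.comp2 (T := fun u v _ => u 2 * v 0 - v 1 * u 0)
        (reg_ssnd.mono hAs) ((reg_cy sw).comp hε hm') 1 1 ?_ ?_
      · intro a b u v j
        simp only [Pi.smul_apply, smul_eq_mul]
        ring
      · intro W u v hu hv j
        exact ((hu 2).mul (hv 0)).sub ((hv 1).mul (hu 0))
    convert (h1.isClosed_zeros hA).inter (h2.isClosed_zeros hA) using 1
    ext z
    constructor
    · rintro ⟨q, hq, l, ⟨hl1, hl2⟩, rfl⟩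
      refine ⟨⟨⟨q, hq, l, rfl⟩, funext fun _ => ?_⟩, ⟨⟨q, hq, l, rfl⟩, funext fun _ => ?_⟩⟩
      · rw [ssnd_segre, sfst_segre, hl1]
        exact sub_self _
      · rw [ssnd_segre, sfst_segre, hl2]
        exact sub_self _
    · rintro ⟨⟨⟨q, hq, l, rfl⟩, hl1⟩, ⟨-, hl2⟩⟩
      have hl1 := congrFun hl1 ()
      have hl2 := congrFun hl2 ()
      rw [ssnd_segre, sfst_segre] at hl1 hl2
      exact ⟨q, hq, l, ⟨sub_eq_zero.1 hl1, sub_eq_zero.1 hl2⟩, rfl⟩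

/-- The second kind of blow-up: the points of `X` together with a point `z` of the line with
`z₀ l₂ = z₁ (t l₁ - l₀)`, for a morphism `l` from `X` to the plane. It is the closure of the graph
of the projection of the plane from `[t : 1 : 0]`, composed with `l`. -/
abbrev lineExt (X : ProjVariety) (l : PSp X.ι → PSp (Fin 3)) (hl : Reg X.carrier l) (t : ℂ) :
    ProjVariety where
  ι := X.ι × Fin 2
  finite := by
    have := X.finite
    infer_instance
  carrier := {z | ∃ q ∈ X.carrier, ∃ r : PSp (Fin 2),
    r.rep 0 * (l q).rep 2 = r.rep 1 * (t * (l q).rep 1 - (l q).rep 0) ∧ z = segre q r}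
  isClosed := by
    set A : Set (PSp (X.ι × Fin 2)) := {z | ∃ q ∈ X.carrier, ∃ l, z = segre q l} with hAdef
    have hA : IsClosed A := isClosed_segre_image X.isClosed
    have hAs : A ⊆ segreSet _ _ := fun z ⟨q, _, l, h⟩ => ⟨q, l, h⟩
    have hm : Set.MapsTo sfst A X.carrier := by
      rintro _ ⟨q, hq, l, rfl⟩
      simpa using hq
    have h1 : PReg A (fun z (_ : Unit) => (ssnd z).rep 0 * (l (sfst z)).rep 2 -
        (ssnd z).rep 1 * (t * (l (sfst z)).rep 1 - (l (sfst z)).rep 0)) := by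
      refine PReg.comp2 (T := fun u v _ => u 0 * v 2 - u 1 * (t * v 1 - v 0))
        (reg_ssnd.mono hAs) (hl.comp (reg_sfst.mono hAs) hm) 1 1 ?_ ?_
      · intro a b u v j
        simp only [Pi.smul_apply, smul_eq_mul]
        ring
      · intro W u v hu hv j
        exact ((hu 0).mul (hv 2)).sub
          ((hu 1).mul (((IsRegularOn.const t).mul (hv 1)).sub (hv 0)))
    convert h1.isClosed_zeros hA using 1
    ext z
    constructor
    · rintro ⟨q, hq, r, hr, rfl⟩
      refine ⟨⟨q, hq, r, rfl⟩, funext fun _ => ?_⟩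
      rw [ssnd_segre, sfst_segre, hr]
      exact sub_self _
    · rintro ⟨⟨q, hq, r, rfl⟩, hr⟩
      have hr := congrFun hr ()
      rw [ssnd_segre, sfst_segre] at hr
      exact ⟨q, hq, r, sub_eq_zero.1 hr, rfl⟩

section Projections

variable {X : ProjVariety} {ε : Mor X P1P1} {sw : Bool} {c : ℂ}

theorem planeExt_subset : (planeExt X ε sw c).carrier ⊆ segreSet _ _ :=
  fun _ ⟨q, _, l, _, h⟩ => ⟨q, l, h⟩

/-- The projection of the first kind of blow-up. -/
def planeProj (X : ProjVariety) (ε : Mor X P1P1) (sw : Bool) (c : ℂ) :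
    Mor (planeExt X ε sw c) X where
  toFun := sfst
  isMorphism := (reg_sfst.mono planeExt_subset).isMorphism (by
    rintro _ ⟨q, hq, l, -, rfl⟩
    simpa using hq)

@[simp] theorem planeProj_segre (q : PSp X.ι) (l : PSp (Fin 3)) :
    planeProj X ε sw c (segre q l) = q := sfst_segre q l

theorem reg_planeExt_snd : Reg (planeExt X ε sw c).carrier ssnd :=
  reg_ssnd.mono planeExt_subset

theorem segre_mem_planeExt {q : PSp X.ι} (hq : q ∈ X.carrier) {l : PSp (Fin 3)} :
    segre q l ∈ (planeExt X ε sw c).carrier ↔ PlaneRel sw c (ε q) l := by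
  constructor
  · rintro ⟨q', hq', l', h, e⟩
    obtain ⟨rfl, rfl⟩ := segre_injective e
    exact h
  · exact fun h => ⟨q, hq, l, h, rfl⟩

variable {l : PSp X.ι → PSp (Fin 3)} {hl : Reg X.carrier l} {t : ℂ}

theorem lineExt_subset : (lineExt X l hl t).carrier ⊆ segreSet _ _ :=
  fun _ ⟨q, _, l, _, h⟩ => ⟨q, l, h⟩

/-- The projection of the second kind of blow-up. -/
def lineProj (X : ProjVariety) (l : PSp X.ι → PSp (Fin 3)) (hl : Reg X.carrier l) (t : ℂ) :
    Mor (lineExt X l hl t) X where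
  toFun := sfst
  isMorphism := (reg_sfst.mono lineExt_subset).isMorphism (by
    rintro _ ⟨q, hq, l, -, rfl⟩
    simpa using hq)

@[simp] theorem lineProj_segre (q : PSp X.ι) (r : PSp (Fin 2)) :
    lineProj X l hl t (segre q r) = q := sfst_segre q r

theorem segre_mem_lineExt {q : PSp X.ι} (hq : q ∈ X.carrier) {r : PSp (Fin 2)} :
    segre q r ∈ (lineExt X l hl t).carrier ↔
      r.rep 0 * (l q).rep 2 = r.rep 1 * (t * (l q).rep 1 - (l q).rep 0) := by
  constructor
  · rintro ⟨q', hq', r', h, e⟩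
    obtain ⟨rfl, rfl⟩ := segre_injective e
    exact h
  · exact fun h => ⟨q, hq, r, h, rfl⟩

end Projections

/-! ### The blow-ups of the first kind -/

theorem isClosed_singleton_psp {ι : Type} (p : PSp ι) : IsClosed ({p} : Set (PSp ι)) := by
  have h : PReg (Set.univ : Set (PSp ι)) (fun q (ij : ι × ι) =>
      q.rep ij.1 * p.rep ij.2 - q.rep ij.2 * p.rep ij.1) := fun r hr => by
    obtain ⟨U, hU, hrU, c, hc, hcf⟩ := preg_rep r hr
    exact ⟨U, hU, hrU, c, hc, fun ij => (((hcf ij.1).mul (IsRegularOn.const (p.rep ij.2))).sub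
      ((hcf ij.2).mul (IsRegularOn.const (p.rep ij.1)))).congr fun q _ => by ring⟩
  convert h.isClosed_zeros isClosed_univ using 1
  ext q
  rw [Set.mem_singleton_iff, (isRep_rep q).eq_iff (isRep_rep p)]
  constructor
  · exact fun h => ⟨trivial, funext fun ij => sub_eq_zero.2 (h _ _)⟩
  · exact fun h i j => sub_eq_zero.1 (congrFun h.2 (i, j))

theorem isOpen_compl_finite {ι : Type} {B : Set (PSp ι)} (hB : B.Finite) : IsOpen Bᶜ := by
  rw [isOpen_compl_iff, ← Set.biUnion_of_singleton B]
  exact hB.isClosed_biUnion fun p _ => isClosed_singleton_psp p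

/-- The coordinates of `l` in the chart where one of them is nonzero. -/
theorem IsRep.of_eq_smul {κ : Type} {v w : κ → ℂ} {p : PSp κ} (h : IsRep w p) {c : ℂ}
    (hvw : w = c • v) : IsRep v p := by
  subst hvw
  exact h.of_smul

section Plane

variable {X : ProjVariety} {ε : Mor X P1P1} {sw : Bool} {c : ℂ}

theorem reg_comp_cx (ε : Mor X P1P1) (sw : Bool) : Reg X.carrier (fun q => cx sw (ε q)) :=
  (reg_cx sw).comp ε.isMorphism.reg ε.isMorphism.1

theorem planeProj_iso {p : PSp X.ι} (hne : ∀ q ∈ X.carrier, q ≠ p → ε q ≠ basePt sw c) :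
    Iso ((planeExt X ε sw c).carrier \ planeProj X ε sw c ⁻¹' {p}) (X.carrier \ {p})
      (planeProj X ε sw c) (fun q => segre q (pmk (planeVec sw c (ε q)))) := by
  have h0 : ∀ q ∈ X.carrier \ {p}, planeVec sw c (ε q) ≠ 0 := fun q hq =>
    planeVec_ne_zero (ε.isMorphism.1 hq.1) (hne q hq.1 hq.2)
  refine ⟨fun z hz => ⟨(planeProj X ε sw c).isMorphism.1 hz.1, hz.2⟩, fun q hq => ?_,
    (planeProj X ε sw c).isMorphism.reg.mono Set.sdiff_subset, ?_, ?_, fun q hq => sfst_segre _ _⟩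
  · refine ⟨(segre_mem_planeExt hq.1).2 (planeRel_pmk (h0 q hq)), ?_⟩
    rw [Set.mem_preimage, planeProj_segre]
    exact hq.2
  · have hx := (reg_comp_cx ε sw).mono (B := X.carrier \ {p}) Set.sdiff_subset
    have hy := (reg_comp_cx ε (!sw)).mono (B := X.carrier \ {p}) Set.sdiff_subset
    exact reg_id.segre ((preg_planeVec sw c hx hy).reg_pmk h0)
  · rintro _ ⟨⟨q, hq, l, hl, rfl⟩, hqp⟩
    rw [Set.mem_preimage, planeProj_segre] at hqp
    have hq0 := h0 q ⟨hq, hqp⟩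
    simp only [planeProj_segre]
    rw [← (hl.isRep hq0).eq_pmk]

theorem shiftNum_eq {q : PSp (Fin 2 × Fin 2)} (h : (cx sw q).rep 0 ≠ 0) :
    shiftNum sw c q = (aff (cx sw q) - c) * (cx sw q).rep 0 := by
  rw [shiftNum, aff]
  field_simp

theorem aff_mul {P : PSp (Fin 2)} (h : P.rep 0 ≠ 0) : P.rep 1 = aff P * P.rep 0 := by
  rw [aff]
  field_simp

theorem affine_planeRel_iff {q : PSp (Fin 2 × Fin 2)} (hx : (cx sw q).rep 0 ≠ 0)
    (hy : (cy sw q).rep 0 ≠ 0) {l : PSp (Fin 3)} {m : Fin 3 → ℂ} (hm : IsRep m l) :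
    PlaneRel sw c q l ↔ m 2 = (aff (cx sw q) - c) * m 1 ∧ m 2 = aff (cy sw q) * m 0 := by
  rw [planeRel_iff hm, shiftNum_eq hx, aff_mul hy]
  refine and_congr ⟨fun h => mul_right_cancel₀ hx ?_, fun h => ?_⟩
    ⟨fun h => mul_right_cancel₀ hy ?_, fun h => ?_⟩
  · linear_combination h
  · rw [h]
    ring
  · linear_combination h
  · rw [h]
    ring

variable {W : Set (PSp X.ι)}

theorem planeProj_isPointBlowup {p : PSp X.ι} (hp : p ∈ X.carrier) (hεp : ε p = basePt sw c)
    (hne : ∀ q ∈ X.carrier, q ≠ p → ε q ≠ basePt sw c) (hW : IsOpen W) (hpW : p ∈ W)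
    (hch : HasChart (X.carrier ∩ W) (fun q => aff (cx sw (ε q)) - c) (fun q => aff (cy sw (ε q))))
    (hfin : ∀ q ∈ X.carrier ∩ W, (cx sw (ε q)).rep 0 ≠ 0 ∧ (cy sw (ε q)).rep 0 ≠ 0) :
    IsPointBlowup (planeProj X ε sw c) p := by
  have ha := hch.isRegularOn_fst
  have hb := hch.isRegularOn_snd
  have ha0 : aff (cx sw (ε p)) - c = 0 := by rw [hεp, cx_basePt, aff_affPt, sub_self]
  have hb0 : aff (cy sw (ε p)) = 0 := by rw [hεp, cy_basePt, aff_affPt]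
  refine ⟨hp, (planeProj_iso hne).isIsoOn, W, fun q => aff (cy sw (ε q)),
    fun q => aff (cx sw (ε q)) - c, hW, hpW, hb, ha, ?_, ?_, fun y => pmk ![(ssnd y).rep 0,
    (ssnd y).rep 1], ?_⟩
  · intro q hq h1 h2
    beta_reduce at h1 h2
    by_contra hqp
    refine hne q hq.1 hqp ((eq_basePt_iff (ε.isMorphism.1 hq.1)).2 ⟨?_, ?_⟩)
    · rw [shiftNum_eq (hfin q hq).1, h2, zero_mul]
    · rw [aff_mul (hfin q hq).2, h1, zero_mul]
  · have h1 := hch.isLocalParameters hW ⟨hp, hpW⟩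
    rw [ha0, hb0] at h1
    refine h1.change hb0 ha0 hW hpW (IsRegularOn.const 0) (IsRegularOn.const 1)
      (IsRegularOn.const 1) (IsRegularOn.const 0) ?_ ?_ <;> intro q _ <;> ring
  set Y := planeExt X ε sw c
  have hl0 : ∀ y ∈ Y.carrier ∩ planeProj X ε sw c ⁻¹' W,
      ![(ssnd y).rep 0, (ssnd y).rep 1] ≠ 0 := by
    rintro _ ⟨⟨q, hq, l, hl, rfl⟩, hqW⟩ h0
    rw [Set.mem_preimage, planeProj_segre] at hqW
    rw [ssnd_segre] at h0
    have e0 : l.rep 0 = 0 := congrFun h0 0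
    have e1 : l.rep 1 = 0 := congrFun h0 1
    obtain ⟨h1, h2⟩ := hfin q ⟨hq, hqW⟩
    rw [affine_planeRel_iff h1 h2 (isRep_rep l), e0, mul_zero] at hl
    apply l.rep_nonzero
    funext j
    fin_cases j
    · exact e0
    · exact e1
    · exact hl.2
  have hYW : Y.carrier ∩ planeProj X ε sw c ⁻¹' W ⊆ Y.carrier := Set.inter_subset_left
  refine Iso.isIsoOn (ψ := fun z => segre (sfst z) (pmk ![(ssnd z).rep 0, (ssnd z).rep 1,
    aff (cy sw (ε (sfst z))) * (ssnd z).rep 0])) ?_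
  have hmodel : blowupModel X W (fun q => aff (cy sw (ε q))) (fun q => aff (cx sw (ε q)) - c) ⊆
      segreSet _ _ := fun z ⟨q, _, l, _, h⟩ => ⟨q, l, h⟩
  have hm3 : ∀ (m : PSp (Fin 2)) (e : ℂ), ![m.rep 0, m.rep 1, e] ≠ 0 := fun m e h0 =>
    rep_two_ne m (congrFun h0 0) (congrFun h0 1)
  refine ⟨?_, ?_, ?_, ?_, ?_, ?_⟩
  · rintro z hz
    have hz0 := hl0 z hz
    obtain ⟨⟨q, hq, l, hl, rfl⟩, hqW⟩ := hz
    rw [Set.mem_preimage, planeProj_segre] at hqW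
    rw [ssnd_segre] at hz0
    obtain ⟨h1, h2⟩ := hfin q ⟨hq, hqW⟩
    rw [affine_planeRel_iff h1 h2 (isRep_rep l)] at hl
    refine ⟨q, ⟨hq, hqW⟩, pmk ![l.rep 0, l.rep 1], ?_, ?_⟩
    · obtain ⟨a, ha, h⟩ := (isRep_pmk hz0).exists_rep_eq
      simp only [h, Pi.smul_apply, smul_eq_mul, Matrix.cons_val_zero, Matrix.cons_val_one]
      linear_combination a * (hl.1 - hl.2)
    · simp only [planeProj_segre, ssnd_segre]
  · rintro _ ⟨q, hq, m, hm, rfl⟩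
    obtain ⟨h1, h2⟩ := hfin q hq
    refine ⟨?_, ?_⟩
    · beta_reduce
      rw [sfst_segre, ssnd_segre]
      refine (segre_mem_planeExt hq.1).2 ((affine_planeRel_iff h1 h2 (isRep_pmk (hm3 _ _))).2 ?_)
      simp only [Matrix.cons_val]
      exact ⟨by linear_combination hm, trivial⟩
    · rw [Set.mem_preimage, planeProj_segre, sfst_segre]
      exact hq.2
  · refine ((planeProj X ε sw c).isMorphism.reg.mono hYW).segre (PReg.reg_pmk ?_ hl0)
    have := (reg_planeExt_snd.mono hYW : Reg (Y.carrier ∩ planeProj X ε sw c ⁻¹' W) ssnd)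
    refine (PReg.poly this (P := ![MvPolynomial.X 0, MvPolynomial.X 1]) (d := 1) ?_).congr_smul ?_
    · intro j
      fin_cases j <;> exact isHomogeneous_X ℂ _
    · intro q _
      refine ⟨1, one_ne_zero, ?_⟩
      funext j
      fin_cases j <;> simp
  · refine (reg_sfst.mono hmodel).segre (PReg.reg_pmk ?_ fun z _ => hm3 _ _)
    have hr : IsRegularOn (blowupModel X W (fun q => aff (cy sw (ε q)))
        (fun q => aff (cx sw (ε q)) - c)) (fun z => aff (cy sw (ε (sfst z)))) :=
      hb.comp (reg_sfst.mono hmodel) (by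
        rintro _ ⟨q, hq, m, hm, rfl⟩
        rwa [sfst_segre])
    refine (PReg.lin (reg_ssnd.mono hmodel) (M := fun (j : Fin 3) (i : Fin 2) z =>
      ![![1, 0], ![0, 1], ![aff (cy sw (ε (sfst z))), 0]] j i) ?_).congr_smul ?_
    · intro j i
      fin_cases j <;> fin_cases i
      all_goals first | exact hr | exact IsRegularOn.const _
    · intro q _
      refine ⟨1, one_ne_zero, ?_⟩
      funext j
      fin_cases j <;> simp
  · intro z hz
    have hz0 := hl0 z hz
    obtain ⟨⟨q, hq, l, hl, rfl⟩, hqW⟩ := hz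
    rw [Set.mem_preimage, planeProj_segre] at hqW
    rw [ssnd_segre] at hz0
    obtain ⟨h1, h2⟩ := hfin q ⟨hq, hqW⟩
    rw [affine_planeRel_iff h1 h2 (isRep_rep l)] at hl
    simp only [planeProj_segre, sfst_segre, ssnd_segre]
    congr 1
    refine (isRep_pmk (hm3 _ _)).eq ?_
    obtain ⟨a, ha, h⟩ := (isRep_pmk hz0).exists_rep_eq
    convert (isRep_rep l).smul ha using 1
    simp only [h, Pi.smul_apply, smul_eq_mul]
    funext j
    fin_cases j
    · simp
    · simp
    · simp only [Fin.reduceFinMk, Matrix.cons_val, Pi.smul_apply, smul_eq_mul]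
      rw [hl.2]
      ring
  · rintro _ ⟨q, hq, m, hm, rfl⟩
    simp only [planeProj_segre, sfst_segre, ssnd_segre]
    congr 1
    obtain ⟨a, ha, h⟩ := (isRep_pmk (hm3 m (aff (cy sw (ε q)) * m.rep 0))).exists_rep_eq
    have : ![(pmk ![m.rep 0, m.rep 1, aff (cy sw (ε q)) * m.rep 0]).rep 0,
        (pmk ![m.rep 0, m.rep 1, aff (cy sw (ε q)) * m.rep 0]).rep 1] = a • m.rep := by
      rw [h]
      funext j
      fin_cases j <;> simp
    rw [this, pmk_smul ha m.rep_nonzero, pmk_rep]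

/-- The chart `(l₀ / l₁, η)` of the blow-up. -/
theorem planeExt_chart_fst
    (hch : HasChart (X.carrier ∩ W) (fun q => aff (cx sw (ε q)) - c) (fun q => aff (cy sw (ε q))))
    (hfin : ∀ q ∈ X.carrier ∩ W, (cx sw (ε q)).rep 0 ≠ 0 ∧ (cy sw (ε q)).rep 0 ≠ 0) :
    HasChart {z ∈ (planeExt X ε sw c).carrier | sfst z ∈ W ∧ (ssnd z).rep 1 ≠ 0}
      (fun z => (ssnd z).rep 0 / (ssnd z).rep 1) (fun z => aff (cy sw (ε (sfst z)))) := by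
  set A' := {z ∈ (planeExt X ε sw c).carrier | sfst z ∈ W ∧ (ssnd z).rep 1 ≠ 0} with hA'
  have hs : A' ⊆ (planeExt X ε sw c).carrier := fun z hz => hz.1
  have hm0 : ∀ α β : ℂ, ![α, 1, α * β] ≠ 0 := fun α β h => one_ne_zero (congrFun h 1)
  refine hch.lift (e := fun _ _ => 1) (qa := fun s y => s * y) (qb := fun s y => y)
    (m := fun s y => ![s, 1, s * y]) ?_ ?_ (IsRegularOn.const 1) ?_ hm0 ?_ ?_
  · exact PReg.ratio (reg_planeExt_snd.mono hs) 0 1 fun z hz => hz.2.2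
  · refine hch.isRegularOn_snd.comp (reg_sfst.mono (hs.trans planeExt_subset)) fun z hz => ?_
    exact ⟨(planeProj X ε sw c).isMorphism.1 hz.1, hz.2.1⟩
  · intro E α β hα hβ _
    refine ⟨hα.mul hβ, hβ, fun j => ?_⟩
    fin_cases j
    · exact hα
    · exact IsRegularOn.const 1
    · exact hα.mul hβ
  · rintro _ ⟨⟨q, hq, l, hl, rfl⟩, hqW, hl1⟩
    rw [sfst_segre] at hqW
    rw [ssnd_segre] at hl1
    obtain ⟨h1, h2⟩ := hfin q ⟨hq, hqW⟩
    rw [affine_planeRel_iff h1 h2 (isRep_rep l)] at hl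
    simp only [sfst_segre, ssnd_segre]
    refine ⟨q, ⟨hq, hqW⟩, ?_, one_ne_zero, ?_, rfl⟩
    · congr 1
      refine IsRep.eq_pmk ((isRep_rep l).of_eq_smul (c := l.rep 1) ?_)
      funext j
      fin_cases j
      · simp [mul_div_cancel₀ _ hl1]
      · simp
      · simp only [Fin.reduceFinMk, Matrix.cons_val, Pi.smul_apply, smul_eq_mul]
        rw [hl.2]
        field_simp
    · field_simp
      linear_combination hl.2 - hl.1
  · intro α β _ q hq h1 h2
    obtain ⟨h3, h4⟩ := hfin q hq
    have hr := isRep_pmk (hm0 α β)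
    obtain ⟨a, ha, h⟩ := hr.exists_rep_eq
    simp only [hA', Set.mem_ofPred_eq, sfst_segre, ssnd_segre]
    refine ⟨⟨(segre_mem_planeExt hq.1).2 ((affine_planeRel_iff h3 h4 hr).2 ?_), hq.2, ?_⟩, ?_, h2⟩
    · rw [h1, h2]
      simp only [Matrix.cons_val]
      constructor <;> ring
    · simpa [h] using ha
    · simp [h, ha]

/-- The chart `(ξ - c, l₁ / l₀)` of the blow-up. -/
theorem planeExt_chart_snd
    (hch : HasChart (X.carrier ∩ W) (fun q => aff (cx sw (ε q)) - c) (fun q => aff (cy sw (ε q))))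
    (hfin : ∀ q ∈ X.carrier ∩ W, (cx sw (ε q)).rep 0 ≠ 0 ∧ (cy sw (ε q)).rep 0 ≠ 0) :
    HasChart {z ∈ (planeExt X ε sw c).carrier | sfst z ∈ W ∧ (ssnd z).rep 0 ≠ 0}
      (fun z => aff (cx sw (ε (sfst z))) - c) (fun z => (ssnd z).rep 1 / (ssnd z).rep 0) := by
  set A' := {z ∈ (planeExt X ε sw c).carrier | sfst z ∈ W ∧ (ssnd z).rep 0 ≠ 0} with hA'
  have hs : A' ⊆ (planeExt X ε sw c).carrier := fun z hz => hz.1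
  have hm0 : ∀ α β : ℂ, ![1, β, β * α] ≠ 0 := fun α β h => one_ne_zero (congrFun h 0)
  refine hch.lift (e := fun _ _ => 1) (qa := fun x _ => x) (qb := fun x m => m * x)
    (m := fun x m => ![1, m, m * x]) ?_ ?_ (IsRegularOn.const 1) ?_ hm0 ?_ ?_
  · refine hch.isRegularOn_fst.comp (reg_sfst.mono (hs.trans planeExt_subset)) fun z hz => ?_
    exact ⟨(planeProj X ε sw c).isMorphism.1 hz.1, hz.2.1⟩
  · exact PReg.ratio (reg_planeExt_snd.mono hs) 1 0 fun z hz => hz.2.2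
  · intro E α β hα hβ _
    refine ⟨hα, hβ.mul hα, fun j => ?_⟩
    fin_cases j
    · exact IsRegularOn.const 1
    · exact hβ
    · exact hβ.mul hα
  · rintro _ ⟨⟨q, hq, l, hl, rfl⟩, hqW, hl1⟩
    rw [sfst_segre] at hqW
    rw [ssnd_segre] at hl1
    obtain ⟨h1, h2⟩ := hfin q ⟨hq, hqW⟩
    rw [affine_planeRel_iff h1 h2 (isRep_rep l)] at hl
    simp only [sfst_segre, ssnd_segre]
    refine ⟨q, ⟨hq, hqW⟩, ?_, one_ne_zero, rfl, ?_⟩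
    · congr 1
      refine IsRep.eq_pmk ((isRep_rep l).of_eq_smul (c := l.rep 0) ?_)
      funext j
      fin_cases j
      · simp
      · simp [mul_div_cancel₀ _ hl1]
      · simp only [Fin.reduceFinMk, Matrix.cons_val, Pi.smul_apply, smul_eq_mul]
        rw [hl.1]
        field_simp
    · field_simp
      linear_combination hl.1 - hl.2
  · intro α β _ q hq h1 h2
    obtain ⟨h3, h4⟩ := hfin q hq
    have hr := isRep_pmk (hm0 α β)
    obtain ⟨a, ha, h⟩ := hr.exists_rep_eq
    simp only [hA', Set.mem_ofPred_eq, sfst_segre, ssnd_segre]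
    refine ⟨⟨(segre_mem_planeExt hq.1).2 ((affine_planeRel_iff h3 h4 hr).2 ?_), hq.2, ?_⟩, h1, ?_⟩
    · rw [h1, h2]
      simp only [Matrix.cons_val]
      constructor <;> ring
    · simpa [h] using ha
    · simp [h, ha]

end Plane

/-! ### The blow-ups of the second kind -/

section Line

variable {X : ProjVariety} {l : PSp X.ι → PSp (Fin 3)} {hl : Reg X.carrier l} {t : ℂ}

/-- The homogeneous coordinates of the projection of the plane from `[t : 1 : 0]`. -/
def lineVec (t : ℂ) (m : Fin 3 → ℂ) : Fin 2 → ℂ := ![t * m 1 - m 0, m 2]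

theorem preg_lineVec {ι : Type} {A : Set (PSp ι)} {f : PSp ι → Fin 3 → ℂ} (hf : PReg A f) :
    PReg A (fun q => lineVec t (f q)) := by
  refine (PReg.lin hf (M := fun (j : Fin 2) (i : Fin 3) _ =>
    ![![-1, t, 0], ![0, 0, 1]] j i) fun _ _ => IsRegularOn.const _).congr_smul fun q _ => ?_
  refine ⟨1, one_ne_zero, ?_⟩
  funext j
  fin_cases j
  · simp [lineVec, Fin.sum_univ_three]
    ring
  · simp [lineVec, Fin.sum_univ_three]

theorem lineVec_smul (a : ℂ) (m : Fin 3 → ℂ) : lineVec t (a • m) = a • lineVec t m := by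
  funext j
  fin_cases j
  · simp [lineVec]
    ring
  · simp [lineVec]

theorem isRep_lineVec {q : PSp X.ι} {r : PSp (Fin 2)}
    (h : r.rep 0 * (l q).rep 2 = r.rep 1 * (t * (l q).rep 1 - (l q).rep 0))
    (h0 : lineVec t (l q).rep ≠ 0) : IsRep (lineVec t (l q).rep) r := by
  have := isRep_pmk h0
  rwa [← ((isRep_rep r).eq_iff this).2] at this
  intro i j
  fin_cases i <;> fin_cases j <;> simp [lineVec] <;> grind

theorem lineProj_iso {p : PSp X.ι} (hne : ∀ q ∈ X.carrier, q ≠ p → lineVec t (l q).rep ≠ 0) :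
    Iso ((lineExt X l hl t).carrier \ lineProj X l hl t ⁻¹' {p}) (X.carrier \ {p})
      (lineProj X l hl t) (fun q => segre q (pmk (lineVec t (l q).rep))) := by
  have h0 : ∀ q ∈ X.carrier \ {p}, lineVec t (l q).rep ≠ 0 := fun q hq => hne q hq.1 hq.2
  refine ⟨fun z hz => ⟨(lineProj X l hl t).isMorphism.1 hz.1, hz.2⟩, fun q hq => ?_,
    (lineProj X l hl t).isMorphism.reg.mono Set.sdiff_subset, ?_, ?_, fun q hq => sfst_segre _ _⟩
  · refine ⟨(segre_mem_lineExt hq.1).2 ?_, ?_⟩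
    · obtain ⟨a, ha, h⟩ := (isRep_pmk (h0 q hq)).exists_rep_eq
      rw [h]
      simp only [lineVec, Pi.smul_apply, smul_eq_mul, Matrix.cons_val_zero, Matrix.cons_val_one]
      ring
    · rw [Set.mem_preimage, lineProj_segre]
      exact hq.2
  · exact reg_id.segre ((preg_lineVec (hl.mono Set.sdiff_subset)).reg_pmk h0)
  · rintro _ ⟨⟨q, hq, r, hr, rfl⟩, hqp⟩
    rw [Set.mem_preimage, lineProj_segre] at hqp
    simp only [lineProj_segre]
    rw [← (isRep_lineVec hr (h0 q ⟨hq, hqp⟩)).eq_pmk]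

variable {W : Set (PSp X.ι)} {a b : PSp X.ι → ℂ}

theorem lineProj_isPointBlowup (ht : t ≠ 0) {p : PSp X.ι} (hp : p ∈ X.carrier)
    (hlp : lineVec t (l p).rep = 0)
    (hne : ∀ q ∈ X.carrier, q ≠ p → lineVec t (l q).rep ≠ 0) (hW : IsOpen W) (hpW : p ∈ W)
    (hch : HasChart (X.carrier ∩ W) a b)
    (hfin : ∀ q ∈ X.carrier ∩ W, (l q).rep 1 ≠ 0 ∧ a q = (l q).rep 0 / (l q).rep 1 ∧
      a q * b q = (l q).rep 2 / (l q).rep 1) :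
    IsPointBlowup (lineProj X l hl t) p := by
  have ha := hch.isRegularOn_fst
  have hb := hch.isRegularOn_snd
  have hap : a p = t := by
    obtain ⟨h1, h2, -⟩ := hfin p ⟨hp, hpW⟩
    have : t * (l p).rep 1 - (l p).rep 0 = 0 := congrFun hlp 0
    rw [h2]
    field_simp
    linear_combination -this
  have hbp : b p = 0 := by
    obtain ⟨-, -, h3⟩ := hfin p ⟨hp, hpW⟩
    have : (l p).rep 2 = 0 := congrFun hlp 1
    rw [this, zero_div, hap] at h3
    exact (mul_eq_zero.1 h3).resolve_left ht
  obtain ⟨V, hV, hVW⟩ := (PReg.of_isRegularOn (κ := Unit) fun _ => ha).exists_isOpen_ne ()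
  have hUa : ∀ q ∈ X.carrier ∩ (W ∩ V), q ∈ X.carrier ∩ W ∧ a q ≠ 0 := fun q hq => by
    have : q ∈ X.carrier ∩ W ∩ V := ⟨⟨hq.1, hq.2.1⟩, hq.2.2⟩
    rw [hVW] at this
    exact this
  have hpV : p ∈ X.carrier ∩ W ∩ V := by
    rw [hVW]
    exact ⟨⟨hp, hpW⟩, by rwa [hap]⟩
  have hs : X.carrier ∩ (W ∩ V) ⊆ X.carrier ∩ W := fun q hq => (hUa q hq).1
  refine ⟨hp, (lineProj_iso hne).isIsoOn, W ∩ V, fun q => a q * b q, fun q => t - a q,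
    hW.inter hV, ⟨hpW, hpV.2⟩, (ha.mul hb).mono hs, ((IsRegularOn.const t).sub ha).mono hs,
    ?_, ?_, ssnd, ?_⟩
  · intro q hq h1 h2
    by_contra hqp
    refine hne q hq.1 hqp ?_
    obtain ⟨h3, h4, h5⟩ := hfin q (hs hq)
    beta_reduce at h1 h2
    rw [h5, div_eq_zero_iff] at h1
    rw [h4] at h2
    funext j
    fin_cases j
    · have : t * (l q).rep 1 - (l q).rep 0 = 0 := by
        field_simp at h2
        linear_combination h2
      simpa [lineVec] using this
    · simpa [lineVec] using h1.resolve_right h3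
  · have h1 := hch.isLocalParameters hW ⟨hp, hpW⟩
    rw [hap, hbp] at h1
    refine h1.change (by rw [hbp, mul_zero]) (by rw [hap, sub_self]) (hW.inter hV)
      ⟨hpW, hpV.2⟩ (IsRegularOn.const 0) (IsRegularOn.const (-1))
      ((ha.mono hs).inv fun q hq => (hUa q hq).2) (IsRegularOn.const 0) ?_ ?_
    · intro q _
      ring
    · intro q hq
      have := (hUa q hq).2
      field_simp
      ring
  -- over `W ∩ V` the blow-up is the local model itself
  · have key : (lineExt X l hl t).carrier ∩ lineProj X l hl t ⁻¹' (W ∩ V) =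
        blowupModel X (W ∩ V) (fun q => a q * b q) (fun q => t - a q) := by
      have hiff : ∀ q ∈ X.carrier ∩ W, ∀ r : PSp (Fin 2),
          r.rep 0 * (l q).rep 2 = r.rep 1 * (t * (l q).rep 1 - (l q).rep 0) ↔
            r.rep 0 * (a q * b q) = r.rep 1 * (t - a q) := fun q hq r => by
        obtain ⟨h3, h4, h5⟩ := hfin q hq
        rw [h5, h4]
        field_simp
      ext z
      constructor
      · rintro ⟨⟨q, hq, r, hr, rfl⟩, hqW⟩
        rw [Set.mem_preimage, lineProj_segre] at hqW
        exact ⟨q, ⟨hq, hqW⟩, r, (hiff q ⟨hq, hqW.1⟩ r).1 hr, rfl⟩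
      · rintro ⟨q, hq, r, hr, rfl⟩
        refine ⟨⟨q, hq.1, r, (hiff q (hs hq) r).2 hr, rfl⟩, ?_⟩
        rw [Set.mem_preimage, lineProj_segre]
        exact hq.2
    rw [← key]
    have hid : ∀ z ∈ (lineExt X l hl t).carrier ∩ lineProj X l hl t ⁻¹' (W ∩ V),
        segre (lineProj X l hl t z) (ssnd z) = z := fun z hz =>
      segre_sfst_ssnd (lineExt_subset hz.1)
    have hr : Reg ((lineExt X l hl t).carrier ∩ lineProj X l hl t ⁻¹' (W ∩ V))
        (fun z => segre (lineProj X l hl t z) (ssnd z)) := reg_id.congr hid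
    refine Iso.isIsoOn (ψ := fun z => z) ⟨fun z hz => ?_, fun z hz => hz, hr, reg_id, hid, hid⟩
    rw [hid z hz]
    exact hz

/-- The chart `(z₀ / z₁, b)` of the blow-up. -/
theorem lineExt_chart_fst (ht : t ≠ 0) (hch : HasChart (X.carrier ∩ W) a b)
    (hfin : ∀ q ∈ X.carrier ∩ W, (l q).rep 1 ≠ 0 ∧ a q = (l q).rep 0 / (l q).rep 1 ∧
      a q * b q = (l q).rep 2 / (l q).rep 1) :
    HasChart {z ∈ (lineExt X l hl t).carrier | sfst z ∈ W ∧ (ssnd z).rep 1 ≠ 0}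
      (fun z => (ssnd z).rep 0 / (ssnd z).rep 1) (fun z => b (sfst z)) := by
  set A' := {z ∈ (lineExt X l hl t).carrier | sfst z ∈ W ∧ (ssnd z).rep 1 ≠ 0} with hA'
  have hs : A' ⊆ (lineExt X l hl t).carrier := fun z hz => hz.1
  have hm0 : ∀ α β : ℂ, ![α, 1] ≠ 0 := fun α β h => one_ne_zero (congrFun h 1)
  have hrel : ∀ q ∈ X.carrier ∩ W, ∀ u v : ℂ,
      u * (l q).rep 2 = v * (t * (l q).rep 1 - (l q).rep 0) ↔ u * (a q * b q) = v * (t - a q) :=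
    fun q hq u v => by
    obtain ⟨h3, h4, h5⟩ := hfin q hq
    rw [h5, h4]
    field_simp
  refine hch.lift (e := fun ζ y => 1 + ζ * y) (qa := fun ζ y => t / (1 + ζ * y))
    (qb := fun _ y => y) (m := fun ζ _ => ![ζ, 1]) ?_ ?_ ?_ ?_ hm0 ?_ ?_
  · exact PReg.ratio (reg_ssnd.mono (hs.trans lineExt_subset)) 0 1 fun z hz => hz.2.2
  · refine hch.isRegularOn_snd.comp (reg_sfst.mono (hs.trans lineExt_subset)) fun z hz => ?_
    exact ⟨(lineProj X l hl t).isMorphism.1 hz.1, hz.2.1⟩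
  · exact (IsRegularOn.const 1).add
      ((isRegularOn_affine (fun w hw => hw) 1).mul (isRegularOn_affine (fun w hw => hw) 2))
  · intro E α β hα hβ he
    refine ⟨(IsRegularOn.const t).div ((IsRegularOn.const 1).add (hα.mul hβ)) he, hβ, fun j => ?_⟩
    fin_cases j
    · exact hα
    · exact IsRegularOn.const 1
  · rintro _ ⟨⟨q, hq, r, hr, rfl⟩, hqW, hr1⟩
    rw [sfst_segre] at hqW
    rw [ssnd_segre] at hr1
    rw [hrel q ⟨hq, hqW⟩] at hr
    simp only [sfst_segre, ssnd_segre]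
    have h1 : a q * (1 + r.rep 0 / r.rep 1 * b q) = t := by
      field_simp
      linear_combination hr
    have h2 : 1 + r.rep 0 / r.rep 1 * b q ≠ 0 := fun h0 => ht (by rw [← h1, h0, mul_zero])
    refine ⟨q, ⟨hq, hqW⟩, ?_, h2, (eq_div_iff h2).2 h1, rfl⟩
    congr 1
    refine IsRep.eq_pmk ((isRep_rep r).of_eq_smul (c := r.rep 1) ?_)
    funext j
    fin_cases j
    · simp [mul_div_cancel₀ _ hr1]
    · simp
  · intro α β he q hq h1 h2
    obtain ⟨c, hc, h⟩ := (isRep_pmk (hm0 α β)).exists_rep_eq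
    simp only [hA', Set.mem_ofPred_eq, sfst_segre, ssnd_segre]
    refine ⟨⟨(segre_mem_lineExt (hl := hl) hq.1).2 ((hrel q hq _ _).2 ?_), hq.2, ?_⟩, ?_, h2⟩
    · rw [h1, h2, h]
      simp only [Pi.smul_apply, smul_eq_mul, Matrix.cons_val_zero, Matrix.cons_val_one]
      field_simp
      ring
    · simpa [h] using hc
    · simp [h, hc]

/-- The chart `(z₁ / z₀, a)` of the blow-up, where `a ≠ 0`. -/
theorem lineExt_chart_snd (hch : HasChart (X.carrier ∩ W) a b)
    (hfin : ∀ q ∈ X.carrier ∩ W, (l q).rep 1 ≠ 0 ∧ a q = (l q).rep 0 / (l q).rep 1 ∧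
      a q * b q = (l q).rep 2 / (l q).rep 1) :
    HasChart {z ∈ (lineExt X l hl t).carrier | sfst z ∈ W ∧ (ssnd z).rep 0 ≠ 0 ∧
      (l (sfst z)).rep 0 ≠ 0}
      (fun z => (ssnd z).rep 1 / (ssnd z).rep 0) (fun z => a (sfst z)) := by
  set A' := {z ∈ (lineExt X l hl t).carrier | sfst z ∈ W ∧ (ssnd z).rep 0 ≠ 0 ∧
      (l (sfst z)).rep 0 ≠ 0} with hA'
  have hs : A' ⊆ (lineExt X l hl t).carrier := fun z hz => hz.1
  have hm0 : ∀ α β : ℂ, ![1, α] ≠ 0 := fun α β h => one_ne_zero (congrFun h 0)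
  have hrel : ∀ q ∈ X.carrier ∩ W, ∀ u v : ℂ,
      u * (l q).rep 2 = v * (t * (l q).rep 1 - (l q).rep 0) ↔ u * (a q * b q) = v * (t - a q) :=
    fun q hq u v => by
    obtain ⟨h3, h4, h5⟩ := hfin q hq
    rw [h5, h4]
    field_simp
  refine hch.lift (e := fun _ s => s) (qa := fun _ s => s)
    (qb := fun ω s => ω * (t - s) / s) (m := fun ω _ => ![1, ω]) ?_ ?_
    (isRegularOn_affine (fun w hw => hw) 2) ?_ hm0 ?_ ?_
  · exact PReg.ratio (reg_ssnd.mono (hs.trans lineExt_subset)) 1 0 fun z hz => hz.2.2.1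
  · refine hch.isRegularOn_fst.comp (reg_sfst.mono (hs.trans lineExt_subset)) fun z hz => ?_
    exact ⟨(lineProj X l hl t).isMorphism.1 hz.1, hz.2.1⟩
  · intro E α β hα hβ he
    refine ⟨hβ, (hα.mul ((IsRegularOn.const t).sub hβ)).div hβ he, fun j => ?_⟩
    fin_cases j
    · exact IsRegularOn.const 1
    · exact hα
  · rintro _ ⟨⟨q, hq, r, hr, rfl⟩, hqW, hr1, hl0⟩
    rw [sfst_segre] at hqW hl0
    rw [ssnd_segre] at hr1
    rw [hrel q ⟨hq, hqW⟩] at hr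
    obtain ⟨h3, h4, -⟩ := hfin q ⟨hq, hqW⟩
    have ha0 : a q ≠ 0 := by
      rw [h4]
      exact div_ne_zero hl0 h3
    simp only [sfst_segre, ssnd_segre]
    refine ⟨q, ⟨hq, hqW⟩, ?_, ha0, rfl, ?_⟩
    · congr 1
      refine IsRep.eq_pmk ((isRep_rep r).of_eq_smul (c := r.rep 0) ?_)
      funext j
      fin_cases j
      · simp
      · simp [mul_div_cancel₀ _ hr1]
    · field_simp
      linear_combination hr
  · intro α β he q hq h1 h2
    obtain ⟨c, hc, h⟩ := (isRep_pmk (hm0 α β)).exists_rep_eq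
    obtain ⟨h3, h4, -⟩ := hfin q hq
    simp only [hA', Set.mem_ofPred_eq, sfst_segre, ssnd_segre]
    refine ⟨⟨(segre_mem_lineExt (hl := hl) hq.1).2 ((hrel q hq _ _).2 ?_), hq.2, ?_, ?_⟩, ?_, h1⟩
    · rw [h1, h2, h]
      simp only [Pi.smul_apply, smul_eq_mul, Matrix.cons_val_zero, Matrix.cons_val_one]
      field_simp
    · simpa [h] using hc
    · intro h0
      rw [h4, h0, zero_div] at h1
      exact he h1.symm
    · simp [h, hc]

end Line

/-! ### Towers of blow-ups of `ℙ¹ × ℙ¹` -/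

/-- `S` is relatively open in `A`. -/
def RelOpen {ι : Type} (A S : Set (PSp ι)) : Prop := ∃ W, IsOpen W ∧ A ∩ W = A ∩ S

theorem RelOpen.inter {ι : Type} {A S T : Set (PSp ι)} (hS : RelOpen A S) (hT : RelOpen A T) :
    RelOpen A (S ∩ T) := by
  obtain ⟨V, hV, h1⟩ := hS
  obtain ⟨W, hW, h2⟩ := hT
  exact ⟨V ∩ W, hV.inter hW, by rw [Set.inter_inter_distrib_left, h1, h2,
    ← Set.inter_inter_distrib_left]⟩

theorem PReg.relOpen_ne {ι κ : Type} {A : Set (PSp ι)} {f : PSp ι → κ → ℂ} (hf : PReg A f)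
    (j : κ) : RelOpen A {q | f q j ≠ 0} := by
  obtain ⟨W, hW, h⟩ := hf.exists_isOpen_ne j
  exact ⟨W, hW, by rw [h]; rfl⟩

theorem Reg.relOpen_preimage {ι κ : Type} {A : Set (PSp ι)} {φ : PSp ι → PSp κ} (hφ : Reg A φ)
    {B S : Set (PSp κ)} (h : Set.MapsTo φ A B) (hS : RelOpen B S) : RelOpen A (φ ⁻¹' S) := by
  obtain ⟨U, hU, hUS⟩ := hS
  obtain ⟨V, hV, hVU⟩ := hφ.exists_isOpen hU
  refine ⟨V, hV, ?_⟩
  rw [hVU]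
  ext q
  refine and_congr_right fun hq => ?_
  have := Set.ext_iff.1 hUS (φ q)
  simpa [h hq] using this

/-- A chart of `X` transported along a morphism that is an isomorphism off the closed set `Z`. -/
theorem HasChart.pullback {X Y : ProjVariety} (π : Mor Y X) {Z : Set (PSp X.ι)} (hZ : IsOpen Zᶜ)
    {ψ : PSp X.ι → PSp Y.ι} (hπ : Iso (Y.carrier \ π ⁻¹' Z) (X.carrier \ Z) π ψ)
    {W : Set (PSp X.ι)} (hW : IsOpen W) {a b : PSp X.ι → ℂ} (h : HasChart (X.carrier ∩ W) a b) :
    ∃ W', IsOpen W' ∧ Y.carrier ∩ W' = Y.carrier ∩ π ⁻¹' (W ∩ Zᶜ) ∧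
      HasChart (Y.carrier ∩ W') (fun q => a (π q)) (fun q => b (π q)) := by
  obtain ⟨W', hW', h'⟩ := π.isMorphism.reg.exists_isOpen (hW.inter hZ)
  refine ⟨W', hW', h', ?_⟩
  rw [h']
  refine (h.mono hZ).comp_iso (hπ.restrict ?_ ?_ ?_)
  · exact fun q hq => ⟨hq.1, hq.2.2⟩
  · exact fun q hq => ⟨hq.1.1, hq.2⟩
  · intro q hq
    have h1 := π.isMorphism.1 hq.1
    simp only [Set.mem_inter_iff, Set.mem_preimage, hq.1, h1, true_and]

/-- There is a chart of `X` around `p` that meets the set `T`. -/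
def ChartAt (X : ProjVariety) (T : Set (PSp X.ι)) (p : PSp X.ι) : Prop :=
  ∃ (W : Set (PSp X.ι)) (a b : PSp X.ι → ℂ), IsOpen W ∧ p ∈ W ∧ HasChart (X.carrier ∩ W) a b ∧
    (X.carrier ∩ W ∩ T).Nonempty

theorem ChartAt.of_iso {X Y : ProjVariety} (π : Mor Y X) {p : PSp X.ι} {ψ : PSp X.ι → PSp Y.ι}
    (hπ : Iso (Y.carrier \ π ⁻¹' {p}) (X.carrier \ {p}) π ψ) {T : Set (PSp X.ι)} (hpT : p ∉ T)
    {y : PSp Y.ι} (hy : y ∈ Y.carrier) (hyp : π y ≠ p) (h : ChartAt X T (π y)) :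
    ChartAt Y (π ⁻¹' T) y := by
  obtain ⟨W, a, b, hW, hyW, hch, r, ⟨hr, hrW⟩, hrT⟩ := h
  obtain ⟨W', hW', hYW, hch'⟩ :=
    hch.pullback π (isOpen_compl_iff.2 (isClosed_singleton_psp p)) hπ hW
  have hrp : r ∈ X.carrier \ {p} := ⟨hr, fun h => hpT (by rwa [← Set.mem_singleton_iff.1 h])⟩
  refine ⟨W', _, _, hW', ?_, hch', ψ r, ?_, ?_⟩
  · exact (hYW.symm.subset ⟨hy, hyW, hyp⟩).2
  · rw [hYW]
    refine ⟨(hπ.mapsTo' hrp).1, ?_⟩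
    rw [Set.mem_preimage, hπ.right r hrp]
    exact ⟨hrW, hrp.2⟩
  · rwa [Set.mem_preimage, hπ.right r hrp]

/-- `ε : X → ℙ¹ × ℙ¹` is an isomorphism off the finite set `B`, and `X` is covered by charts that
meet the preimage of the set `G` of general points, which is disjoint from `B`. -/
structure IsTower (G B : Set (PSp (Fin 2 × Fin 2))) (X : ProjVariety) (ε : Mor X P1P1) : Prop where
  finite : B.Finite
  subset : G ⊆ P1P1.carrier
  disjoint : ∀ q ∈ G, q ∉ B
  iso : ∃ ψ, Iso (X.carrier \ ε ⁻¹' B) (P1P1.carrier \ B) ε ψ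
  chart : ∀ p ∈ X.carrier, ChartAt X (ε ⁻¹' G) p

theorem reg_affPt {ι : Type} {A : Set (PSp ι)} {f : PSp ι → ℂ} (hf : IsRegularOn A f) :
    Reg A (fun q => affPt (f q)) := by
  refine PReg.reg (f := fun q => ![1, f q]) (PReg.of_isRegularOn fun j => ?_) fun q _ => affPt_rep _
  fin_cases j
  · exact IsRegularOn.const 1
  · exact hf

/-- The point with coordinates `ξ = P` and `η = Q`. -/
def mkPt (sw : Bool) (P Q : PSp (Fin 2)) : PSp (Fin 2 × Fin 2) :=
  bif sw then segre Q P else segre P Q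

@[simp] theorem cx_mkPt (sw : Bool) (P Q : PSp (Fin 2)) : cx sw (mkPt sw P Q) = P := by
  cases sw <;> simp [cx, mkPt]

@[simp] theorem cy_mkPt (sw : Bool) (P Q : PSp (Fin 2)) : cy sw (mkPt sw P Q) = Q := by
  cases sw <;> simp [cx, cy, mkPt]

theorem mkPt_mem (sw : Bool) (P Q : PSp (Fin 2)) : mkPt sw P Q ∈ P1P1.carrier := by
  cases sw <;> exact segre_mem_P1P1 _ _

theorem mkPt_cx_cy {sw : Bool} {q : PSp (Fin 2 × Fin 2)} (hq : q ∈ P1P1.carrier) :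
    mkPt sw (cx sw q) (cy sw q) = q :=
  P1P1_ext (mkPt_mem _ _ _) hq sw (by simp) (by simp)

theorem reg_mkPt {ι : Type} {A : Set (PSp ι)} (sw : Bool) {φ ψ : PSp ι → PSp (Fin 2)}
    (hφ : Reg A φ) (hψ : Reg A ψ) : Reg A (fun q => mkPt sw (φ q) (ψ q)) := by
  cases sw
  · exact hφ.segre hψ
  · exact hψ.segre hφ

/-- A local coordinate on `ℙ¹`: the affine coordinate shifted by `c`, or the inverse coordinate. -/
def lineCoord (i : Fin 2) (c : ℂ) (P : PSp (Fin 2)) : ℂ := P.rep (1 - i) / P.rep i - c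

/-- The inverse of `lineCoord`. -/
def linePt (i : Fin 2) (c x : ℂ) : PSp (Fin 2) := pmk (fun j => if j = i then 1 else x + c)

theorem linePt_rep (i : Fin 2) (c x : ℂ) :
    IsRep (fun j => if j = i then 1 else x + c) (linePt i c x) :=
  isRep_pmk (Function.ne_iff.2 ⟨i, by simp⟩)

theorem one_sub_ne (i : Fin 2) : 1 - i ≠ i := by
  fin_cases i <;> decide

theorem linePt_rep_ne (i : Fin 2) (c x : ℂ) : (linePt i c x).rep i ≠ 0 := by
  obtain ⟨a, ha, h⟩ := (linePt_rep i c x).exists_rep_eq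
  simpa [h] using ha

theorem lineCoord_linePt (i : Fin 2) (c x : ℂ) : lineCoord i c (linePt i c x) = x := by
  obtain ⟨a, ha, h⟩ := (linePt_rep i c x).exists_rep_eq
  simp [lineCoord, h, one_sub_ne, ha]

theorem linePt_lineCoord {i : Fin 2} {c : ℂ} {P : PSp (Fin 2)} (h : P.rep i ≠ 0) :
    linePt i c (lineCoord i c P) = P := by
  refine ((isRep_rep P).eq ?_).symm
  convert (linePt_rep i c (lineCoord i c P)).smul h using 1
  funext j
  fin_cases i <;> fin_cases j <;> simp_all [lineCoord, mul_div_cancel₀]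

/-- The product charts of `ℙ¹ × ℙ¹`. -/
theorem P1P1_chart (sw : Bool) (i j : Fin 2) (c : ℂ) :
    HasChart {q ∈ P1P1.carrier | (cx sw q).rep i ≠ 0 ∧ (cy sw q).rep j ≠ 0}
      (fun q => lineCoord i c (cx sw q)) (fun q => lineCoord j 0 (cy sw q)) := by
  set A := {q ∈ P1P1.carrier | (cx sw q).rep i ≠ 0 ∧ (cy sw q).rep j ≠ 0} with hA
  have hs : A ⊆ P1P1.carrier := fun q hq => hq.1
  have hO : IsOpen {w : PSp (Fin 3) | w.rep 0 ≠ 0} := by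
    simpa [val] using isOpen_val_ne (isHomogeneous_X ℂ (0 : Fin 3))
  have hreg : ∀ (k : Fin 3) (i : Fin 2) (c : ℂ), Reg {w : PSp (Fin 3) | w.rep 0 ≠ 0}
      (fun w => linePt i c (w.rep k / w.rep 0)) := fun k i c => by
    refine PReg.reg_pmk (PReg.of_isRegularOn fun j => ?_) fun w _ =>
      Function.ne_iff.2 ⟨i, by simp⟩
    by_cases hj : j = i
    · simp only [hj, if_true]
      exact IsRegularOn.const 1
    · simp only [hj, if_false]
      exact (isRegularOn_affine (E := {w : PSp (Fin 3) | w.rep 0 ≠ 0}) (fun w hw => hw) k).add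
        (IsRegularOn.const c)
  refine ⟨{w | w.rep 0 ≠ 0}, fun w => mkPt sw (linePt i c (w.rep 1 / w.rep 0))
    (linePt j 0 (w.rep 2 / w.rep 0)), hO, fun q _ => (aff2_ratio _ _).1, fun w hw => ?_,
    reg_aff2 ?_ ?_, reg_mkPt sw (hreg 1 i c) (hreg 2 j 0), fun q hq => ?_, fun w hw => ?_⟩
  · exact ⟨mkPt_mem _ _ _, by simpa using linePt_rep_ne _ _ _, by simpa using linePt_rep_ne _ _ _⟩
  · exact (PReg.ratio ((reg_cx sw).mono hs) (1 - i) i fun q hq => hq.2.1).sub (IsRegularOn.const c)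
  · exact (PReg.ratio ((reg_cy sw).mono hs) (1 - j) j fun q hq => hq.2.2).sub (IsRegularOn.const 0)
  · obtain ⟨-, h1, h2⟩ := aff2_ratio (lineCoord i c (cx sw q)) (lineCoord j 0 (cy sw q))
    simp only [h1, h2, linePt_lineCoord hq.2.1, linePt_lineCoord hq.2.2]
    exact mkPt_cx_cy hq.1
  · simp only [cx_mkPt, cy_mkPt, lineCoord_linePt]
    exact (eq_aff2 hw).symm

theorem relOpen_P1P1 (sw : Bool) (i j : Fin 2) :
    RelOpen P1P1.carrier {q | (cx sw q).rep i ≠ 0 ∧ (cy sw q).rep j ≠ 0} :=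
  (PReg.relOpen_ne (reg_cx sw) i).inter (PReg.relOpen_ne (reg_cy sw) j)

/-- The identity morphism. -/
def idMor (X : ProjVariety) : Mor X X where
  toFun := fun q => q
  isMorphism := reg_id.isMorphism fun _ h => h

theorem isTower_P1P1 {G : Set (PSp (Fin 2 × Fin 2))} (hG : G ⊆ P1P1.carrier) (hne : G.Nonempty)
    (h : ∀ q ∈ G, ∀ i j, (cx false q).rep i ≠ 0 ∧ (cy false q).rep j ≠ 0) :
    IsTower G ∅ P1P1 (idMor P1P1) where
  finite := Set.finite_empty
  subset := hG
  disjoint q _ := id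
  iso := ⟨fun q => q, fun q hq => ⟨hq.1, id⟩, fun q hq => ⟨hq.1, id⟩, reg_id, reg_id,
    fun _ _ => rfl, fun _ _ => rfl⟩
  chart p hp := by
    obtain ⟨i, hi⟩ := Function.ne_iff.1 (cx false p).rep_nonzero
    obtain ⟨j, hj⟩ := Function.ne_iff.1 (cy false p).rep_nonzero
    obtain ⟨W, hW, hPW⟩ := relOpen_P1P1 false i j
    have hch := P1P1_chart false i j 0
    have he : {q ∈ P1P1.carrier | (cx false q).rep i ≠ 0 ∧ (cy false q).rep j ≠ 0} =
      P1P1.carrier ∩ W := by rw [hPW]; rfl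
    rw [he] at hch
    obtain ⟨q, hq⟩ := hne
    refine ⟨W, _, _, hW, (hPW.symm.subset ⟨hp, hi, hj⟩).2, hch, q, ?_, hq⟩
    exact hPW.symm.subset ⟨hG hq, h q hq i j⟩

/-- The conditions on general points that come from the centre `(ξ, η) = (c, 0)` and the slope
`t`. -/
def GeneralFor (sw : Bool) (c t : ℂ) (q : PSp (Fin 2 × Fin 2)) : Prop :=
  (∀ j, planeVec sw c q j ≠ 0) ∧ ∀ j, lineVec t (planeVec sw c q) j ≠ 0

/-- The composite of a blow-up of the first kind and the blow-up of the second kind that follows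
it. -/
abbrev twoExt (X : ProjVariety) (ε : Mor X P1P1) (sw : Bool) (c t : ℂ) : ProjVariety :=
  lineExt (planeExt X ε sw c) ssnd reg_planeExt_snd t

/-- The morphism from the first blow-up to `ℙ¹ × ℙ¹`. -/
abbrev planeMap (X : ProjVariety) (ε : Mor X P1P1) (sw : Bool) (c : ℂ) :
    Mor (planeExt X ε sw c) P1P1 := ε.comp (planeProj X ε sw c)

/-- The projection from the second blow-up to the first one. -/
abbrev twoProj (X : ProjVariety) (ε : Mor X P1P1) (sw : Bool) (c t : ℂ) :
    Mor (twoExt X ε sw c t) (planeExt X ε sw c) :=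
  lineProj (planeExt X ε sw c) ssnd reg_planeExt_snd t

/-- The morphism from the second blow-up to `ℙ¹ × ℙ¹`. -/
abbrev twoMap (X : ProjVariety) (ε : Mor X P1P1) (sw : Bool) (c t : ℂ) :
    Mor (twoExt X ε sw c t) P1P1 := (planeMap X ε sw c).comp (twoProj X ε sw c t)

/-- Adding a pair of blow-ups to a tower. -/
theorem IsTower.step {G B : Set (PSp (Fin 2 × Fin 2))} {X : ProjVariety} {ε : Mor X P1P1}
    (h : IsTower G B X ε) (hG : G.Nonempty) {sw : Bool} {c t : ℂ} (ht : t ≠ 0)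
    (hgen : ∀ q ∈ G, GeneralFor sw c t q) (hb : basePt sw c ∉ B) :
    ∃ (p : PSp X.ι) (p' : PSp (planeExt X ε sw c).ι),
      IsPointBlowup (planeProj X ε sw c) p ∧ IsPointBlowup (twoProj X ε sw c t) p' ∧
      ε p = basePt sw c ∧ planeProj X ε sw c p' = p ∧
      QuotientHasValue (planeMap X ε sw c) (fun z => aff (cx sw z) - c) (fun z => aff (cy sw z))
        p' t ∧
      IsTower G (insert (basePt sw c) B) (twoExt X ε sw c t) (twoMap X ε sw c t) := by
  obtain ⟨hBfin, hGsub, hGB, ⟨ψ, hψ⟩, hcharts⟩ := h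
  have hb' : basePt sw c ∈ P1P1.carrier \ B := ⟨basePt_mem sw c, hb⟩
  set p := ψ (basePt sw c) with hpdef
  have hpX : p ∈ X.carrier := (hψ.mapsTo' hb').1
  have hεp : ε p = basePt sw c := hψ.right _ hb'
  have huniq : ∀ q ∈ X.carrier, ε q = basePt sw c → q = p := fun q hq hqb => by
    rw [hpdef, ← hqb, hψ.left q ⟨hq, by rwa [Set.mem_preimage, hqb]⟩]
  have hne : ∀ q ∈ X.carrier, q ≠ p → ε q ≠ basePt sw c := fun q hq hqp hqb =>
    hqp (huniq q hq hqb)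
  have hbG : basePt sw c ∉ G := fun hbG => (hgen _ hbG).1 0 (by
    rw [(planeVec_eq_zero_iff (sw := sw) (c := c)).2 ((eq_basePt_iff (basePt_mem sw c)).1 rfl)]
    rfl)
  have hGne : ∀ q ∈ G, planeVec sw c q ≠ 0 := fun q hq h0 => (hgen q hq).1 0 (by rw [h0]; rfl)
  -- the chart around the centre
  obtain ⟨W, hW, hpW, hch, hfin, q₀, ⟨hq₀, hq₀W⟩, hq₀G⟩ : ∃ W, IsOpen W ∧ p ∈ W ∧
      HasChart (X.carrier ∩ W) (fun q => aff (cx sw (ε q)) - c) (fun q => aff (cy sw (ε q))) ∧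
      (∀ q ∈ X.carrier ∩ W, (cx sw (ε q)).rep 0 ≠ 0 ∧ (cy sw (ε q)).rep 0 ≠ 0) ∧
      (X.carrier ∩ W ∩ ε ⁻¹' G).Nonempty := by
    obtain ⟨V, hV, hPV⟩ := relOpen_P1P1 sw 0 0
    have hch := P1P1_chart sw 0 0 c
    have he : {q ∈ P1P1.carrier | (cx sw q).rep 0 ≠ 0 ∧ (cy sw q).rep 0 ≠ 0} =
      P1P1.carrier ∩ V := by rw [hPV]; rfl
    rw [he] at hch
    obtain ⟨W, hW, hXW, hch'⟩ := hch.pullback ε (isOpen_compl_finite hBfin) hψ hV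
    have hV' : ∀ q ∈ P1P1.carrier, q ∈ V ↔ (cx sw q).rep 0 ≠ 0 ∧ (cy sw q).rep 0 ≠ 0 :=
      fun q hq => by
      have := Set.ext_iff.1 hPV q
      simpa only [Set.mem_inter_iff, hq, true_and, Set.mem_ofPred_eq] using this
    refine ⟨W, hW, ?_, hch'.congr ?_ ?_, ?_, ?_⟩
    · refine (hXW.symm.subset ⟨hpX, ?_⟩).2
      rw [Set.mem_preimage, hεp]
      refine ⟨(hV' _ hb'.1).2 ?_, hb⟩
      rw [cx_basePt, cy_basePt]
      exact ⟨affPt_rep_zero _, affPt_rep_zero _⟩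
    · exact fun q _ => rfl
    · exact fun q _ => (sub_zero _).symm
    · intro q hq
      rw [hXW] at hq
      exact (hV' _ (ε.isMorphism.1 hq.1)).1 hq.2.1
    · obtain ⟨g, hg⟩ := hG
      have hgP : g ∈ P1P1.carrier \ B := ⟨hGsub hg, hGB g hg⟩
      refine ⟨ψ g, ?_, ?_⟩
      · rw [hXW]
        refine ⟨(hψ.mapsTo' hgP).1, ?_⟩
        rw [Set.mem_preimage, hψ.right g hgP]
        refine ⟨(hV' _ hgP.1).2 ⟨fun h0 => ?_, fun h0 => ?_⟩, hgP.2⟩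
        · exact (hgen g hg).1 1 (by simp [planeVec, h0])
        · exact (hgen g hg).1 0 (by simp [planeVec, h0])
      · rwa [Set.mem_preimage, hψ.right g hgP]
  set X' := planeExt X ε sw c with hX'
  set X'' := twoExt X ε sw c t with hX''
  have hπ := planeProj_iso (ε := ε) hne
  have hrel : ∀ l : PSp (Fin 3), PlaneRel sw c (basePt sw c) l ↔ l.rep 2 = 0 := fun l => by
    rw [affine_planeRel_iff (by rw [cx_basePt]; exact affPt_rep_zero _)
      (by rw [cy_basePt]; exact affPt_rep_zero _) (isRep_rep l), cx_basePt, cy_basePt]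
    simp
  have hl0 : (![t, 1, 0] : Fin 3 → ℂ) ≠ 0 := fun h => one_ne_zero (congrFun h 1)
  obtain ⟨al, hal, hlrep⟩ := (isRep_pmk hl0).exists_rep_eq
  set p' : PSp X'.ι := segre p (pmk ![t, 1, 0]) with hp'
  have hp'X : p' ∈ X'.carrier := by
    refine (segre_mem_planeExt hpX).2 ?_
    rw [hεp, hrel, hlrep]
    simp
  have hπp' : planeProj X ε sw c p' = p := planeProj_segre _ _
  have hp'l : lineVec t (ssnd p').rep = 0 := by
    rw [hp', ssnd_segre, hlrep]
    funext j
    fin_cases j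
    · simp [lineVec]
      ring
    · simp [lineVec]
  have hne' : ∀ y ∈ X'.carrier, y ≠ p' → lineVec t (ssnd y).rep ≠ 0 := by
    rintro _ ⟨q, hq, l, hl, rfl⟩ hyp h0
    rw [ssnd_segre] at h0
    have h1 : t * l.rep 1 - l.rep 0 = 0 := congrFun h0 0
    have h2 : l.rep 2 = 0 := congrFun h0 1
    have h3 : l.rep 1 ≠ 0 := fun h3 => l.rep_nonzero (by
      rw [h3, mul_zero, zero_sub, neg_eq_zero] at h1
      funext j
      fin_cases j
      · exact h1
      · exact h3
      · exact h2)
    have h4 : l.rep 0 = t * l.rep 1 := by linear_combination -h1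
    obtain ⟨r1, r2⟩ := hl
    rw [h2, zero_mul, eq_comm] at r1 r2
    have hqb : ε q = basePt sw c := (eq_basePt_iff (ε.isMorphism.1 hq)).2
      ⟨(mul_eq_zero.1 r1).resolve_right h3,
        (mul_eq_zero.1 r2).resolve_right (by rw [h4]; exact mul_ne_zero ht h3)⟩
    refine hyp ?_
    rw [hp', huniq q hq hqb]
    congr 1
    refine IsRep.eq_pmk ((isRep_rep l).of_eq_smul (c := l.rep 1) ?_)
    funext j
    fin_cases j
    · simp [h4, mul_comm]
    · simp
    · simp [h2]
  have hπ' := lineProj_iso (hl := reg_planeExt_snd (ε := ε) (sw := sw) (c := c)) hne'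
  -- the charts of the first blow-up
  have hopen : ∀ j, RelOpen X'.carrier {z | sfst z ∈ W ∧ (ssnd z).rep j ≠ 0} := fun j =>
    ((planeProj X ε sw c).isMorphism.reg.relOpen_preimage (planeProj X ε sw c).isMorphism.1
      ⟨W, hW, rfl⟩).inter (PReg.relOpen_ne reg_planeExt_snd j)
  obtain ⟨W₁, hW₁, hXW₁⟩ := hopen 1
  obtain ⟨W₂, hW₂, hXW₂⟩ := hopen 0
  have hch₁ := planeExt_chart_fst hch hfin
  have hch₂ := planeExt_chart_snd hch hfin
  have e₁ : {z ∈ X'.carrier | sfst z ∈ W ∧ (ssnd z).rep 1 ≠ 0} = X'.carrier ∩ W₁ := by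
    rw [hXW₁]; rfl
  have e₂ : {z ∈ X'.carrier | sfst z ∈ W ∧ (ssnd z).rep 0 ≠ 0} = X'.carrier ∩ W₂ := by
    rw [hXW₂]; rfl
  rw [e₁] at hch₁
  rw [e₂] at hch₂
  have haff : ∀ y ∈ X'.carrier ∩ W₁, (ssnd y).rep 1 ≠ 0 ∧
      aff (cx sw (ε (sfst y))) - c = (ssnd y).rep 2 / (ssnd y).rep 1 ∧
      (ssnd y).rep 0 / (ssnd y).rep 1 * aff (cy sw (ε (sfst y))) =
        (ssnd y).rep 2 / (ssnd y).rep 1 := by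
    intro y hy
    rw [← e₁] at hy
    obtain ⟨⟨q, hq, l, hl, rfl⟩, hqW, hl1⟩ := hy
    rw [sfst_segre] at hqW
    rw [ssnd_segre] at hl1
    obtain ⟨h1, h2⟩ := hfin q ⟨hq, hqW⟩
    rw [affine_planeRel_iff h1 h2 (isRep_rep l)] at hl
    rw [sfst_segre, ssnd_segre]
    refine ⟨hl1, ?_, ?_⟩
    · rw [hl.1, mul_div_cancel_right₀ _ hl1]
    · rw [hl.2]
      ring
  have hp'W₁ : p' ∈ X'.carrier ∩ W₁ := by
    rw [← e₁]
    refine ⟨hp'X, ?_, ?_⟩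
    · rwa [hp', sfst_segre]
    · rw [hp', ssnd_segre, hlrep]
      simpa using hal
  -- a general point of the first blow-up
  have hq₀p : q₀ ∈ X.carrier \ {p} := ⟨hq₀, fun h0 => hbG (by
    rw [← hεp, ← Set.mem_singleton_iff.1 h0]
    exact hq₀G)⟩
  set y₀ : PSp X'.ι := segre q₀ (pmk (planeVec sw c (ε q₀))) with hy₀
  have hy₀X : y₀ ∈ X'.carrier := (hπ.mapsTo' hq₀p).1
  obtain ⟨a₀, ha₀, hr₀⟩ := (isRep_pmk (hGne _ hq₀G)).exists_rep_eq
  have hy₀j : ∀ j, (ssnd y₀).rep j ≠ 0 := fun j => by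
    rw [hy₀, ssnd_segre, hr₀]
    exact mul_ne_zero ha₀ ((hgen _ hq₀G).1 j)
  have hy₀G : y₀ ∈ planeMap X ε sw c ⁻¹' G := by
    rw [Set.mem_preimage]
    change ε (sfst y₀) ∈ G
    rw [hy₀, sfst_segre]
    exact hq₀G
  have hy₀W : sfst y₀ ∈ W := by rwa [hy₀, sfst_segre]
  have hchart' : ∀ y ∈ X'.carrier, ChartAt X' (planeMap X ε sw c ⁻¹' G) y := by
    intro y hy
    by_cases hyp : planeProj X ε sw c y = p
    · have hyW : sfst y ∈ W := by
        change planeProj X ε sw c y ∈ W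
        rwa [hyp]
      by_cases h1 : (ssnd y).rep 1 = 0
      · have h0 : (ssnd y).rep 0 ≠ 0 := by
          obtain ⟨q, hq, l, hl, rfl⟩ := hy
          rw [planeProj_segre] at hyp
          rw [hyp, hεp, hrel] at hl
          rw [ssnd_segre] at h1 ⊢
          intro h0
          apply l.rep_nonzero
          funext j
          fin_cases j
          · exact h0
          · exact h1
          · exact hl
        exact ⟨W₂, _, _, hW₂, (e₂.subset ⟨hy, hyW, h0⟩).2, hch₂, y₀,
          e₂.subset ⟨hy₀X, hy₀W, hy₀j 0⟩, hy₀G⟩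
      · exact ⟨W₁, _, _, hW₁, (e₁.subset ⟨hy, hyW, h1⟩).2, hch₁, y₀,
          e₁.subset ⟨hy₀X, hy₀W, hy₀j 1⟩, hy₀G⟩
    · refine ChartAt.of_iso (planeProj X ε sw c) hπ (T := ε ⁻¹' G) ?_ hy hyp
        (hcharts _ ((planeProj X ε sw c).isMorphism.1 hy))
      rwa [Set.mem_preimage, hεp]
  have hfin' : ∀ y ∈ X'.carrier ∩ W₁, (ssnd y).rep 1 ≠ 0 ∧
      (ssnd y).rep 0 / (ssnd y).rep 1 = (ssnd y).rep 0 / (ssnd y).rep 1 ∧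
      (ssnd y).rep 0 / (ssnd y).rep 1 * aff (cy sw (ε (sfst y))) =
        (ssnd y).rep 2 / (ssnd y).rep 1 := fun y hy =>
    ⟨(haff y hy).1, rfl, (haff y hy).2.2⟩
  have hch₃ := lineExt_chart_fst (hl := reg_planeExt_snd) ht hch₁ hfin'
  have hch₄ := lineExt_chart_snd (hl := reg_planeExt_snd) (t := t) hch₁ hfin'
  have hopen' : ∀ j, RelOpen X''.carrier {z | sfst z ∈ W₁ ∧ (ssnd z).rep j ≠ 0} := fun j =>
    ((twoProj X ε sw c t).isMorphism.reg.relOpen_preimage (twoProj X ε sw c t).isMorphism.1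
      ⟨W₁, hW₁, rfl⟩).inter (PReg.relOpen_ne (reg_ssnd.mono lineExt_subset) j)
  obtain ⟨W₃, hW₃, hXW₃⟩ := hopen' 1
  obtain ⟨W₄, hW₄, hXW₄⟩ := (hopen' 0).inter
    ((twoProj X ε sw c t).isMorphism.reg.relOpen_preimage (twoProj X ε sw c t).isMorphism.1
      (PReg.relOpen_ne reg_planeExt_snd 0))
  have e₃ : {z ∈ X''.carrier | sfst z ∈ W₁ ∧ (ssnd z).rep 1 ≠ 0} = X''.carrier ∩ W₃ := by
    rw [hXW₃]; rfl
  have e₄ : {z ∈ X''.carrier | sfst z ∈ W₁ ∧ (ssnd z).rep 0 ≠ 0 ∧ (ssnd (sfst z)).rep 0 ≠ 0} =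
      X''.carrier ∩ W₄ := by
    rw [hXW₄]
    ext z
    exact ⟨fun h => ⟨h.1, ⟨h.2.1, h.2.2.1⟩, h.2.2.2⟩, fun h => ⟨h.1, h.2.1.1, h.2.1.2, h.2.2⟩⟩
  rw [e₃] at hch₃
  rw [e₄] at hch₄
  have hp'G : p' ∉ planeMap X ε sw c ⁻¹' G := by
    rw [Set.mem_preimage]
    change ε (sfst p') ∉ G
    rwa [hp', sfst_segre, hεp]
  have hy₀p : y₀ ∈ X'.carrier \ {p'} := ⟨hy₀X, fun h0 => hp'G (by
    rw [← Set.mem_singleton_iff.1 h0]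
    exact hy₀G)⟩
  set z₀ : PSp X''.ι := segre y₀ (pmk (lineVec t (ssnd y₀).rep)) with hz₀
  have hz₀X : z₀ ∈ X''.carrier := (hπ'.mapsTo' hy₀p).1
  have hz₀j : ∀ j, (ssnd z₀).rep j ≠ 0 := fun j => by
    obtain ⟨b₀, hb₀, hr⟩ := (isRep_pmk (hne' y₀ hy₀X hy₀p.2)).exists_rep_eq
    rw [hz₀, ssnd_segre, hr, hy₀, ssnd_segre, hr₀, lineVec_smul]
    exact mul_ne_zero hb₀ (mul_ne_zero ha₀ ((hgen _ hq₀G).2 j))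
  have hz₀G : z₀ ∈ twoMap X ε sw c t ⁻¹' G := by
    rw [Set.mem_preimage]
    change planeMap X ε sw c (sfst z₀) ∈ G
    rw [hz₀, sfst_segre]
    exact hy₀G
  have hz₀W : sfst z₀ ∈ W₁ := by
    rw [hz₀, sfst_segre]
    exact (e₁.subset ⟨hy₀X, hy₀W, hy₀j 1⟩).2
  refine ⟨p, p', planeProj_isPointBlowup hpX hεp hne hW hpW hch hfin,
    lineProj_isPointBlowup ht hp'X hp'l hne' hW₁ hp'W₁.2 hch₁ hfin', hεp, hπp', ?_, ?_⟩
  · refine ⟨W₁, fun y => (ssnd y).rep 0 / (ssnd y).rep 1, hW₁, hp'W₁, hch₁.isRegularOn_fst,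
      fun y hy => ⟨?_, ?_⟩, ?_⟩
    · have hy' := hy
      rw [← e₁] at hy'
      have hyX : sfst y ∈ X.carrier := (planeProj X ε sw c).isMorphism.1 hy.1
      obtain ⟨h1, h2⟩ := hfin (sfst y) ⟨hyX, hy'.2.1⟩
      have hy2 := mkPt_cx_cy (sw := sw) (ε.isMorphism.1 hyX)
      rw [eq_affPt h1, eq_affPt h2] at hy2
      change ε (sfst y) ∈ ClassicalAG.chart
      rw [← hy2]
      cases sw
      · exact ⟨_, _, rfl⟩
      · exact ⟨_, _, rfl⟩
    · obtain ⟨h1, h2, h3⟩ := haff y hy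
      change aff (cx sw (ε (sfst y))) - c = _ * aff (cy sw (ε (sfst y)))
      rw [h2, ← h3]
    · change (ssnd p').rep 0 / (ssnd p').rep 1 = t
      rw [hp', ssnd_segre, hlrep]
      simp [hal]
  · refine ⟨hBfin.insert _, hGsub, fun q hq hqB => ?_, ?_, ?_⟩
    · rcases hqB with rfl | hqB
      · exact hbG hq
      · exact hGB q hq hqB
    · have hmem : ∀ q, q ∈ (insert (basePt sw c) B)ᶜ ↔ q ≠ basePt sw c ∧ q ∉ B := fun q => by
        simp [not_or]
      refine ⟨_, ((hπ'.restrict (A' := X''.carrier \ twoMap X ε sw c t ⁻¹' insert (basePt sw c) B)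
        (B' := X'.carrier \ planeMap X ε sw c ⁻¹' insert (basePt sw c) B) ?_ ?_ ?_).trans
        (hπ.restrict (B' := X.carrier \ ε ⁻¹' insert (basePt sw c) B) ?_ ?_ ?_)).trans
        (hψ.restrict (B' := P1P1.carrier \ insert (basePt sw c) B) ?_ ?_ ?_)⟩
      · refine fun z hz => ⟨hz.1, fun h0 => hz.2 (Or.inl ?_)⟩
        change planeMap X ε sw c (twoProj X ε sw c t z) = _
        rw [show twoProj X ε sw c t z = p' from h0]
        change ε (planeProj X ε sw c p') = _
        rw [hπp', hεp]
      · refine fun y hy => ⟨hy.1, fun h0 => hy.2 (Or.inl ?_)⟩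
        change ε (planeProj X ε sw c y) = _
        rw [Set.mem_singleton_iff.1 h0, hπp', hεp]
      · exact fun z hz => ⟨fun h => ⟨(twoProj X ε sw c t).isMorphism.1 hz.1, h.2⟩,
          fun h => ⟨hz.1, h.2⟩⟩
      · refine fun y hy => ⟨hy.1, fun h0 => hy.2 (Or.inl ?_)⟩
        change ε (planeProj X ε sw c y) = _
        rw [show planeProj X ε sw c y = p from h0, hεp]
      · refine fun q hq => ⟨hq.1, fun h0 => hq.2 (Or.inl ?_)⟩
        rw [Set.mem_singleton_iff.1 h0, hεp]
      · exact fun z hz => ⟨fun h => ⟨(planeProj X ε sw c).isMorphism.1 hz.1, h.2⟩,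
          fun h => ⟨hz.1, h.2⟩⟩
      · exact fun q hq => ⟨hq.1, fun h0 => hq.2 (Or.inr h0)⟩
      · exact fun q hq => ⟨hq.1, fun h0 => hq.2 (Or.inr h0)⟩
      · exact fun z hz => ⟨fun h => ⟨ε.isMorphism.1 hz.1, h.2⟩, fun h => ⟨hz.1, h.2⟩⟩
    · intro z hz
      by_cases hzp : twoProj X ε sw c t z = p'
      · have hzW : sfst z ∈ W₁ := by
          change twoProj X ε sw c t z ∈ W₁
          rw [hzp]
          exact hp'W₁.2
        by_cases h1 : (ssnd z).rep 1 = 0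
        · have h0 : (ssnd z).rep 0 ≠ 0 := fun h0 => rep_two_ne _ h0 h1
          have hl' : (ssnd (sfst z)).rep 0 ≠ 0 := by
            rw [show sfst z = p' from hzp, hp', ssnd_segre, hlrep]
            simpa using ⟨hal, ht⟩
          refine ⟨W₄, _, _, hW₄, (e₄.subset ⟨hz, hzW, h0, hl'⟩).2, hch₄, z₀,
            e₄.subset ⟨hz₀X, hz₀W, hz₀j 0, ?_⟩, hz₀G⟩
          rw [hz₀, sfst_segre]
          exact hy₀j 0
        · exact ⟨W₃, _, _, hW₃, (e₃.subset ⟨hz, hzW, h1⟩).2, hch₃, z₀,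
            e₃.subset ⟨hz₀X, hz₀W, hz₀j 1⟩, hz₀G⟩
      · exact ChartAt.of_iso (twoProj X ε sw c t) hπ' (T := planeMap X ε sw c ⁻¹' G) hp'G hz hzp
          (hchart' _ ((twoProj X ε sw c t).isMorphism.1 hz))

/-! ### Geometric consequences of a tower of blow-ups -/

/-- A nonempty open subset of `ℙ¹ × ℙ¹` inside the torus `x, y ≠ 0, ∞`. -/
structure IsGeneralSet (G : Set (PSp (Fin 2 × Fin 2))) : Prop where
  subset : G ⊆ P1P1.carrier
  nonempty : G.Nonempty
  relOpen : RelOpen P1P1.carrier G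
  rep_ne : ∀ q ∈ G, ∀ i j, (cx false q).rep i ≠ 0 ∧ (cy false q).rep j ≠ 0

theorem IsGeneralSet.hasChart {G : Set (PSp (Fin 2 × Fin 2))} (h : IsGeneralSet G) :
    HasChart G (fun q => lineCoord 0 0 (cx false q)) (fun q => lineCoord 0 0 (cy false q)) := by
  obtain ⟨W, hW, hGW⟩ := h.relOpen
  convert (P1P1_chart false 0 0 0).mono hW using 1
  ext q
  constructor
  · intro hq
    exact ⟨⟨h.subset hq, h.rep_ne q hq 0 0⟩, (hGW.symm.subset ⟨h.subset hq, hq⟩).2⟩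
  · intro hq
    exact (hGW.subset ⟨hq.1.1, hq.2⟩).2

/-- A variety with a dense open subset isomorphic to an open subset of the plane is rational. -/
theorem exists_isBirational_of_hasChart {X : ProjVariety} {D : Set (PSp X.ι)} (hD : IsOpen D)
    (hXD : X.carrier ⊆ closure (X.carrier ∩ D)) (hne : (X.carrier ∩ D).Nonempty)
    {a b : PSp X.ι → ℂ} (h : HasChart (X.carrier ∩ D) a b) :
    ∃ r : RatMap X (projSpace 2), r.IsBirational := by
  obtain ⟨O, χ, hO, h⟩ := h
  obtain ⟨q, hq⟩ := hne
  have hOd : (projSpace 2).carrier ⊆ closure ((projSpace 2).carrier ∩ O) := by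
    have := subset_closure_of_isPreirreducible (isPreirreducible_of_isOpen isOpen_univ)
      isOpen_univ hO ⟨_, trivial, h.mapsTo hq⟩
    simpa using this
  have hOu : (projSpace 2).carrier ∩ O = O := Set.univ_inter O
  let r : RatMap X (projSpace 2) :=
    { dom := D
      isOpen_dom := hD
      dense_dom := hXD
      toFun := fun q => aff2 (a q) (b q)
      isMorphism := h.reg.isMorphism fun _ _ => trivial }
  let s : RatMap (projSpace 2) X :=
    { dom := O
      isOpen_dom := hO
      dense_dom := hOd
      toFun := χ
      isMorphism := by
        rw [hOu]
        exact h.reg'.isMorphism fun w hw => (h.mapsTo' hw).1 }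
  refine ⟨r, s, ⟨D, hD, hXD, fun p hp => ⟨hp.2, h.mapsTo hp, h.left p hp⟩⟩,
    ⟨O, hO, hOd, fun w hw => ⟨hw.2, (h.mapsTo' hw.2).2, h.right w hw.2⟩⟩⟩

namespace IsTower

variable {G B : Set (PSp (Fin 2 × Fin 2))} {X : ProjVariety} {ε : Mor X P1P1}

theorem isSmoothOfDim (h : IsTower G B X ε) : IsSmoothOfDim X 2 := fun p hp => by
  obtain ⟨W, a, b, hW, hpW, ⟨O, χ, hO, hi⟩, -⟩ := h.chart p hp
  exact jacobian_of_iso X hW hO hi ⟨hp, hpW⟩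

/-- The preimage of a general set is open and dense. -/
theorem exists_dense (h : IsTower G B X ε) (hG : IsGeneralSet G) :
    ∃ D, IsOpen D ∧ X.carrier ∩ D = X.carrier ∩ ε ⁻¹' G ∧
      X.carrier ⊆ closure (X.carrier ∩ D) := by
  obtain ⟨D, hD, hXD⟩ := ε.isMorphism.reg.relOpen_preimage ε.isMorphism.1 hG.relOpen
  refine ⟨D, hD, hXD, fun p hp => ?_⟩
  obtain ⟨W, a, b, hW, hpW, hch, r, hr, hrG⟩ := h.chart p hp
  have hrD : r ∈ D := (hXD.symm.subset ⟨hr.1, hrG⟩).2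
  have := subset_closure_of_isPreirreducible hch.isPreirreducible hW hD ⟨r, hr, hrD⟩
    ⟨⟨hp, hpW⟩, hpW⟩
  refine closure_mono ?_ this
  exact fun q hq => ⟨hq.1.1.1, hq.2⟩

/-- The preimage of a general set is isomorphic to that set. -/
theorem hasChart (h : IsTower G B X ε) (hG : IsGeneralSet G) {D : Set (PSp X.ι)}
    (hXD : X.carrier ∩ D = X.carrier ∩ ε ⁻¹' G) :
    ∃ a b, HasChart (X.carrier ∩ D) a b ∧ (X.carrier ∩ D).Nonempty := by
  obtain ⟨ψ, hψ⟩ := h.iso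
  have hi : Iso (X.carrier ∩ D) G ε ψ := by
    rw [hXD]
    exact hψ.restrict (fun q hq => ⟨hq.1, h.disjoint _ hq.2⟩)
      (fun q hq => ⟨hG.subset hq, h.disjoint _ hq⟩)
      fun q hq => ⟨fun h => h.2, fun h => ⟨hq.1, h⟩⟩
  obtain ⟨g, hg⟩ := hG.nonempty
  exact ⟨_, _, hG.hasChart.comp_iso hi, ψ g, hi.mapsTo' hg⟩

theorem isIrreducible (h : IsTower G B X ε) (hG : IsGeneralSet G) : IsIrreducible X.carrier := by
  obtain ⟨D, hD, hXD, hd⟩ := h.exists_dense hG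
  obtain ⟨a, b, hch, hne⟩ := h.hasChart hG hXD
  refine ⟨hne.mono Set.inter_subset_left, isPreirreducible_iff_closure.1 ?_⟩
  have : closure X.carrier = closure (X.carrier ∩ D) :=
    (closure_minimal hd isClosed_closure).antisymm (closure_mono Set.inter_subset_left)
  rw [this]
  exact hch.isPreirreducible.closure

theorem isSmoothRationalSurface (h : IsTower G B X ε) (hG : IsGeneralSet G) :
    IsSmoothRationalSurface X := by
  obtain ⟨D, hD, hXD, hd⟩ := h.exists_dense hG
  obtain ⟨a, b, hch, hne⟩ := h.hasChart hG hXD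
  exact ⟨h.isIrreducible hG, h.isSmoothOfDim, exists_isBirational_of_hasChart hD hd hne hch⟩

end IsTower

theorem IsGeneralSet.isTower {G : Set (PSp (Fin 2 × Fin 2))} (h : IsGeneralSet G) :
    IsTower G ∅ P1P1 (idMor P1P1) := isTower_P1P1 h.subset h.nonempty h.rep_ne

theorem IsGeneralSet.dense {G : Set (PSp (Fin 2 × Fin 2))} (h : IsGeneralSet G)
    {U : Set (PSp (Fin 2 × Fin 2))} (hU : G ⊆ U) :
    P1P1.carrier ⊆ closure (P1P1.carrier ∩ U) := by
  obtain ⟨D, -, hXD, hd⟩ := h.isTower.exists_dense h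
  rw [hXD] at hd
  exact hd.trans (closure_mono fun q hq => ⟨hq.1, hU hq.2⟩)

namespace IsTower

variable {G B : Set (PSp (Fin 2 × Fin 2))} {X : ProjVariety} {ε : Mor X P1P1}

/-- The inverse of the morphism of a tower, as a rational map. -/
theorem exists_isInverse (h : IsTower G B X ε) (hG : IsGeneralSet G) :
    ∃ e : RatMap P1P1 X, e.IsInverse ε.toRatMap ∧ e.dom = Bᶜ ∧
      ∀ p ∈ X.carrier, ε p ∉ B → e (ε p) = p := by
  obtain ⟨ψ, hψ⟩ := h.iso
  obtain ⟨D, hD, hXD, hd⟩ := h.exists_dense hG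
  have hB : P1P1.carrier ⊆ closure (P1P1.carrier ∩ Bᶜ) := hG.dense h.disjoint
  let e : RatMap P1P1 X :=
    { dom := Bᶜ
      isOpen_dom := isOpen_compl_finite h.finite
      dense_dom := hB
      toFun := ψ
      isMorphism := hψ.reg'.isMorphism fun q hq => (hψ.mapsTo' hq).1 }
  refine ⟨e, ⟨⟨D, hD, hd, fun p hp => ?_⟩, ⟨Bᶜ, e.isOpen_dom, hB, fun q hq => ?_⟩⟩, rfl,
    fun p hp hpB => hψ.left p ⟨hp, hpB⟩⟩
  · have hpB : ε p ∉ B := h.disjoint _ (hXD.subset hp).2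
    exact ⟨trivial, hpB, hψ.left p ⟨hp.1, hpB⟩⟩
  · exact ⟨hq.2, trivial, hψ.right q hq⟩

theorem isBirational (h : IsTower G B X ε) (hG : IsGeneralSet G) :
    ε.toRatMap.IsBirational :=
  let ⟨e, he, _⟩ := h.exists_isInverse hG
  ⟨e, he⟩

/-- A morphism that lies over a rational map at general points is a lift of it. -/
theorem liftsTo (h : IsTower G B X ε) (hG : IsGeneralSet G) {φ : RatMap P1P1 P1P1} {F : Mor X X}
    (hF : ∀ p ∈ X.carrier, ε p ∈ G → ε p ∈ φ.dom ∧ φ (ε p) ∉ B ∧ ε (F p) = φ (ε p)) :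
    LiftsTo ε φ F := by
  obtain ⟨e, he, hdom, hinv⟩ := h.exists_isInverse hG
  obtain ⟨D, hD, hXD, hd⟩ := h.exists_dense hG
  refine ⟨e, he, D, hD, hd, fun p hp => ?_⟩
  obtain ⟨h1, h2, h3⟩ := hF p hp.1 (hXD.subset hp).2
  refine ⟨h1, by rwa [hdom], ?_⟩
  rw [← h3]
  exact (hinv _ (F.isMorphism.1 hp.1) (by rwa [h3])).symm

end IsTower

/-! ### Local extension of maps, and the coordinates of a tower -/

/-- On a neighbourhood of `s` in `S` there is a morphism that agrees with `f₀` on `D`. -/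
def ExtendsAt {ι κ : Type} (S D : Set (PSp ι)) (f₀ : PSp ι → PSp κ) (s : PSp ι) : Prop :=
  ∃ W, IsOpen W ∧ s ∈ W ∧ ∃ g : PSp ι → PSp κ, Reg (S ∩ W) g ∧ ∀ q ∈ S ∩ W, q ∈ D → g q = f₀ q

namespace ExtendsAt

variable {ι κ μ : Type} {S D : Set (PSp ι)} {s : PSp ι}

theorem of_reg {f₀ g : PSp ι → PSp κ} (hg : Reg S g) (h : ∀ q ∈ S, q ∈ D → g q = f₀ q) :
    ExtendsAt S D f₀ s :=
  ⟨Set.univ, isOpen_univ, trivial, g, hg.mono Set.inter_subset_left, fun q hq => h q hq.1⟩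

theorem segre {f₀ : PSp ι → PSp (κ × μ)} {a₀ : PSp ι → PSp κ} {b₀ : PSp ι → PSp μ}
    (ha : ExtendsAt S D a₀ s) (hb : ExtendsAt S D b₀ s)
    (h : ∀ q ∈ S, q ∈ D → f₀ q = ClassicalAG.segre (a₀ q) (b₀ q)) : ExtendsAt S D f₀ s := by
  obtain ⟨V, hV, hsV, a, har, ha⟩ := ha
  obtain ⟨W, hW, hsW, b, hbr, hb⟩ := hb
  refine ⟨V ∩ W, hV.inter hW, ⟨hsV, hsW⟩, fun q => ClassicalAG.segre (a q) (b q),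
    (har.mono fun q hq => ⟨hq.1, hq.2.1⟩).segre (hbr.mono fun q hq => ⟨hq.1, hq.2.2⟩),
    fun q hq hqD => ?_⟩
  change ClassicalAG.segre (a q) (b q) = f₀ q
  rw [ha q ⟨hq.1, hq.2.1⟩ hqD, hb q ⟨hq.1, hq.2.2⟩ hqD, h q hq.1 hqD]

/-- An extension by homogeneous coordinates that do not all vanish at `s`. -/
theorem of_isRep [Nonempty κ] {f₀ : PSp ι → PSp κ} (hs : s ∈ S) {v : PSp ι → κ → ℂ}
    (hv : PReg S v) (h0 : v s ≠ 0) (h : ∀ q ∈ S, q ∈ D → v q ≠ 0 → IsRep (v q) (f₀ q)) :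
    ExtendsAt S D f₀ s := by
  obtain ⟨j, hj⟩ := Function.ne_iff.1 h0
  obtain ⟨V, hV, hSV⟩ := hv.exists_isOpen_ne j
  have hne : ∀ q ∈ S ∩ V, v q ≠ 0 := fun q hq => Function.ne_iff.2 ⟨j, (hSV.subset hq).2⟩
  exact ⟨V, hV, (hSV.symm.subset ⟨hs, hj⟩).2, fun q => pmk (v q),
    (hv.mono Set.inter_subset_left).reg_pmk hne,
    fun q hq hqD => (h q hq.1 hqD (hne q hq)).eq_pmk.symm⟩

end ExtendsAt

/-- A criterion for homogeneous coordinates in terms of minors. -/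
theorem IsRep.of_minors {κ : Type} {v w : κ → ℂ} {p : PSp κ} (hw : IsRep w p) (hv : v ≠ 0)
    (h : ∀ i j, v i * w j = v j * w i) : IsRep v p := by
  obtain ⟨j, hj⟩ := Function.ne_iff.1 hv
  obtain ⟨c, hc, hp⟩ := hw.exists_rep_eq
  refine ⟨hv, c * w j / v j, ?_⟩
  rw [hp]
  funext i
  have hj' : v j ≠ 0 := hj
  simp only [Pi.smul_apply, smul_eq_mul]
  field_simp
  linear_combination -h i j

/-- `l` and `z` are the coordinates of the two blow-ups with centres `(ξ, η) = (c, 0)` and the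
slope `t`. -/
structure CentreCoord (X : ProjVariety) (ε : Mor X P1P1) (sw : Bool) (c t : ℂ)
    (l : PSp X.ι → PSp (Fin 3)) (z : PSp X.ι → PSp (Fin 2)) : Prop where
  reg_plane : Reg X.carrier l
  reg_line : Reg X.carrier z
  planeRel : ∀ p ∈ X.carrier, PlaneRel sw c (ε p) (l p)
  lineRel : ∀ p ∈ X.carrier,
    (z p).rep 0 * (l p).rep 2 = (z p).rep 1 * (t * (l p).rep 1 - (l p).rep 0)

section TwoExt

variable {X : ProjVariety} {ε : Mor X P1P1} {sw : Bool} {c t : ℂ}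

theorem twoExt_mapsTo_fst : Set.MapsTo sfst (twoExt X ε sw c t).carrier
    (planeExt X ε sw c).carrier := (twoProj X ε sw c t).isMorphism.1

theorem twoExt_mapsTo_base : Set.MapsTo (fun z => sfst (sfst z)) (twoExt X ε sw c t).carrier
    X.carrier := fun _ hz => (planeProj X ε sw c).isMorphism.1 (twoExt_mapsTo_fst hz)

theorem reg_twoExt_fst : Reg (twoExt X ε sw c t).carrier sfst := reg_sfst.mono lineExt_subset

theorem reg_twoExt_base : Reg (twoExt X ε sw c t).carrier (fun z => sfst (sfst z)) :=
  (reg_sfst.mono planeExt_subset).comp reg_twoExt_fst twoExt_mapsTo_fst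

/-- The coordinates of a pair of blow-ups. -/
theorem centreCoord_twoExt : CentreCoord (twoExt X ε sw c t) (twoMap X ε sw c t) sw c t
    (fun z => ssnd (sfst z)) ssnd where
  reg_plane := reg_planeExt_snd.comp reg_twoExt_fst twoExt_mapsTo_fst
  reg_line := reg_ssnd.mono lineExt_subset
  planeRel p hp := by
    obtain ⟨q, hq, l, hl, h⟩ := twoExt_mapsTo_fst hp
    change PlaneRel sw c (ε (sfst (sfst p))) (ssnd (sfst p))
    rw [h, sfst_segre, ssnd_segre]
    exact hl
  lineRel p hp := by
    obtain ⟨y, hy, r, hr, rfl⟩ := hp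
    rw [sfst_segre, ssnd_segre]
    exact hr

/-- The coordinates of the earlier blow-ups of a tower. -/
theorem CentreCoord.twoExt {sw' : Bool} {c' : ℂ} {l : PSp X.ι → PSp (Fin 3)}
    {z : PSp X.ι → PSp (Fin 2)} (h : CentreCoord X ε sw' c' t l z) :
    CentreCoord (twoExt X ε sw c t) (twoMap X ε sw c t) sw' c' t
      (fun p => l (sfst (sfst p))) (fun p => z (sfst (sfst p))) where
  reg_plane := h.reg_plane.comp reg_twoExt_base twoExt_mapsTo_base
  reg_line := h.reg_line.comp reg_twoExt_base twoExt_mapsTo_base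
  planeRel _ hp := h.planeRel _ (twoExt_mapsTo_base hp)
  lineRel _ hp := h.lineRel _ (twoExt_mapsTo_base hp)

/-- A map to a pair of blow-ups extends if its components do. -/
theorem ExtendsAt.twoExt {ι : Type} {S D : Set (PSp ι)} {s : PSp ι}
    {f₀ : PSp ι → PSp (twoExt X ε sw c t).ι}
    (hf₀ : ∀ q ∈ S, q ∈ D → f₀ q ∈ (twoExt X ε sw c t).carrier)
    (h₁ : ExtendsAt S D (fun q => sfst (sfst (f₀ q))) s)
    (h₂ : ExtendsAt S D (fun q => ssnd (sfst (f₀ q))) s)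
    (h₃ : ExtendsAt S D (fun q => ssnd (f₀ q)) s) : ExtendsAt S D f₀ s := by
  have h₁₂ : ExtendsAt S D (fun q => sfst (f₀ q)) s := h₁.segre h₂ fun q hq hqD =>
    (segre_sfst_ssnd (planeExt_subset (twoExt_mapsTo_fst (hf₀ q hq hqD)))).symm
  exact h₁₂.segre h₃ fun q hq hqD => (segre_sfst_ssnd (lineExt_subset (hf₀ q hq hqD))).symm

end TwoExt

/-- The coordinates over a point with affine coordinates `(ξ, η)` such that `η ≠ 0`. -/
theorem CentreCoord.isRep {X : ProjVariety} {ε : Mor X P1P1} {sw : Bool} {c t : ℂ}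
    {l : PSp X.ι → PSp (Fin 3)} {z : PSp X.ι → PSp (Fin 2)} (h : CentreCoord X ε sw c t l z)
    (ht : t ≠ 0) {p : PSp X.ι} (hp : p ∈ X.carrier) {ξ η : ℂ} (hξ : cx sw (ε p) = affPt ξ)
    (hη : cy sw (ε p) = affPt η) (h0 : η ≠ 0) :
    IsRep ![ξ - c, η, (ξ - c) * η] (l p) ∧ IsRep ![t * η - (ξ - c), (ξ - c) * η] (z p) := by
  obtain ⟨a, ha, hx⟩ := (affPt_rep ξ).exists_rep_eq
  obtain ⟨b, hb, hy⟩ := (affPt_rep η).exists_rep_eq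
  have hv : planeVec sw c (ε p) = (a * b) • ![ξ - c, η, (ξ - c) * η] := by
    funext j
    fin_cases j <;> simp [planeVec, shiftNum, hξ, hη, hx, hy] <;> ring
  have hl : IsRep ![ξ - c, η, (ξ - c) * η] (l p) := by
    refine IsRep.of_smul (c := a * b) ?_
    rw [← hv]
    refine (h.planeRel p hp).isRep ?_
    rw [hv]
    exact smul_ne_zero (mul_ne_zero ha hb) (Function.ne_iff.2 ⟨1, h0⟩)
  refine ⟨hl, (isRep_rep (z p)).of_minors ?_ ?_⟩
  · intro h1
    have h2 : (ξ - c) * η = 0 := congrFun h1 1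
    have h3 : t * η - (ξ - c) = 0 := congrFun h1 0
    rw [(mul_eq_zero.1 h2).resolve_right h0, sub_zero] at h3
    exact mul_ne_zero ht h0 h3
  · obtain ⟨d, hd, hlr⟩ := hl.exists_rep_eq
    have hz := h.lineRel p hp
    rw [hlr] at hz
    simp only [Pi.smul_apply, smul_eq_mul, Matrix.cons_val] at hz
    have hz' : (z p).rep 0 * ((ξ - c) * η) = (z p).rep 1 * (t * η - (ξ - c)) :=
      mul_left_cancel₀ hd (by linear_combination hz)
    intro i j
    fin_cases i <;> fin_cases j <;> simp <;> first | ring1 | linear_combination hz' |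
      linear_combination -hz'

/-! ### General points of `ℙ¹ × ℙ¹` -/

theorem cx_pt (sw : Bool) (x y : ℂ) : cx sw (pt x y) = affPt (bif sw then y else x) := by
  cases sw <;> simp [cx, pt]

theorem cy_pt (sw : Bool) (x y : ℂ) : cy sw (pt x y) = affPt (bif sw then x else y) := by
  cases sw <;> simp [cx, cy, pt]

theorem pt_mem (x y : ℂ) : pt x y ∈ P1P1.carrier := segre_mem_P1P1 _ _

theorem affPt_injective : Function.Injective affPt := fun x y h => by
  rw [← aff_affPt x, h, aff_affPt]

theorem pt_injective {x y x' y' : ℂ} (h : pt x y = pt x' y') : x = x' ∧ y = y' :=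
  let ⟨h₁, h₂⟩ := segre_injective h
  ⟨affPt_injective h₁, affPt_injective h₂⟩

theorem basePt_eq_pt (sw : Bool) (c : ℂ) :
    basePt sw c = pt (bif sw then 0 else c) (bif sw then c else 0) := by
  cases sw <;> rfl

theorem eq_pt {q : PSp (Fin 2 × Fin 2)} (hq : q ∈ P1P1.carrier) (hx : (cx false q).rep 0 ≠ 0)
    (hy : (cy false q).rep 0 ≠ 0) : q = pt (aff (cx false q)) (aff (cy false q)) := by
  refine P1P1_ext hq (pt_mem _ _) false ?_ ?_
  · rw [cx_pt]
    exact eq_affPt hx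
  · rw [cy_pt]
    exact eq_affPt hy

theorem rep_pt (x y : ℂ) :
    IsRep (fun ij : Fin 2 × Fin 2 => ![1, x] ij.1 * ![1, y] ij.2) (pt x y) :=
  (affPt_rep x).segre (affPt_rep y)

theorem xCoord_pt (x y : ℂ) : xCoord (pt x y) = x := by
  obtain ⟨a, ha, h⟩ := (rep_pt x y).exists_rep_eq
  simp [xCoord, h, ha]

theorem yCoord_pt (x y : ℂ) : yCoord (pt x y) = y := by
  obtain ⟨a, ha, h⟩ := (rep_pt x y).exists_rep_eq
  simp [yCoord, h, ha]

/-- The product of the polynomials that do not vanish at general points. -/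
def genPoly (k t x y : ℂ) : ℂ :=
  x * y * (x ^ 2 - k ^ 2) * (y ^ 2 - k ^ 2) * ((t * y - x) ^ 2 - k ^ 2) *
    ((t * x - y) ^ 2 - k ^ 2) * (2 * t * x * y - (x ^ 2 - k ^ 2)) *
    (2 * t * x * y - (y ^ 2 - k ^ 2))

theorem genPoly_comm (k t x y : ℂ) : genPoly k t y x = genPoly k t x y := by
  simp only [genPoly]
  ring

/-- The general points of `ℙ¹ × ℙ¹`. -/
def generalSet (k t : ℂ) : Set (PSp (Fin 2 × Fin 2)) :=
  {q ∈ P1P1.carrier | ((cx false q).rep 0 ≠ 0 ∧ (cy false q).rep 0 ≠ 0) ∧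
    genPoly k t (aff (cx false q)) (aff (cy false q)) ≠ 0}

theorem pt_mem_generalSet {k t x y : ℂ} : pt x y ∈ generalSet k t ↔ genPoly k t x y ≠ 0 := by
  have := pt_mem x y
  simp only [generalSet, Set.mem_ofPred_eq, cx_pt, cy_pt, this, true_and]
  simp [affPt_rep_zero]

theorem exists_eq_pt {k t : ℂ} {q : PSp (Fin 2 × Fin 2)} (h : q ∈ generalSet k t) :
    ∃ x y, q = pt x y ∧ genPoly k t x y ≠ 0 :=
  ⟨_, _, eq_pt h.1 h.2.1.1 h.2.1.2, h.2.2⟩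

theorem RelOpen.setOf_ne {ι : Type} {A T : Set (PSp ι)} (hT : RelOpen A T) {f : PSp ι → ℂ}
    (hf : IsRegularOn (A ∩ T) f) : RelOpen A {q | q ∈ T ∧ f q ≠ 0} := by
  obtain ⟨V, hV, h1⟩ := hT
  obtain ⟨W, hW, h2⟩ := (PReg.of_isRegularOn (κ := Unit) fun _ => hf).exists_isOpen_ne ()
  refine ⟨V ∩ W, hV.inter hW, ?_⟩
  rw [← Set.inter_assoc, h1, h2]
  ext q
  exact ⟨fun h => ⟨h.1.1, h.1.2, h.2⟩, fun h => ⟨⟨h.1, h.2.1⟩, h.2.2⟩⟩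

theorem relOpen_generalSet (k t : ℂ) : RelOpen P1P1.carrier (generalSet k t) := by
  have hT := relOpen_P1P1 false 0 0
  have hx : IsRegularOn (P1P1.carrier ∩ {q | (cx false q).rep 0 ≠ 0 ∧ (cy false q).rep 0 ≠ 0})
      (fun q => aff (cx false q)) :=
    PReg.ratio ((reg_cx false).mono Set.inter_subset_left) 1 0 fun q hq => hq.2.1
  have hy : IsRegularOn (P1P1.carrier ∩ {q | (cx false q).rep 0 ≠ 0 ∧ (cy false q).rep 0 ≠ 0})
      (fun q => aff (cy false q)) :=
    PReg.ratio ((reg_cy false).mono Set.inter_subset_left) 1 0 fun q hq => hq.2.2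
  have hk := IsRegularOn.const (W := P1P1.carrier ∩
    {q | (cx false q).rep 0 ≠ 0 ∧ (cy false q).rep 0 ≠ 0}) (k ^ 2)
  have htx := (IsRegularOn.const t).mul hx
  have hty := (IsRegularOn.const t).mul hy
  have hxy := ((IsRegularOn.const (2 * t)).mul hx).mul hy
  have hw := (hx.pow 2).sub hk
  have hw' := (hy.pow 2).sub hk
  obtain ⟨W, hW, h⟩ := hT.setOf_ne (((((((hx.mul hy).mul hw).mul hw').mul
    (((hty.sub hx).pow 2).sub hk)).mul (((htx.sub hy).pow 2).sub hk)).mul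
    (hxy.sub hw)).mul (hxy.sub hw'))
  refine ⟨W, hW, h.trans ?_⟩
  ext q
  exact ⟨fun hq => ⟨hq.1, hq.1, hq.2⟩, fun hq => ⟨hq.1, hq.2.2⟩⟩

/-- The nonvanishing conditions at a general point. -/
theorem genPoly_ne_zero_iff {k t x y : ℂ} : genPoly k t x y ≠ 0 ↔
    x ≠ 0 ∧ y ≠ 0 ∧ x ^ 2 - k ^ 2 ≠ 0 ∧ y ^ 2 - k ^ 2 ≠ 0 ∧ (t * y - x) ^ 2 - k ^ 2 ≠ 0 ∧
      (t * x - y) ^ 2 - k ^ 2 ≠ 0 ∧ 2 * t * x * y - (x ^ 2 - k ^ 2) ≠ 0 ∧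
      2 * t * x * y - (y ^ 2 - k ^ 2) ≠ 0 := by
  simp only [genPoly, mul_ne_zero_iff, and_assoc]

/-- The second coordinate of the image of `(x, y)` under the involution
`(x, y) ↦ (x, y')`, where `1 / y + 1 / y' = t / (x - k) + t / (x + k)`. -/
def invol (k t x y : ℂ) : ℂ := (x ^ 2 - k ^ 2) * y / (2 * t * x * y - (x ^ 2 - k ^ 2))

/-- Some general point has a general image under the involution: for a suitable fixed `x`, all
points with `y` close to `0` but different from it have this property. -/
theorem exists_genPoly_invol_ne_zero {k t : ℂ} (hk : k ≠ 0) (ht : t ≠ 0) :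
    ∃ x y, genPoly k t x y ≠ 0 ∧ genPoly k t x (invol k t x y) ≠ 0 := by
  obtain ⟨x, hx⟩ := Infinite.exists_notMem_finset ({0, k, -k, k / t, -k / t} : Finset ℂ)
  simp only [Finset.mem_insert, Finset.mem_singleton, not_or] at hx
  obtain ⟨hx0, hxk, hxk', hxt, hxt'⟩ := hx
  have hw : x ^ 2 - k ^ 2 ≠ 0 := by
    rw [sq_sub_sq]
    exact mul_ne_zero (fun h => hxk' (by linear_combination h)) (sub_ne_zero.2 hxk)
  have hw0 : k ^ 2 - x ^ 2 ≠ 0 := fun h => hw (by linear_combination -h)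
  have hwt : (t * x) ^ 2 - k ^ 2 ≠ 0 := by
    rw [sq_sub_sq]
    refine mul_ne_zero (fun h => hxt' ?_) (fun h => hxt ?_)
    · rw [eq_div_iff ht]
      linear_combination h
    · rw [eq_div_iff ht]
      linear_combination h
  set R : ℂ → ℂ := fun y => x * (x ^ 2 - k ^ 2) * (y ^ 2 - k ^ 2) * ((t * y - x) ^ 2 - k ^ 2) *
    ((t * x - y) ^ 2 - k ^ 2) * (2 * t * x * y - (x ^ 2 - k ^ 2)) *
    (2 * t * x * y - (y ^ 2 - k ^ 2)) with hR
  have hgen : ∀ y, genPoly k t x y = y * R y := fun y => by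
    simp only [genPoly, hR]
    ring
  have hR0 : R 0 ≠ 0 := by
    simp only [hR, mul_zero, zero_sub, sub_zero, neg_sq, ne_eq, OfNat.ofNat_ne_zero,
      not_false_eq_true, zero_pow]
    simp [hx0, hw, hw0, hwt, hk]
  have hRc : Continuous R := by fun_prop
  have hi0 : invol k t x 0 = 0 := by simp [invol]
  have hic : ContinuousAt (invol k t x) 0 := by
    refine ContinuousAt.div (by fun_prop) (by fun_prop) ?_
    simpa using hw0
  have h1 : ∀ᶠ y in nhdsWithin (0 : ℂ) {0}ᶜ, R y ≠ 0 :=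
    (hRc.continuousAt.eventually_ne hR0).filter_mono nhdsWithin_le_nhds
  have h2 : ∀ᶠ y in nhdsWithin (0 : ℂ) {0}ᶜ, R (invol k t x y) ≠ 0 := by
    refine (ContinuousAt.eventually_ne (g := fun y => R (invol k t x y))
      (hRc.continuousAt.comp hic) ?_).filter_mono nhdsWithin_le_nhds
    rwa [hi0]
  obtain ⟨y, ⟨hy1, hy2⟩, hy0⟩ := ((h1.and h2).and self_mem_nhdsWithin).exists
  have hg : genPoly k t x y ≠ 0 := by
    rw [hgen]
    exact mul_ne_zero hy0 hy1
  refine ⟨x, y, hg, ?_⟩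
  rw [hgen]
  exact mul_ne_zero (div_ne_zero (mul_ne_zero hw hy0) (genPoly_ne_zero_iff.1 hg).2.2.2.2.2.2.1) hy2

theorem invol_invol {k t x y : ℂ} (h : genPoly k t x y ≠ 0) :
    invol k t x (invol k t x y) = y := by
  obtain ⟨-, -, h1, -, -, -, h2, -⟩ := genPoly_ne_zero_iff.1 h
  have h3 : 2 * t * x * invol k t x y - (x ^ 2 - k ^ 2) =
      (x ^ 2 - k ^ 2) ^ 2 / (2 * t * x * y - (x ^ 2 - k ^ 2)) := by
    rw [invol, eq_div_iff h2, sub_mul, mul_div_assoc', div_mul_cancel₀ _ h2]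
    ring
  rw [invol, h3, invol]
  generalize 2 * t * x * y - (x ^ 2 - k ^ 2) = d at h2 ⊢
  field_simp

theorem isGeneralSet {k t : ℂ} (hk : k ≠ 0) (ht : t ≠ 0) : IsGeneralSet (generalSet k t) where
  subset _ hq := hq.1
  nonempty := by
    obtain ⟨x, y, h, -⟩ := exists_genPoly_invol_ne_zero hk ht
    exact ⟨_, pt_mem_generalSet.2 h⟩
  relOpen := relOpen_generalSet k t
  rep_ne q hq i j := by
    obtain ⟨x, y, rfl, h⟩ := exists_eq_pt hq
    obtain ⟨hx, hy, -⟩ := genPoly_ne_zero_iff.1 h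
    have key : ∀ (u : ℂ), u ≠ 0 → ∀ i, (affPt u).rep i ≠ 0 := fun u hu i => by
      obtain ⟨a, ha, hr⟩ := (affPt_rep u).exists_rep_eq
      rw [hr]
      fin_cases i
      · simpa using ha
      · simpa using ⟨ha, hu⟩
    rw [cx_pt, cy_pt]
    exact ⟨key _ hx i, key _ hy j⟩

/-- General points avoid the indeterminacy of the coordinates of each pair of blow-ups. -/
theorem generalFor {k t c : ℂ} (hc : c ^ 2 = k ^ 2) (sw : Bool) {q : PSp (Fin 2 × Fin 2)}
    (hq : q ∈ generalSet k t) : GeneralFor sw c t q := by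
  obtain ⟨x, y, rfl, h⟩ := exists_eq_pt hq
  obtain ⟨ξ, η, hξ, hη, h⟩ : ∃ ξ η, cx sw (pt x y) = affPt ξ ∧ cy sw (pt x y) = affPt η ∧
      genPoly k t ξ η ≠ 0 := by
    refine ⟨_, _, cx_pt _ _ _, cy_pt _ _ _, ?_⟩
    cases sw
    · exact h
    · rwa [genPoly_comm]
  obtain ⟨-, hη0, hξc, -, hl, -⟩ := genPoly_ne_zero_iff.1 h
  obtain ⟨a, ha, hx⟩ := (affPt_rep ξ).exists_rep_eq
  obtain ⟨b, hb, hy⟩ := (affPt_rep η).exists_rep_eq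
  have hξc' : ξ - c ≠ 0 := fun h0 => hξc (by linear_combination (ξ + c) * h0 + hc)
  have hl' : t * η - (ξ - c) ≠ 0 := fun h0 => hl (by
    linear_combination (t * η - ξ - c) * h0 + hc)
  have hv : planeVec sw c (pt x y) = (a * b) • ![ξ - c, η, (ξ - c) * η] := by
    funext j
    fin_cases j <;> simp [planeVec, shiftNum, hξ, hη, hx, hy] <;> ring
  have hab := mul_ne_zero ha hb
  rw [GeneralFor, hv, lineVec_smul]
  constructor
  · intro j
    fin_cases j <;> simp [ha, hb, hη0, hξc']
  · intro j
    fin_cases j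
    · exact mul_ne_zero hab hl'
    · exact mul_ne_zero hab (mul_ne_zero hξc' hη0)

/-! ### Extension of the involution to the tower -/

theorem IsRep.of_minor {v w : Fin 2 → ℂ} {p : PSp (Fin 2)} (hw : IsRep w p) (hv : v ≠ 0)
    (h : v 0 * w 1 = v 1 * w 0) : IsRep v p := by
  refine hw.of_minors hv fun i j => ?_
  fin_cases i <;> fin_cases j
  · rfl
  · exact h
  · exact h.symm
  · rfl

theorem IsRep.of_minors_three {v w : Fin 3 → ℂ} {p : PSp (Fin 3)} (hw : IsRep w p) (hv : v ≠ 0)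
    (h₁ : v 0 * w 1 = v 1 * w 0) (h₂ : v 0 * w 2 = v 2 * w 0) (h₃ : v 1 * w 2 = v 2 * w 1) :
    IsRep v p := by
  refine hw.of_minors hv fun i j => ?_
  fin_cases i <;> fin_cases j
  · rfl
  · exact h₁
  · exact h₂
  · exact h₁.symm
  · rfl
  · exact h₃
  · exact h₂.symm
  · exact h₃.symm
  · rfl

/-- On the open set `D` of general points, the map `f₀` lies over the involution
`(x, y) ↦ (x, y')`. -/
def LiesOverInvol (k t : ℂ) {S : ProjVariety} (ε : Mor S P1P1) (D : Set (PSp S.ι))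
    (f₀ : PSp S.ι → PSp S.ι) : Prop :=
  ∀ q ∈ S.carrier, q ∈ D → f₀ q ∈ S.carrier ∧ ∃ x y, genPoly k t x y ≠ 0 ∧ ε q = pt x y ∧
    ε (f₀ q) = pt x (invol k t x y)

section Formulas

variable {k t c : ℂ} {S : ProjVariety} {ε : Mor S P1P1} {D : Set (PSp S.ι)}
  {f₀ : PSp S.ι → PSp S.ι}

theorem Mor.reg_cx {X : ProjVariety} (ε : Mor X P1P1) (sw : Bool) :
    Reg X.carrier (fun q => cx sw (ε q)) :=
  (ClassicalAG.reg_cx sw).comp ε.isMorphism.reg ε.isMorphism.1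

/-- The nonvanishing conditions in terms of `c = ±k`. -/
theorem general_facts (hc : c ^ 2 = k ^ 2) {x y : ℂ} (h : genPoly k t x y ≠ 0) :
    x ≠ 0 ∧ y ≠ 0 ∧ x - c ≠ 0 ∧ x + c ≠ 0 ∧ invol k t x y ≠ 0 ∧
      ∃ e, e = 2 * t * x * y - (x ^ 2 - c ^ 2) ∧ e ≠ 0 ∧
        invol k t x y = (x ^ 2 - c ^ 2) * y / e := by
  obtain ⟨h1, h2, h3, -, -, -, h4, -⟩ := genPoly_ne_zero_iff.1 h
  rw [invol, ← hc]
  rw [← hc] at h3 h4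
  rw [sq_sub_sq] at h3
  refine ⟨h1, h2, right_ne_zero_of_mul h3, left_ne_zero_of_mul h3, ?_, _, rfl, h4, rfl⟩
  rw [sq_sub_sq]
  exact div_ne_zero (mul_ne_zero h3 h2) (by rwa [← sq_sub_sq])

/-- The coordinate `y'` near the points with `x ≠ -c`, from the coordinate `z₀ / z₁` with general
value `t / (x - c) - 1 / y`. -/
theorem extendsAt_snd (hf : LiesOverInvol k t ε D f₀) (hc : c ^ 2 = k ^ 2) (ht : t ≠ 0)
    {l : PSp S.ι → PSp (Fin 3)} {z : PSp S.ι → PSp (Fin 2)} (h : CentreCoord S ε false c t l z)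
    {s : PSp S.ι} (hs : s ∈ S.carrier)
    (hsc : (cx false (ε s)).rep 1 + c * (cx false (ε s)).rep 0 ≠ 0) :
    ExtendsAt S.carrier D (fun q => cy false (ε (f₀ q))) s := by
  have hv := PReg.comp2 (T := fun u v => ![(u 1 + c * u 0) * v 0 + t * u 0 * v 1,
    (u 1 + c * u 0) * v 1]) (ε.reg_cx false) h.reg_line 1 1
    (by
      intro a b u v j
      fin_cases j <;> simp <;> ring)
    (by
      intro W u v hu hv j
      have h1 := (hu 1).add ((IsRegularOn.const c).mul (hu 0))
      fin_cases j
      · exact (h1.mul (hv 0)).add (((IsRegularOn.const t).mul (hu 0)).mul (hv 1))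
      · exact h1.mul (hv 1))
  refine ExtendsAt.of_isRep hs hv ?_ ?_
  · intro h0
    have h1 := (mul_eq_zero.1 (congrFun h0 1)).resolve_left hsc
    have h2 := congrFun h0 0
    simp only [Matrix.cons_val_zero, h1, mul_zero, add_zero, Pi.zero_apply] at h2
    exact rep_two_ne _ ((mul_eq_zero.1 h2).resolve_left hsc) h1
  · intro q hq hqD hne
    obtain ⟨hfq, x, y, hg, hεq, hεf⟩ := hf q hq hqD
    obtain ⟨hx, hy, h1, h2, -, e, he, h3, h4⟩ := general_facts hc hg
    have hξ : cx false (ε q) = affPt x := by rw [hεq, cx_pt]; rfl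
    have hη : cy false (ε q) = affPt y := by rw [hεq, cy_pt]; rfl
    obtain ⟨-, hz⟩ := h.isRep ht hq hξ hη hy
    obtain ⟨a, ha, hxr⟩ := (affPt_rep x).exists_rep_eq
    obtain ⟨d, hd, hzr⟩ := hz.exists_rep_eq
    have hY : cy false (ε (f₀ q)) = affPt (invol k t x y) := by rw [hεf, cy_pt]; rfl
    simp only [hY]
    refine (affPt_rep _).of_minor hne ?_
    simp only [hξ, hxr, hzr, h4, Pi.smul_apply, smul_eq_mul, Matrix.cons_val]
    field_simp
    rw [he]
    ring

/-- The involution exchanges the coordinates `z` for `c` and `-c` up to the sign of `z₀ / z₁`, since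
`t / (x - c) - 1 / y' = -(t / (x + c) - 1 / y)`. -/
theorem extendsAt_line (hf : LiesOverInvol k t ε D f₀) (hc : c ^ 2 = k ^ 2) (ht : t ≠ 0)
    {l l' : PSp S.ι → PSp (Fin 3)} {z z' : PSp S.ι → PSp (Fin 2)}
    (h : CentreCoord S ε false c t l z) (h' : CentreCoord S ε false (-c) t l' z')
    {s : PSp S.ι} (hs : s ∈ S.carrier) : ExtendsAt S.carrier D (fun q => z (f₀ q)) s := by
  have hv := PReg.comp2 (T := fun u _ => ![-u 0, u 1]) h'.reg_line h'.reg_line 1 0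
    (by
      intro a b u v j
      fin_cases j <;> simp)
    (by
      intro W u v hu hv j
      fin_cases j
      · exact (hu 0).neg
      · exact hu 1)
  refine ExtendsAt.of_isRep hs hv ?_ ?_
  · intro h0
    exact rep_two_ne _ (neg_eq_zero.1 (congrFun h0 0)) (congrFun h0 1)
  · intro q hq hqD hne
    obtain ⟨hfq, x, y, hg, hεq, hεf⟩ := hf q hq hqD
    obtain ⟨hx, hy, h1, h2, h5, e, he, h3, h4⟩ := general_facts hc hg
    have hξ : cx false (ε q) = affPt x := by rw [hεq, cx_pt]; rfl
    have hη : cy false (ε q) = affPt y := by rw [hεq, cy_pt]; rfl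
    have hξ' : cx false (ε (f₀ q)) = affPt x := by rw [hεf, cx_pt]; rfl
    have hη' : cy false (ε (f₀ q)) = affPt (invol k t x y) := by rw [hεf, cy_pt]; rfl
    obtain ⟨-, hz⟩ := h'.isRep ht hq hξ hη hy
    obtain ⟨d, hd, hzr⟩ := hz.exists_rep_eq
    refine (h.isRep ht hfq hξ' hη' h5).2.of_minor hne ?_
    simp only [hzr, h4, Pi.smul_apply, smul_eq_mul, Matrix.cons_val]
    field_simp
    rw [he]
    ring

/-- The coordinate `l` near the points with `x ≠ -c`. In terms of its general value
`[1 / y : 1 / (x - c) : 1]`, the involution replaces `1 / y` by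
`t / (x - c) + t / (x + c) - 1 / y`. -/
theorem extendsAt_plane (hf : LiesOverInvol k t ε D f₀) (hc : c ^ 2 = k ^ 2) (ht : t ≠ 0)
    {l : PSp S.ι → PSp (Fin 3)} {z : PSp S.ι → PSp (Fin 2)} (h : CentreCoord S ε false c t l z)
    {s : PSp S.ι} (hs : s ∈ S.carrier)
    (hsc : (cx false (ε s)).rep 1 + c * (cx false (ε s)).rep 0 ≠ 0) :
    ExtendsAt S.carrier D (fun q => l (f₀ q)) s := by
  have hv := PReg.comp2 (T := fun u v => ![(u 1 + c * u 0) * (t * v 1 - v 0) + t * u 0 * v 2,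
    (u 1 + c * u 0) * v 1, (u 1 + c * u 0) * v 2]) (ε.reg_cx false) h.reg_plane 1 1
    (by
      intro a b u v j
      fin_cases j <;> simp <;> ring)
    (by
      intro W u v hu hv j
      have h1 := (hu 1).add ((IsRegularOn.const c).mul (hu 0))
      have h2 := (IsRegularOn.const t (W := W))
      fin_cases j
      · exact (h1.mul ((h2.mul (hv 1)).sub (hv 0))).add ((h2.mul (hu 0)).mul (hv 2))
      · exact h1.mul (hv 1)
      · exact h1.mul (hv 2))
  refine ExtendsAt.of_isRep hs hv ?_ ?_
  · intro h0
    have h1 := (mul_eq_zero.1 (congrFun h0 1)).resolve_left hsc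
    have h2 := (mul_eq_zero.1 (congrFun h0 2)).resolve_left hsc
    have h3 := congrFun h0 0
    simp only [Matrix.cons_val_zero, h1, h2, mul_zero, add_zero, zero_sub, Pi.zero_apply] at h3
    have h4 := neg_eq_zero.1 ((mul_eq_zero.1 h3).resolve_left hsc)
    refine (l s).rep_nonzero (funext fun j => ?_)
    fin_cases j
    · exact h4
    · exact h1
    · exact h2
  · intro q hq hqD hne
    obtain ⟨hfq, x, y, hg, hεq, hεf⟩ := hf q hq hqD
    obtain ⟨hx, hy, h1, h2, h5, e, he, h3, h4⟩ := general_facts hc hg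
    have hξ : cx false (ε q) = affPt x := by rw [hεq, cx_pt]; rfl
    have hη : cy false (ε q) = affPt y := by rw [hεq, cy_pt]; rfl
    have hξ' : cx false (ε (f₀ q)) = affPt x := by rw [hεf, cx_pt]; rfl
    have hη' : cy false (ε (f₀ q)) = affPt (invol k t x y) := by rw [hεf, cy_pt]; rfl
    obtain ⟨hl, -⟩ := h.isRep ht hq hξ hη hy
    obtain ⟨a, ha, hxr⟩ := (affPt_rep x).exists_rep_eq
    obtain ⟨d, hd, hlr⟩ := hl.exists_rep_eq
    refine (h.isRep ht hfq hξ' hη' h5).1.of_minors_three hne ?_ ?_ ?_ <;>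
    · simp only [hξ, hxr, hlr, h4, Pi.smul_apply, smul_eq_mul, Matrix.cons_val]
      field_simp
      try (rw [he]; ring)

theorem lineVec_planeVec_ne_zero (ht : t ≠ 0) {sw : Bool} {p : PSp (Fin 2 × Fin 2)}
    (h : planeVec sw c p ≠ 0) : lineVec t (planeVec sw c p) ≠ 0 := by
  intro h0
  have h1 : t * ((cx sw p).rep 0 * (cy sw p).rep 1) - shiftNum sw c p * (cy sw p).rep 0 = 0 :=
    congrFun h0 0
  have h2 : shiftNum sw c p * (cy sw p).rep 1 = 0 := congrFun h0 1
  refine h (planeVec_eq_zero_iff.2 ?_)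
  rcases mul_eq_zero.1 h2 with h3 | h3
  · refine ⟨h3, ?_⟩
    rw [h3, zero_mul, sub_zero] at h1
    refine (mul_eq_zero.1 ((mul_eq_zero.1 h1).resolve_left ht)).resolve_left fun h4 => ?_
    exact rep_two_ne _ h4 (by simpa [shiftNum, h4] using h3)
  · refine ⟨?_, h3⟩
    rw [h3, mul_zero, mul_zero, zero_sub, neg_eq_zero] at h1
    exact (mul_eq_zero.1 h1).resolve_right fun h4 => rep_two_ne _ h4 h3

/-- Off the centre, the coordinates of a pair of blow-ups extend as soon as the map to
`ℙ¹ × ℙ¹` does. -/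
theorem extendsAt_of_ne_basePt (hf : LiesOverInvol k t ε D f₀) (ht : t ≠ 0) {sw : Bool}
    {l : PSp S.ι → PSp (Fin 3)} {z : PSp S.ι → PSp (Fin 2)} (h : CentreCoord S ε sw c t l z)
    {P : PSp S.ι → PSp (Fin 2 × Fin 2)} (hP : Reg S.carrier P)
    (hPm : Set.MapsTo P S.carrier P1P1.carrier)
    (hPD : ∀ q ∈ S.carrier, q ∈ D → P q = ε (f₀ q)) {s : PSp S.ι} (hs : s ∈ S.carrier)
    (hPs : P s ≠ basePt sw c) : ExtendsAt S.carrier D (fun q => l (f₀ q)) s ∧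
      ExtendsAt S.carrier D (fun q => z (f₀ q)) s := by
  have hv := preg_planeVec (A := S.carrier) (φ := P) sw c ((reg_cx sw).comp hP hPm)
    ((reg_cy sw).comp hP hPm)
  have h0 : planeVec sw c (P s) ≠ 0 := planeVec_ne_zero (hPm hs) hPs
  have key : ∀ q ∈ S.carrier, q ∈ D → planeVec sw c (P q) ≠ 0 →
      IsRep (planeVec sw c (P q)) (l (f₀ q)) := fun q hq hqD hne => by
    rw [hPD q hq hqD] at hne ⊢
    exact (h.planeRel _ (hf q hq hqD).1).isRep hne
  refine ⟨ExtendsAt.of_isRep hs hv h0 key, ExtendsAt.of_isRep hs (preg_lineVec (t := t) hv)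
    (lineVec_planeVec_ne_zero ht h0) fun q hq hqD hne => ?_⟩
  have hne' : planeVec sw c (P q) ≠ 0 := fun h1 => hne (by
    rw [h1]
    funext j
    fin_cases j <;> simp [lineVec])
  have hl := key q hq hqD hne'
  obtain ⟨a, ha, hlr⟩ := hl.exists_rep_eq
  have := isRep_lineVec (l := l) (h.lineRel _ (hf q hq hqD).1) (by
    rw [hlr, lineVec_smul]
    exact smul_ne_zero ha hne)
  rw [hlr, lineVec_smul] at this
  exact this.of_smul

/-- The coordinates over `(0, c)`, near the points over `(0, -c)`: the involution exchanges the
neighbourhoods of these two points. -/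
theorem extendsAt_of_basePt_neg (hf : LiesOverInvol k t ε D f₀) (hc : c ^ 2 = k ^ 2)
    (hc0 : c ≠ 0) (ht : t ≠ 0) {l l' : PSp S.ι → PSp (Fin 3)} {z z' : PSp S.ι → PSp (Fin 2)}
    (h : CentreCoord S ε true c t l z) (h' : CentreCoord S ε true (-c) t l' z')
    {s : PSp S.ι} (hs : s ∈ S.carrier) (hεs : ε s = basePt true (-c)) :
    ExtendsAt S.carrier D (fun q => l (f₀ q)) s ∧
      ExtendsAt S.carrier D (fun q => z (f₀ q)) s := by
  have hεr : Reg S.carrier ε := ε.isMorphism.reg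
  -- with `w = x ^ 2 - c ^ 2` and `m = l'`, the coordinates of the plane are
  -- `[m₀ w - 2 t c y m₁ : m₁ (2 t x y - w) : x (m₀ w - 2 t c y m₁)]`, homogenized by means of the
  -- Segre coordinates `u` of `(x, y)`
  have hv := PReg.comp2 (T := fun u m => ![
    (m 0 * (u (1, 0) ^ 2 - c ^ 2 * u (0, 0) ^ 2) - 2 * t * c * u (0, 1) * u (0, 0) * m 1) *
      u (0, 0),
    m 1 * (2 * t * u (1, 0) * u (0, 1) - (u (1, 0) ^ 2 - c ^ 2 * u (0, 0) ^ 2)) * u (0, 0),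
    u (1, 0) * (m 0 * (u (1, 0) ^ 2 - c ^ 2 * u (0, 0) ^ 2) -
      2 * t * c * u (0, 1) * u (0, 0) * m 1)]) hεr h'.reg_plane 3 1
    (by
      intro a b u v j
      fin_cases j <;> simp <;> ring)
    (by
      intro W u m hu hm j
      have hw := ((hu (1, 0)).pow 2).sub ((IsRegularOn.const (c ^ 2)).mul ((hu (0, 0)).pow 2))
      have h1 := ((hm 0).mul hw).sub ((((IsRegularOn.const (2 * t * c)).mul (hu (0, 1))).mul
        (hu (0, 0))).mul (hm 1))
      have h2 := ((IsRegularOn.const (2 * t)).mul (hu (1, 0))).mul (hu (0, 1))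
      fin_cases j
      · exact h1.mul (hu (0, 0))
      · exact ((hm 1).mul (h2.sub hw)).mul (hu (0, 0))
      · exact (hu (1, 0)).mul h1)
  -- with `n = z'`, the coordinates of the line are
  -- `[n₀ (w + 2 t x y - 2 x ^ 2) + n₁ (2 t y + 2 t c - 2 x) : n₁ (w - 2 c y) - 2 c x y n₀]`
  have hv' := PReg.comp2 (T := fun u n => ![
    n 0 * ((u (1, 0) ^ 2 - c ^ 2 * u (0, 0) ^ 2) + 2 * t * u (1, 0) * u (0, 1) -
      2 * u (1, 0) ^ 2) + n 1 * (2 * t * u (0, 1) * u (0, 0) + 2 * t * c * u (0, 0) ^ 2 -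
      2 * u (1, 0) * u (0, 0)),
    n 1 * ((u (1, 0) ^ 2 - c ^ 2 * u (0, 0) ^ 2) - 2 * c * u (0, 1) * u (0, 0)) -
      2 * c * u (1, 0) * u (0, 1) * n 0]) hεr h'.reg_line 2 1
    (by
      intro a b u v j
      fin_cases j <;> simp <;> ring)
    (by
      intro W u n hu hn j
      have hw := ((hu (1, 0)).pow 2).sub ((IsRegularOn.const (c ^ 2)).mul ((hu (0, 0)).pow 2))
      have h1 := ((IsRegularOn.const (2 * t)).mul (hu (1, 0))).mul (hu (0, 1))
      have h2 := ((IsRegularOn.const (2 * t)).mul (hu (0, 1))).mul (hu (0, 0))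
      have h3 := (IsRegularOn.const (2 * t * c)).mul ((hu (0, 0)).pow 2)
      have h4 := ((IsRegularOn.const 2).mul (hu (1, 0))).mul (hu (0, 0))
      have h5 := ((IsRegularOn.const (2 * c)).mul (hu (0, 1))).mul (hu (0, 0))
      have h6 := ((IsRegularOn.const (2 * c)).mul (hu (1, 0))).mul (hu (0, 1))
      fin_cases j
      · exact ((hn 0).mul ((hw.add h1).sub ((IsRegularOn.const 2).mul ((hu (1, 0)).pow 2)))).add
          ((hn 1).mul ((h2.add h3).sub h4))
      · exact ((hn 1).mul (hw.sub h5)).sub (h6.mul (hn 0)))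
  obtain ⟨a, ha, hpr⟩ := (rep_pt 0 (-c)).exists_rep_eq
  have hεs' : ε s = pt 0 (-c) := hεs
  have hm2 : (l' s).rep 2 = 0 := by
    have h1 := h'.planeRel s hs
    have hne : (cx true (ε s)).rep 0 ≠ 0 := by
      rw [hεs, cx_basePt]
      exact affPt_rep_zero _
    have h2 := h1.1
    rw [((eq_basePt_iff (ε.isMorphism.1 hs)).1 hεs).1, zero_mul] at h2
    exact (mul_eq_zero.1 h2).resolve_right hne
  refine ⟨ExtendsAt.of_isRep hs hv ?_ ?_, ExtendsAt.of_isRep hs hv' ?_ ?_⟩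
  · intro h0
    have e0 := congrFun h0 0
    have e1 := congrFun h0 1
    simp only [hεs', hpr, Pi.smul_apply, smul_eq_mul, Matrix.cons_val, Pi.zero_apply] at e0 e1
    have hm1 : (l' s).rep 1 = 0 := by
      have : (a ^ 3 * c ^ 2) * (l' s).rep 1 = 0 := by linear_combination e1
      exact (mul_eq_zero.1 this).resolve_left
        (mul_ne_zero (pow_ne_zero _ ha) (pow_ne_zero _ hc0))
    have hm0 : (l' s).rep 0 = 0 := by
      rw [hm1] at e0
      have : (a ^ 3 * c ^ 2) * (l' s).rep 0 = 0 := by linear_combination -e0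
      exact (mul_eq_zero.1 this).resolve_left
        (mul_ne_zero (pow_ne_zero _ ha) (pow_ne_zero _ hc0))
    refine (l' s).rep_nonzero (funext fun j => ?_)
    fin_cases j
    · exact hm0
    · exact hm1
    · exact hm2
  · intro q hq hqD hne
    obtain ⟨hfq, x, y, hg, hεq, hεf⟩ := hf q hq hqD
    obtain ⟨hx, hy, h1, h2, h5, e, he, h3, h4⟩ := general_facts hc hg
    have hξ : cx true (ε q) = affPt y := by rw [hεq, cx_pt]; rfl
    have hη : cy true (ε q) = affPt x := by rw [hεq, cy_pt]; rfl
    have hξ' : cx true (ε (f₀ q)) = affPt (invol k t x y) := by rw [hεf, cx_pt]; rfl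
    have hη' : cy true (ε (f₀ q)) = affPt x := by rw [hεf, cy_pt]; rfl
    obtain ⟨hl, -⟩ := h'.isRep ht hq hξ hη hx
    obtain ⟨b, hb, hqr⟩ := (rep_pt x y).exists_rep_eq
    obtain ⟨d, hd, hlr⟩ := hl.exists_rep_eq
    refine (h.isRep ht hfq hξ' hη' hx).1.of_minors_three hne ?_ ?_ ?_ <;>
    · simp only [hεq, hqr, hlr, h4, Pi.smul_apply, smul_eq_mul, Matrix.cons_val]
      field_simp
      try (rw [he]; ring)
  · intro h0
    have e0 := congrFun h0 0
    have e1 := congrFun h0 1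
    simp only [hεs', hpr, Pi.smul_apply, smul_eq_mul, Matrix.cons_val, Pi.zero_apply] at e0 e1
    have hac : a ^ 2 * c ^ 2 ≠ 0 := mul_ne_zero (pow_ne_zero _ ha) (pow_ne_zero _ hc0)
    refine rep_two_ne (z' s) ((mul_eq_zero.1 (?_ : (a ^ 2 * c ^ 2) * _ = 0)).resolve_left hac)
      ((mul_eq_zero.1 (?_ : (a ^ 2 * c ^ 2) * _ = 0)).resolve_left hac)
    · linear_combination -e0
    · linear_combination e1
  · intro q hq hqD hne
    obtain ⟨hfq, x, y, hg, hεq, hεf⟩ := hf q hq hqD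
    obtain ⟨hx, hy, h1, h2, h5, e, he, h3, h4⟩ := general_facts hc hg
    have hξ : cx true (ε q) = affPt y := by rw [hεq, cx_pt]; rfl
    have hη : cy true (ε q) = affPt x := by rw [hεq, cy_pt]; rfl
    have hξ' : cx true (ε (f₀ q)) = affPt (invol k t x y) := by rw [hεf, cx_pt]; rfl
    have hη' : cy true (ε (f₀ q)) = affPt x := by rw [hεf, cy_pt]; rfl
    obtain ⟨-, hz⟩ := h'.isRep ht hq hξ hη hx
    obtain ⟨b, hb, hqr⟩ := (rep_pt x y).exists_rep_eq
    obtain ⟨d, hd, hzr⟩ := hz.exists_rep_eq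
    refine (h.isRep ht hfq hξ' hη' hx).2.of_minor hne ?_
    simp only [hεq, hqr, hzr, h4, Pi.smul_apply, smul_eq_mul, Matrix.cons_val]
    field_simp
    rw [he]
    ring

end Formulas

/-! ### Automorphisms of the tower -/

namespace IsTower

variable {G B : Set (PSp (Fin 2 × Fin 2))} {S : ProjVariety} {ε : Mor S P1P1}

/-- A self-map of `ℙ¹ × ℙ¹`, defined at general points, lifts to a morphism of `S` if its lift
extends near every point of `S`. -/
theorem exists_mor (h : IsTower G B S ε) (hG : IsGeneralSet G)
    (φ₀ : PSp (Fin 2 × Fin 2) → PSp (Fin 2 × Fin 2))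
    (hφ₀ : ∀ q ∈ G, φ₀ q ∈ P1P1.carrier \ B)
    (hext : ∀ (D : Set (PSp S.ι)) (f₀ : PSp S.ι → PSp S.ι), IsOpen D →
      S.carrier ⊆ closure (S.carrier ∩ D) → (S.carrier ∩ D).Nonempty →
      (∀ q ∈ S.carrier, q ∈ D → ε q ∈ G ∧ f₀ q ∈ S.carrier ∧ ε (f₀ q) = φ₀ (ε q)) →
      ∀ s ∈ S.carrier, ExtendsAt S.carrier D f₀ s) :
    ∃ F : Mor S S, ∀ s ∈ S.carrier, ε s ∈ G → ε (F s) = φ₀ (ε s) := by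
  obtain ⟨ψ, hψ⟩ := h.iso
  obtain ⟨D, hD, hSD, hd⟩ := h.exists_dense hG
  obtain ⟨a, b, -, hne⟩ := h.hasChart hG hSD
  have hf : ∀ q ∈ S.carrier, q ∈ D → ε q ∈ G ∧ ψ (φ₀ (ε q)) ∈ S.carrier ∧
      ε (ψ (φ₀ (ε q))) = φ₀ (ε q) := fun q hq hqD => by
    have hqG := (hSD.subset ⟨hq, hqD⟩).2
    exact ⟨hqG, (hψ.mapsTo' (hφ₀ _ hqG)).1, hψ.right _ (hφ₀ _ hqG)⟩
  obtain ⟨F, hF, hFf⟩ := exists_reg_extension (h.isIrreducible hG).isPreirreducible hD hne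
    (fun q => ψ (φ₀ (ε q))) (hext D _ hD hd hne hf)
  have hFS : Set.MapsTo F S.carrier S.carrier := fun s hs => by
    by_contra hFs
    obtain ⟨V, hV, hSV⟩ := hF.exists_isOpen S.isClosed.isOpen_compl
    obtain ⟨q, hqV, hqS, hqD⟩ := mem_closure_iff.1 (hd hs) V hV (hSV.symm.subset ⟨hs, hFs⟩).2
    refine (hSV.subset ⟨hqS, hqV⟩).2 ?_
    rw [hFf q ⟨hqS, hqD⟩]
    exact (hf q hqS hqD).2.1
  refine ⟨⟨F, hF.isMorphism hFS⟩, fun s hs hsG => ?_⟩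
  have hsD := (hSD.symm.subset ⟨hs, hsG⟩).2
  change ε (F s) = _
  rw [hFf s ⟨hs, hsD⟩]
  exact (hf s hs hsD).2.2

/-- Lifts of mutually inverse maps are mutually inverse, as soon as one general point has a
general image. -/
theorem leftInverse (h : IsTower G B S ε) (hG : IsGeneralSet G)
    {φ φ' : PSp (Fin 2 × Fin 2) → PSp (Fin 2 × Fin 2)} {F F' : Mor S S}
    (hF : ∀ s ∈ S.carrier, ε s ∈ G → ε (F s) = φ (ε s))
    (hF' : ∀ s ∈ S.carrier, ε s ∈ G → ε (F' s) = φ' (ε s))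
    (hne : ∃ q ∈ G, φ' q ∈ G) (hφ : ∀ q ∈ G, φ' q ∈ G → φ (φ' q) = q) :
    ∀ s ∈ S.carrier, F (F' s) = s := by
  obtain ⟨ψ, hψ⟩ := h.iso
  obtain ⟨D, hD, hSD, -⟩ := h.exists_dense hG
  obtain ⟨D', hD', hSD'⟩ := F'.isMorphism.reg.exists_isOpen hD
  have hFF : Reg S.carrier (fun s => F (F' s)) :=
    F.isMorphism.reg.comp F'.isMorphism.reg F'.isMorphism.1
  have hdense : S.carrier ⊆ closure (S.carrier ∩ (D ∩ D')) := by
    have := subset_closure_of_isPreirreducible (h.isIrreducible hG).isPreirreducible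
      isOpen_univ (hD.inter hD') ?_
    · simpa using this
    · obtain ⟨q, hq, hqG⟩ := hne
      have hqB : q ∈ P1P1.carrier \ B := ⟨hG.subset hq, h.disjoint q hq⟩
      have hS := (hψ.mapsTo' hqB).1
      have hε : ε (ψ q) = q := hψ.right q hqB
      have hεG : ε (ψ q) ∈ G := by rwa [hε]
      refine ⟨ψ q, hS, (hSD.symm.subset ⟨hS, hεG⟩).2, (hSD'.symm.subset ⟨hS, ?_⟩).2⟩
      refine (hSD.symm.subset ⟨F'.isMorphism.1 hS, ?_⟩).2
      rwa [Set.mem_preimage, hF' _ hS hεG, hε]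
  refine Reg.eqOn_of_dense hFF reg_id hdense fun s hs => ?_
  have hsG : ε s ∈ G := (hSD.subset ⟨hs.1, hs.2.1⟩).2
  have hs' := F'.isMorphism.1 hs.1
  have hsG' : ε (F' s) ∈ G := (hSD.subset ⟨hs', (hSD'.subset ⟨hs.1, hs.2.2⟩).2⟩).2
  have hε : ε (F (F' s)) = ε s := by
    rw [hF _ hs' hsG', hF' s hs.1 hsG]
    exact hφ _ hsG (by rwa [← hF' s hs.1 hsG])
  have hsB := h.disjoint _ hsG
  have hleft := hψ.left (F (F' s)) ⟨F.isMorphism.1 hs', by rwa [Set.mem_preimage, hε]⟩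
  rw [hε, hψ.left s ⟨hs.1, hsB⟩] at hleft
  exact hleft.symm

end IsTower

/-- The numbers `±k`. -/
def signed (k : ℂ) (n : Bool) : ℂ := bif n then -k else k

theorem signed_sq (k : ℂ) (n : Bool) : signed k n ^ 2 = k ^ 2 := by
  cases n <;> simp [signed]

theorem signed_ne_zero {k : ℂ} (hk : k ≠ 0) (n : Bool) : signed k n ≠ 0 := by
  cases n <;> simpa [signed]

theorem signed_not (k : ℂ) (n : Bool) : signed k (!n) = -signed k n := by
  cases n <;> simp [signed]

/-- `S` is a tower over the four points `(±k, 0)` and `(0, ±k)`, with coordinates `l` and `z` that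
determine morphisms to `S`. The first index tells the coordinate axes apart, the second one is the
sign of `±k`. -/
structure IsQRTTower (k t : ℂ) (B : Set (PSp (Fin 2 × Fin 2))) (S : ProjVariety) (ε : Mor S P1P1)
    (l : Bool → Bool → PSp S.ι → PSp (Fin 3)) (z : Bool → Bool → PSp S.ι → PSp (Fin 2)) :
    Prop where
  tower : IsTower (generalSet k t) B S ε
  centres : ∀ q ∈ B, ∃ sw n, q = basePt sw (signed k n)
  coord : ∀ sw n, CentreCoord S ε sw (signed k n) t (l sw n) (z sw n)
  extendsAt : ∀ (D : Set (PSp S.ι)) (f₀ : PSp S.ι → PSp S.ι) (s : PSp S.ι),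
    (∀ q ∈ S.carrier, q ∈ D → f₀ q ∈ S.carrier) →
    ExtendsAt S.carrier D (fun q => ε (f₀ q)) s →
    (∀ sw n, ExtendsAt S.carrier D (fun q => l sw n (f₀ q)) s) →
    (∀ sw n, ExtendsAt S.carrier D (fun q => z sw n (f₀ q)) s) → ExtendsAt S.carrier D f₀ s

/-- The involution `(x, y) ↦ (x, y')` at general points. -/
def involPt (k t : ℂ) (q : PSp (Fin 2 × Fin 2)) : PSp (Fin 2 × Fin 2) :=
  pt (aff (cx false q)) (invol k t (aff (cx false q)) (aff (cy false q)))

theorem involPt_pt (k t x y : ℂ) : involPt k t (pt x y) = pt x (invol k t x y) := by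
  simp [involPt, cx_pt, cy_pt]

/-- The exchange of the two coordinates. -/
def swapPt (q : PSp (Fin 2 × Fin 2)) : PSp (Fin 2 × Fin 2) :=
  mkPt true (cx false q) (cy false q)

theorem swapPt_pt (x y : ℂ) : swapPt (pt x y) = pt y x := by
  rw [swapPt, cx_pt, cy_pt]
  rfl

theorem reg_swapPt : Reg P1P1.carrier swapPt := reg_mkPt true (reg_cx false) (reg_cy false)

namespace IsQRTTower

variable {k t : ℂ} {B : Set (PSp (Fin 2 × Fin 2))} {S : ProjVariety} {ε : Mor S P1P1}
  {l : Bool → Bool → PSp S.ι → PSp (Fin 3)} {z : Bool → Bool → PSp S.ι → PSp (Fin 2)}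

theorem pt_notMem (h : IsQRTTower k t B S ε l z) {x y : ℂ} (hx : x ≠ 0) (hk : x ^ 2 ≠ k ^ 2) :
    pt x y ∉ B ∧ pt y x ∉ B := by
  have key : ∀ sw n, pt x y ≠ basePt sw (signed k n) ∧ pt y x ≠ basePt sw (signed k n) := by
    intro sw n
    have hn : x ≠ signed k n := fun hx' => hk (by rw [hx', signed_sq])
    rw [basePt_eq_pt]
    refine ⟨fun he => ?_, fun he => ?_⟩
    · cases sw
      · exact hn (pt_injective he).1
      · exact hx (pt_injective he).1
    · cases sw
      · exact hx (pt_injective he).2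
      · exact hn (pt_injective he).2
  constructor
  · intro hB
    obtain ⟨sw, n, he⟩ := h.centres _ hB
    exact (key sw n).1 he
  · intro hB
    obtain ⟨sw, n, he⟩ := h.centres _ hB
    exact (key sw n).2 he

/-- The lift of the exchange of the coordinates. -/
theorem exists_swap (h : IsQRTTower k t B S ε l z) (hk : k ≠ 0) (ht : t ≠ 0) :
    ∃ F : Mor S S, (∀ s ∈ S.carrier, ε (F s) = swapPt (ε s)) ∧
      ∀ s ∈ S.carrier, F (F s) = s := by
  have hG := isGeneralSet hk ht
  have hmor := h.tower.exists_mor hG swapPt ?_ ?_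
  · obtain ⟨F, hF⟩ := hmor
    refine ⟨F, ?_, h.tower.leftInverse hG hF hF ?_ ?_⟩
    · obtain ⟨D, -, hSD, hd⟩ := h.tower.exists_dense hG
      exact Reg.eqOn_of_dense (ε.isMorphism.reg.comp F.isMorphism.reg F.isMorphism.1)
        (reg_swapPt.comp ε.isMorphism.reg ε.isMorphism.1) hd
        fun q hq => hF q hq.1 (hSD.subset hq).2
    · obtain ⟨q, hq⟩ := hG.nonempty
      refine ⟨q, hq, ?_⟩
      obtain ⟨x, y, rfl, hg⟩ := exists_eq_pt hq
      rwa [swapPt_pt, pt_mem_generalSet, genPoly_comm]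
    · intro q hq _
      obtain ⟨x, y, rfl, hg⟩ := exists_eq_pt hq
      rw [swapPt_pt, swapPt_pt]
  · intro q hq
    obtain ⟨x, y, rfl, hg⟩ := exists_eq_pt hq
    obtain ⟨hx, -, hxk, -⟩ := genPoly_ne_zero_iff.1 hg
    rw [swapPt_pt]
    exact ⟨pt_mem _ _, (h.pt_notMem hx (sub_ne_zero.1 hxk)).2⟩
  · intro D f₀ hD _ _ hf s hs
    have hcomp : ∀ sw n, ∀ q ∈ S.carrier, q ∈ D →
        l (!sw) n q = l sw n (f₀ q) ∧ z (!sw) n q = z sw n (f₀ q) := by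
      intro sw n q hq hqD
      obtain ⟨hqG, hfq, hε⟩ := hf q hq hqD
      obtain ⟨x, y, hxy, hg⟩ := exists_eq_pt hqG
      rw [hxy, swapPt_pt] at hε
      obtain ⟨hx, hy, -⟩ := genPoly_ne_zero_iff.1 hg
      have h1 := (h.coord (!sw) n).isRep ht hq (ξ := bif sw then x else y)
        (η := bif sw then y else x) (by rw [hxy, cx_pt]; cases sw <;> rfl)
        (by rw [hxy, cy_pt]; cases sw <;> rfl) (by cases sw <;> assumption)
      have h2 := (h.coord sw n).isRep ht hfq (ξ := bif sw then x else y)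
        (η := bif sw then y else x) (by rw [hε, cx_pt]) (by rw [hε, cy_pt])
        (by cases sw <;> assumption)
      exact ⟨h1.1.eq h2.1, h1.2.eq h2.2⟩
    refine h.extendsAt D f₀ s (fun q hq hqD => (hf q hq hqD).2.1) ?_ (fun sw n => ?_)
      fun sw n => ?_
    · exact ExtendsAt.of_reg (reg_swapPt.comp ε.isMorphism.reg ε.isMorphism.1)
        fun q hq hqD => (hf q hq hqD).2.2.symm
    · exact ExtendsAt.of_reg (h.coord (!sw) n).reg_plane fun q hq hqD => (hcomp sw n q hq hqD).1
    · exact ExtendsAt.of_reg (h.coord (!sw) n).reg_line fun q hq hqD => (hcomp sw n q hq hqD).2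

/-- If the involution takes a point to `(0, c)`, this point lies over `(0, -c)`. -/
theorem eq_basePt_neg {ε : Mor S P1P1} {D : Set (PSp S.ι)} {f₀ : PSp S.ι → PSp S.ι} {c : ℂ}
    (hf : LiesOverInvol k t ε D f₀) (hd : S.carrier ⊆ closure (S.carrier ∩ D)) (hk : k ≠ 0)
    {P : PSp S.ι → PSp (Fin 2 × Fin 2)} (hP : Reg S.carrier P)
    (hPx : ∀ q ∈ S.carrier, cx false (P q) = cx false (ε q))
    (hPD : ∀ q ∈ S.carrier, q ∈ D → P q = ε (f₀ q)) {s : PSp S.ι} (hs : s ∈ S.carrier)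
    (hPs : P s = basePt true c) : ε s = basePt true (-c) := by
  -- a relation between `x`, `y` and `y'` without denominators
  have hv := PReg.comp2 (κ := Fin 2 × Fin 2) (μ := Fin 2) (ν := Unit) (T := fun u v _ =>
    (u (1, 0) ^ 2 - k ^ 2 * u (0, 0) ^ 2) * v 1 - (2 * t * u (1, 0) * u (0, 1) * v 1 -
      (u (1, 0) * u (1, 1) - k ^ 2 * u (0, 0) * u (0, 1)) * v 0)) hP
      ((reg_cy false).comp ε.isMorphism.reg ε.isMorphism.1) 2 1
    (by
      intro a b u v j
      simp
      ring)
    (by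
      intro W u v hu hv j
      have h1 := ((hu (1, 0)).pow 2).sub ((IsRegularOn.const (k ^ 2)).mul ((hu (0, 0)).pow 2))
      have h2 := (((IsRegularOn.const (2 * t)).mul (hu (1, 0))).mul (hu (0, 1))).mul (hv 1)
      have h3 := ((hu (1, 0)).mul (hu (1, 1))).sub
        (((IsRegularOn.const (k ^ 2)).mul (hu (0, 0))).mul (hu (0, 1)))
      exact (h1.mul (hv 1)).sub (h2.sub (h3.mul (hv 0))))
  have hzero := (closure_minimal (fun q hq => ?_) (hv.isClosed_zeros S.isClosed)) (hd hs)
  · have h0 := congrFun hzero.2 ()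
    obtain ⟨a, ha, hpr⟩ := (rep_pt 0 c).exists_rep_eq
    have hPs' : P s = pt 0 c := hPs
    simp only [hPs', hpr, Pi.smul_apply, smul_eq_mul, Matrix.cons_val, Pi.zero_apply] at h0
    have h1 : (cy false (ε s)).rep 1 + c * (cy false (ε s)).rep 0 = 0 := by
      have : (a ^ 2 * k ^ 2) * ((cy false (ε s)).rep 1 + c * (cy false (ε s)).rep 0) = 0 := by
        linear_combination -h0
      exact (mul_eq_zero.1 this).resolve_left
        (mul_ne_zero (pow_ne_zero _ ha) (pow_ne_zero _ hk))
    refine (eq_basePt_iff (ε.isMorphism.1 hs)).2 ⟨?_, ?_⟩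
    · change (cy false (ε s)).rep 1 - -c * (cy false (ε s)).rep 0 = 0
      linear_combination h1
    · change (cx false (ε s)).rep 1 = 0
      rw [← hPx s hs, hPs', cx_pt]
      obtain ⟨b, hb, hr⟩ := (affPt_rep 0).exists_rep_eq
      simp [hr]
  · refine ⟨hq.1, funext fun _ => ?_⟩
    obtain ⟨-, x, y, hg, hεq, hεf⟩ := hf q hq.1 hq.2
    obtain ⟨-, -, -, -, -, e, he, he0, hi⟩ := general_facts rfl hg
    obtain ⟨a, ha, hpr⟩ := (rep_pt x (invol k t x y)).exists_rep_eq
    obtain ⟨b, hb, hyr⟩ := (affPt_rep y).exists_rep_eq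
    simp only [hPD q hq.1 hq.2, hεf, hεq, hpr, cy_pt, cond_false, hyr, Pi.smul_apply,
      smul_eq_mul, Matrix.cons_val, Pi.zero_apply]
    rw [hi]
    field_simp
    rw [he]
    ring

/-- The lift of the involution. -/
theorem exists_invol (h : IsQRTTower k t B S ε l z) (hk : k ≠ 0) (ht : t ≠ 0) :
    ∃ F : Mor S S, (∀ s ∈ S.carrier, ε s ∈ generalSet k t → ε (F s) = involPt k t (ε s)) ∧
      ∀ s ∈ S.carrier, F (F s) = s := by
  have hG := isGeneralSet hk ht
  have hmor := h.tower.exists_mor hG (involPt k t) ?_ ?_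
  · obtain ⟨F, hF⟩ := hmor
    refine ⟨F, hF, h.tower.leftInverse hG hF hF ?_ ?_⟩
    · obtain ⟨x, y, hg, hg'⟩ := exists_genPoly_invol_ne_zero hk ht
      refine ⟨pt x y, pt_mem_generalSet.2 hg, ?_⟩
      rwa [involPt_pt, pt_mem_generalSet]
    · intro q hq _
      obtain ⟨x, y, rfl, hg⟩ := exists_eq_pt hq
      rw [involPt_pt, involPt_pt, invol_invol hg]
  · intro q hq
    obtain ⟨x, y, rfl, hg⟩ := exists_eq_pt hq
    obtain ⟨hx, -, hxk, -⟩ := genPoly_ne_zero_iff.1 hg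
    rw [involPt_pt]
    exact ⟨pt_mem _ _, (h.pt_notMem hx (sub_ne_zero.1 hxk)).1⟩
  · intro D f₀ hD hd hne hf₀
    have hf : LiesOverInvol k t ε D f₀ := fun q hq hqD => by
      obtain ⟨hqG, hfq, hε⟩ := hf₀ q hq hqD
      obtain ⟨x, y, hxy, hg⟩ := exists_eq_pt hqG
      rw [hxy, involPt_pt] at hε
      exact ⟨hfq, x, y, hg, hxy, hε⟩
    have hx : ∀ (s : PSp S.ι), ∀ n, (cx false (ε s)).rep 1 +
        signed k n * (cx false (ε s)).rep 0 = 0 → (cx false (ε s)).rep 1 +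
          signed k (!n) * (cx false (ε s)).rep 0 ≠ 0 := by
      intro s n h1 h2
      rw [signed_not] at h2
      have h3 : (2 * signed k n) * (cx false (ε s)).rep 0 = 0 := by linear_combination h1 - h2
      have h4 := (mul_eq_zero.1 h3).resolve_left (mul_ne_zero two_ne_zero (signed_ne_zero hk n))
      rw [h4, mul_zero, add_zero] at h1
      exact rep_two_ne _ h4 h1
    obtain ⟨Y, hY, hYD⟩ := exists_reg_extension (h.tower.isIrreducible hG).isPreirreducible hD hne
      (fun q => cy false (ε (f₀ q))) fun s hs => by
        by_cases hn : (cx false (ε s)).rep 1 + signed k false * (cx false (ε s)).rep 0 = 0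
        · exact extendsAt_snd hf (signed_sq k _) ht (h.coord false _) hs (hx s _ hn)
        · exact extendsAt_snd hf (signed_sq k _) ht (h.coord false _) hs hn
    set P : PSp S.ι → PSp (Fin 2 × Fin 2) := fun q => mkPt false (cx false (ε q)) (Y q) with hPdef
    have hP : Reg S.carrier P := reg_mkPt false (ε.reg_cx false) hY
    have hPm : Set.MapsTo P S.carrier P1P1.carrier := fun q _ => mkPt_mem _ _ _
    have hPx : ∀ q, cx false (P q) = cx false (ε q) := fun q => cx_mkPt _ _ _
    have hPD : ∀ q ∈ S.carrier, q ∈ D → P q = ε (f₀ q) := fun q hq hqD => by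
      obtain ⟨hfq, x, y, hg, hεq, hεf⟩ := hf q hq hqD
      simp only [hPdef]
      rw [hYD q ⟨hq, hqD⟩, hεq, hεf, cx_pt, cy_pt]
      rfl
    intro s hs
    have hkey : ∀ sw n, ExtendsAt S.carrier D (fun q => l sw n (f₀ q)) s ∧
        ExtendsAt S.carrier D (fun q => z sw n (f₀ q)) s := by
      intro sw n
      by_cases hb : P s = basePt sw (signed k n)
      · have hc := h.coord sw (!n)
        rw [signed_not] at hc
        cases sw
        · refine ⟨extendsAt_plane hf (signed_sq k n) ht (h.coord false n) hs fun h0 => ?_,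
            extendsAt_line hf (signed_sq k n) ht (h.coord false n) hc hs⟩
          refine hx s n h0 ?_
          rw [signed_not, ← hPx s, hb, cx_basePt]
          obtain ⟨a, ha, hr⟩ := (affPt_rep (signed k n)).exists_rep_eq
          simp only [hr, Pi.smul_apply, smul_eq_mul, Matrix.cons_val]
          ring
        · exact extendsAt_of_basePt_neg hf (signed_sq k n) (signed_ne_zero hk n) ht
            (h.coord true n) hc hs
            (eq_basePt_neg hf hd hk hP (fun q _ => hPx q) hPD hs hb)
      · exact extendsAt_of_ne_basePt hf ht (h.coord sw n) hP hPm hPD hs hb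
    exact h.extendsAt D f₀ s (fun q hq hqD => (hf₀ q hq hqD).2.1) (ExtendsAt.of_reg hP hPD)
      (fun sw n => (hkey sw n).1) fun sw n => (hkey sw n).2

/-- The automorphism of the tower that lies over `(x, y) ↦ (y', x)`. -/
theorem exists_isAutomorphism (h : IsQRTTower k t B S ε l z) (hk : k ≠ 0) (ht : t ≠ 0) :
    ∃ F : Mor S S, F.IsAutomorphism ∧ ∀ s ∈ S.carrier, ∀ x y, genPoly k t x y ≠ 0 →
      ε s = pt x y → ε (F s) = pt (invol k t x y) x := by
  obtain ⟨T, hε, hTT⟩ := h.exists_swap hk ht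
  obtain ⟨I, hI, hII⟩ := h.exists_invol hk ht
  refine ⟨T.comp I, ⟨(T.comp I).isMorphism, _, (I.comp T).isMorphism, fun p hp => ?_,
    fun p hp => ?_⟩, fun s hs x y hg hs' => ?_⟩
  · change I (T (T (I p))) = p
    rw [hTT _ (I.isMorphism.1 hp), hII p hp]
  · change T (I (I (T p))) = p
    rw [hII _ (T.isMorphism.1 hp), hTT p hp]
  · change ε (T (I s)) = _
    rw [hε _ (I.isMorphism.1 hs), hI s hs (by rwa [hs', pt_mem_generalSet]), hs', involPt_pt,
      swapPt_pt]

end IsQRTTower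

/-! ### The birational map -/

/-- The maps `(x, y) ↦ (y', x)` and `(x, y) ↦ (y, x')`, for the two values of `sw`. -/
theorem exists_ratMap {k t : ℂ} (hk : k ≠ 0) (ht : t ≠ 0) (sw : Bool) :
    ∃ φ : RatMap P1P1 P1P1, ∀ ξ η : ℂ, 2 * t * ξ * η - (ξ ^ 2 - k ^ 2) ≠ 0 →
      mkPt sw (affPt ξ) (affPt η) ∈ φ.dom ∧
        φ (mkPt sw (affPt ξ) (affPt η)) = mkPt (!sw) (affPt ξ) (affPt (invol k t ξ η)) := by
  set A : Set (PSp (Fin 2 × Fin 2)) :=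
    P1P1.carrier ∩ {q | (cx sw q).rep 0 ≠ 0 ∧ (cy sw q).rep 0 ≠ 0} with hA
  have hx : IsRegularOn A (fun q => aff (cx sw q)) :=
    PReg.ratio ((reg_cx sw).mono Set.inter_subset_left) 1 0 fun q hq => hq.2.1
  have hy : IsRegularOn A (fun q => aff (cy sw q)) :=
    PReg.ratio ((reg_cy sw).mono Set.inter_subset_left) 1 0 fun q hq => hq.2.2
  have hw := (hx.pow 2).sub (IsRegularOn.const (k ^ 2))
  have hden := (((IsRegularOn.const (2 * t)).mul hx).mul hy).sub hw
  obtain ⟨W, hW, hAW⟩ := (relOpen_P1P1 sw 0 0).setOf_ne hden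
  have hG := isGeneralSet hk ht
  have hGW : generalSet k t ⊆ W := fun q hq => by
    refine (hAW.symm.subset ⟨hG.subset hq, ?_, ?_⟩).2
    · cases sw
      · exact hG.rep_ne q hq 0 0
      · exact (hG.rep_ne q hq 0 0).symm
    · obtain ⟨x, y, rfl, hg⟩ := exists_eq_pt hq
      obtain ⟨-, -, -, -, -, -, h1, h2⟩ := genPoly_ne_zero_iff.1 hg
      rw [cx_pt, cy_pt, aff_affPt, aff_affPt]
      cases sw
      · exact h1
      · convert h2 using 1
        simp only [cond_true]
        ring
  refine ⟨⟨W, hW, hG.dense hGW, fun q => mkPt (!sw) (affPt (aff (cx sw q)))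
    (affPt (invol k t (aff (cx sw q)) (aff (cy sw q)))), ?_⟩, fun ξ η h => ⟨?_, ?_⟩⟩
  · rw [hAW]
    have hsub : P1P1.carrier ∩ {q | q ∈ {q | (cx sw q).rep 0 ≠ 0 ∧ (cy sw q).rep 0 ≠ 0} ∧
      2 * t * aff (cx sw q) * aff (cy sw q) - (aff (cx sw q) ^ 2 - k ^ 2) ≠ 0} ⊆ A :=
      fun q hq => ⟨hq.1, hq.2.1⟩
    exact (reg_mkPt _ (reg_affPt (hx.mono hsub)) (reg_affPt (((hw.mul hy).mono hsub).div
      (hden.mono hsub) fun q hq => hq.2.2))).isMorphism fun q _ => mkPt_mem _ _ _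
  · refine (hAW.symm.subset ⟨mkPt_mem _ _ _, ?_, ?_⟩).2
    · simp only [Set.mem_ofPred_eq, cx_mkPt, cy_mkPt]
      exact ⟨affPt_rep_zero _, affPt_rep_zero _⟩
    · rwa [cx_mkPt, cy_mkPt, aff_affPt, aff_affPt]
  · change mkPt _ _ _ = _
    rw [cx_mkPt, cy_mkPt, aff_affPt, aff_affPt]

theorem invol_den_ne_zero {k t x y : ℂ} (h : genPoly k t x y ≠ 0) :
    2 * t * x * invol k t x y - (x ^ 2 - k ^ 2) ≠ 0 := by
  obtain ⟨-, -, -, -, -, e, he, he0, hi⟩ := general_facts rfl h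
  obtain ⟨-, -, hw, -⟩ := genPoly_ne_zero_iff.1 h
  have : 2 * t * x * invol k t x y - (x ^ 2 - k ^ 2) = (x ^ 2 - k ^ 2) ^ 2 / e := by
    rw [hi, eq_div_iff he0, sub_mul, mul_div_assoc', div_mul_cancel₀ _ he0, he]
    ring
  rw [this]
  exact div_ne_zero (pow_ne_zero _ hw) he0

/-- The map `(x, y) ↦ (y', x)` is birational. -/
theorem exists_isQRTMap {k t : ℂ} (hk : k ≠ 0) (ht : t ≠ 0) :
    ∃ φ : RatMap P1P1 P1P1, IsQRTMap k t φ ∧ φ.IsBirational ∧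
      ∀ x y, genPoly k t x y ≠ 0 → pt x y ∈ φ.dom ∧ φ (pt x y) = pt (invol k t x y) x := by
  obtain ⟨φ, hφ⟩ := exists_ratMap hk ht false
  obtain ⟨ψ, hψ⟩ := exists_ratMap hk ht true
  have hG := isGeneralSet hk ht
  obtain ⟨W, hW, hGW⟩ := hG.relOpen
  have hd : P1P1.carrier ⊆ closure (P1P1.carrier ∩ W) :=
    hG.dense fun q hq => (hGW.symm.subset ⟨hG.subset hq, hq⟩).2
  have hgen : ∀ x y, genPoly k t x y ≠ 0 →
      pt x y ∈ φ.dom ∧ φ (pt x y) = pt (invol k t x y) x := fun x y hg =>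
    hφ x y (genPoly_ne_zero_iff.1 hg).2.2.2.2.2.2.1
  refine ⟨φ, fun x y h => ?_, ⟨ψ, ⟨W, hW, hd, fun q hq => ?_⟩, ⟨W, hW, hd, fun q hq => ?_⟩⟩, hgen⟩
  · have h' : 2 * t * x * y - (x ^ 2 - k ^ 2) ≠ 0 := fun h0 => h (by linear_combination h0)
    have hi : (x - k) * (x + k) * y / (k ^ 2 - x ^ 2 + 2 * t * x * y) = invol k t x y := by
      rw [invol]
      congr 1 <;> ring
    rw [hi]
    exact hφ x y h'
  · obtain ⟨x, y, rfl, hg⟩ := exists_eq_pt (hGW.subset hq).2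
    obtain ⟨h1, h2⟩ := hgen x y hg
    obtain ⟨h3, h4⟩ := hψ x (invol k t x y) (invol_den_ne_zero hg)
    rw [invol_invol hg] at h4
    rw [h2]
    exact ⟨h1, h3, h4⟩
  · obtain ⟨x, y, rfl, hg⟩ := exists_eq_pt (hGW.subset hq).2
    rw [← genPoly_comm] at hg
    obtain ⟨-, -, -, -, -, -, h0, -⟩ := genPoly_ne_zero_iff.1 hg
    obtain ⟨h1, h2⟩ := hψ y x h0
    obtain ⟨h3, h4⟩ := hφ y (invol k t y x) (invol_den_ne_zero hg)
    rw [invol_invol hg] at h4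
    change pt x y ∈ ψ.dom ∧ ψ (pt x y) ∈ φ.dom ∧ φ (ψ (pt x y)) = pt x y
    rw [show ψ (pt x y) = pt y (invol k t y x) from h2]
    exact ⟨h1, h3, h4⟩

/-! ### The surface -/

theorem QuotientHasValue.congr {Y : ProjVariety} {ε : Mor Y P1P1}
    {f g f' g' : PSp (Fin 2 × Fin 2) → ℂ} {b : PSp Y.ι} {c : ℂ} (h : QuotientHasValue ε f g b c)
    (hf : ∀ x y, f' (pt x y) = f (pt x y)) (hg : ∀ x y, g' (pt x y) = g (pt x y)) :
    QuotientHasValue ε f' g' b c := by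
  obtain ⟨W, r, hW, hb, hr, hq, hrb⟩ := h
  refine ⟨W, r, hW, hb, hr, fun q hqW => ⟨(hq q hqW).1, ?_⟩, hrb⟩
  obtain ⟨⟨x, y, hxy⟩, h⟩ := hq q hqW
  rw [hxy] at h ⊢
  rw [hf, hg, h]

section Surface

variable (k t : ℂ)

/-- The blow-up of `ℙ¹ × ℙ¹` at the two centres over `(k, 0)`. -/
abbrev surface₂ : ProjVariety := twoExt P1P1 (idMor P1P1) false k t

/-- The morphism from `surface₂` to `ℙ¹ × ℙ¹`. -/
abbrev map₂ : Mor (surface₂ k t) P1P1 := twoMap P1P1 (idMor P1P1) false k t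

/-- The blow-up of `surface₂` at the two centres over `(-k, 0)`. -/
abbrev surface₄ : ProjVariety := twoExt (surface₂ k t) (map₂ k t) false (-k) t

/-- The morphism from `surface₄` to `ℙ¹ × ℙ¹`. -/
abbrev map₄ : Mor (surface₄ k t) P1P1 := twoMap (surface₂ k t) (map₂ k t) false (-k) t

/-- The blow-up of `surface₄` at the two centres over `(0, k)`. -/
abbrev surface₆ : ProjVariety := twoExt (surface₄ k t) (map₄ k t) true k t

/-- The morphism from `surface₆` to `ℙ¹ × ℙ¹`. -/
abbrev map₆ : Mor (surface₆ k t) P1P1 := twoMap (surface₄ k t) (map₄ k t) true k t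

/-- The blow-up of `surface₆` at the two centres over `(0, -k)`. -/
abbrev surface₈ : ProjVariety := twoExt (surface₆ k t) (map₆ k t) true (-k) t

/-- The morphism from `surface₈` to `ℙ¹ × ℙ¹`. -/
abbrev map₈ : Mor (surface₈ k t) P1P1 := twoMap (surface₆ k t) (map₆ k t) true (-k) t

end Surface

/-- The coordinates of the eight blow-ups. -/
theorem exists_isQRTTower {k t : ℂ} {B : Set (PSp (Fin 2 × Fin 2))}
    (h : IsTower (generalSet k t) B (surface₈ k t) (map₈ k t))
    (hB : ∀ q ∈ B, ∃ sw n, q = basePt sw (signed k n)) :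
    ∃ l z, IsQRTTower k t B (surface₈ k t) (map₈ k t) l z := by
  refine ⟨fun sw n p => bif sw then (bif n then ssnd (sfst p) else ssnd (sfst (sfst (sfst p))))
      else (bif n then ssnd (sfst (sfst (sfst (sfst (sfst p)))))
        else ssnd (sfst (sfst (sfst (sfst (sfst (sfst (sfst p)))))))),
    fun sw n p => bif sw then (bif n then ssnd p else ssnd (sfst (sfst p)))
      else (bif n then ssnd (sfst (sfst (sfst (sfst p))))
        else ssnd (sfst (sfst (sfst (sfst (sfst (sfst p))))))), h, hB, ?_, ?_⟩
  · intro sw n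
    cases sw <;> cases n
    · exact (((centreCoord_twoExt (X := P1P1) (ε := idMor P1P1)).twoExt).twoExt).twoExt
    · exact ((centreCoord_twoExt (X := surface₂ k t) (ε := map₂ k t)).twoExt).twoExt
    · exact (centreCoord_twoExt (X := surface₄ k t) (ε := map₄ k t)).twoExt
    · exact centreCoord_twoExt
  · intro D f₀ s hf hε hl hz
    have m₃ := fun q hq hqD => twoExt_mapsTo_base (hf q hq hqD)
    have m₂ := fun q hq hqD => twoExt_mapsTo_base (m₃ q hq hqD)
    have m₁ := fun q hq hqD => twoExt_mapsTo_base (m₂ q hq hqD)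
    have e₁ := ExtendsAt.twoExt m₁ hε (hl false false) (hz false false)
    have e₂ := ExtendsAt.twoExt m₂ e₁ (hl false true) (hz false true)
    have e₃ := ExtendsAt.twoExt m₃ e₂ (hl true false) (hz true false)
    exact ExtendsAt.twoExt hf e₃ (hl true true) (hz true true)

end ClassicalAG

end

open ClassicalAG

theorem mainTheorem5 (k t : ℂ) (hk0 : k ≠ 0) (hk1 : k ≠ 1) (hk2 : k ≠ -1) (ht : t ≠ 0) :
    ∃ φ : RatMap P1P1 P1P1, IsQRTMap k t φ ∧ φ.IsBirational ∧
      ∃ (X₁ X₂ X₃ X₄ X₅ X₆ X₇ S : ProjVariety)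
        (π₁ : Mor X₁ P1P1) (π₂ : Mor X₂ X₁) (π₃ : Mor X₃ X₂) (π₄ : Mor X₄ X₃)
        (π₅ : Mor X₅ X₄) (π₆ : Mor X₆ X₅) (π₇ : Mor X₇ X₆) (π₈ : Mor S X₇)
        (b₁ : PSp (Fin 2 × Fin 2)) (b₂ : PSp X₁.ι) (b₃ : PSp X₂.ι) (b₄ : PSp X₃.ι)
        (b₅ : PSp X₄.ι) (b₆ : PSp X₅.ι) (b₇ : PSp X₆.ι) (b₈ : PSp X₇.ι)
        (ε₁ : Mor X₁ P1P1) (ε₂ : Mor X₂ P1P1) (ε₃ : Mor X₃ P1P1) (ε₄ : Mor X₄ P1P1)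
        (ε₅ : Mor X₅ P1P1) (ε₆ : Mor X₆ P1P1) (ε₇ : Mor X₇ P1P1) (ε : Mor S P1P1),
        -- each surface is the blow-up of the previous one at a point
        IsPointBlowup π₁ b₁ ∧ IsPointBlowup π₂ b₂ ∧ IsPointBlowup π₃ b₃ ∧
        IsPointBlowup π₄ b₄ ∧ IsPointBlowup π₅ b₅ ∧ IsPointBlowup π₆ b₆ ∧
        IsPointBlowup π₇ b₇ ∧ IsPointBlowup π₈ b₈ ∧
        -- the composite morphisms to the product of two projective lines
        ε₁ = π₁ ∧ ε₂ = ε₁.comp π₂ ∧ ε₃ = ε₂.comp π₃ ∧ ε₄ = ε₃.comp π₄ ∧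
        ε₅ = ε₄.comp π₅ ∧ ε₆ = ε₅.comp π₆ ∧ ε₇ = ε₆.comp π₇ ∧ ε = ε₇.comp π₈ ∧
        -- the centres: four points of the affine chart and one infinitely near point over each
        b₁ = pt k 0 ∧
        (π₁ b₂ = b₁ ∧ QuotientHasValue ε₁ (fun z => xCoord z - k) yCoord b₂ t) ∧
        ε₂ b₃ = pt (-k) 0 ∧
        (π₃ b₄ = b₃ ∧ QuotientHasValue ε₃ (fun z => xCoord z + k) yCoord b₄ t) ∧
        ε₄ b₅ = pt 0 k ∧
        (π₅ b₆ = b₅ ∧ QuotientHasValue ε₅ (fun z => yCoord z - k) xCoord b₆ t) ∧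
        ε₆ b₇ = pt 0 (-k) ∧
        (π₇ b₈ = b₇ ∧ QuotientHasValue ε₇ (fun z => yCoord z + k) xCoord b₈ t) ∧
        -- the resulting surface, the birational morphism and the lift
        IsSmoothRationalSurface S ∧
        ε.toRatMap.IsBirational ∧
        ∃ F : Mor S S, F.IsAutomorphism ∧ LiftsTo ε φ F := by
  obtain ⟨φ, hφ, hbir, hφg⟩ := exists_isQRTMap hk0 ht
  have hG := isGeneralSet hk0 ht
  have hgen : ∀ sw, ∀ c, c ^ 2 = k ^ 2 → ∀ q ∈ generalSet k t, GeneralFor sw c t q :=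
    fun sw c hc q hq => generalFor hc sw hq
  have hneg : (-k) ^ 2 = k ^ 2 := neg_sq k
  have hkk : k ≠ -k := fun h => hk0 (self_eq_neg.1 h)
  -- at each step, the centre lies off the earlier ones because `k ≠ 0`
  obtain ⟨b₁, b₂, hb₁, hb₂, he₁, he₂, hv₁, h₁⟩ := hG.isTower.step hG.nonempty (sw := false) ht
    (hgen _ k rfl) (Set.notMem_empty _)
  obtain ⟨b₃, b₄, hb₃, hb₄, he₃, he₄, hv₂, h₂⟩ := h₁.step hG.nonempty (sw := false) ht
    (hgen _ (-k) hneg) (by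
      rintro (h | h)
      · exact hkk (pt_injective h).1.symm
      · exact h)
  obtain ⟨b₅, b₆, hb₅, hb₆, he₅, he₆, hv₃, h₃⟩ := h₂.step hG.nonempty (sw := true) ht
    (hgen _ k rfl) (by
      rintro (h | h | h)
      · exact hk0 (pt_injective h).2
      · exact hk0 (pt_injective h).2
      · exact h)
  obtain ⟨b₇, b₈, hb₇, hb₈, he₇, he₈, hv₄, h₄⟩ := h₃.step hG.nonempty (sw := true) ht
    (hgen _ (-k) hneg) (by
      rintro (h | h | h | h)
      · exact hkk (pt_injective h).2.symm
      · exact neg_ne_zero.2 hk0 (pt_injective h).2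
      · exact neg_ne_zero.2 hk0 (pt_injective h).2
      · exact h)
  obtain ⟨l, z, hQ⟩ := exists_isQRTTower h₄ (by
    rintro q (h | h | h | h | h)
    · exact ⟨true, true, h⟩
    · exact ⟨true, false, h⟩
    · exact ⟨false, true, h⟩
    · exact ⟨false, false, h⟩
    · exact h.elim)
  obtain ⟨F, hF, hFε⟩ := hQ.exists_isAutomorphism hk0 ht
  -- the surfaces and the morphisms are determined by the blow-ups `hb₁`, …, `hb₈`
  refine ⟨φ, hφ, hbir, _, _, _, _, _, _, _, _, _, _, _, _, _, _, _, _, b₁, b₂, b₃, b₄, b₅, b₆, b₇,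
    b₈, _, _, _, _, _, _, _, _, hb₁, hb₂, hb₃, hb₄, hb₅, hb₆, hb₇, hb₈, rfl, rfl, rfl, rfl, rfl,
    rfl, rfl, rfl, he₁, ⟨he₂, hv₁.congr ?_ ?_⟩, he₃, ⟨he₄, hv₂.congr ?_ ?_⟩, he₅,
    ⟨he₆, hv₃.congr ?_ ?_⟩, he₇, ⟨he₈, hv₄.congr ?_ ?_⟩, h₄.isSmoothRationalSurface hG,
    h₄.isBirational hG, F, hF, h₄.liftsTo hG fun p hp hpG => ?_⟩
  iterate 8
    · intro x y
      simp [xCoord_pt, yCoord_pt, cx_pt, cy_pt]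
  · obtain ⟨x, y, hxy, hg⟩ := exists_eq_pt hpG
    obtain ⟨hdom, hval⟩ := hφg x y hg
    obtain ⟨hx, -, hxk, -⟩ := genPoly_ne_zero_iff.1 hg
    rw [hxy, hval]
    exact ⟨hdom, (hQ.pt_notMem hx (sub_ne_zero.1 hxk)).2, hFε p hp x y hg hxy⟩
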